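/- Let $R$ be a commutative ring. A \emph{DG $R$-algebra} is a non-negatively graded $R$-algebra $A=\bigoplus_{i\ge 0}A_i$ with $ab=(-1)^{|a||b|}ba$ for homogeneous $a,b$ and $a^2=0$ for homogeneous $a$ of odd degree, together with an $R$-linear differential $d$ of degree $-1$ with $d^2=0$ and $d(ab)=d(a)b+(-1)^{|a|}a\,d(b)$. DG modules are right DG modules, graded by $\mathbb Z$, with differential of degree $-1$ satisfying $\partial(xa)=\partial(x)a+(-1)^{|x|}x\,d(a)$. A DG $R$-algebra is a \emph{divided power} DG $R$-algebra if each homogeneous $u$ of positive even degree has elements $u^{(i)}$ ($i\ge 0$) with: $u^{(0)}=1$, $u^{(1)}=u$, $|u^{(i)}|=i|u|$; $u^{(i)}u^{(j)}=\binom{i+j}{i}u^{(i+j)}$; $(u+v)^{(i)}=\sum_j u^{(j)}v^{(i-j)}$ for $|u|=|v|$; for $i\ge 2$, $(vw)^{(i)}=0$ if $|v|,|w|$ are odd and $(vw)^{(i)}=v^iw^{(i)}$ if $|v|$ is even and $|w|$ is even and positive; and $(u^{(i)})^{(j)}=\frac{(ij)!}{j!(i!)^j}u^{(ij)}$ for $i\ge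 1$, $j\ge 0$. Let $n$ be a positive integer and let $A\to B$ be one of the following extensions of DG $R$-algebras. (a) $B=A[X_1,\dots,X_n]$ is a polynomial extension: the $X_i\in B$ are homogeneous of positive degrees, the monomials $X_1^{m_1}\cdots X_n^{m_n}$ (with $m_i\ge 0$, and $m_i\le 1$ if $|X_i|$ is odd) form a basis of the underlying graded $A$-module of $B$, and $d(X_i)$ lies in $A[X_1,\dots,X_{i-1}]$ for each $i$. (b) $A$ is a divided power DG $R$-algebra and $B=A\langle X_1,\dots,X_n\rangle$ is a free extension: there are homogeneous elements $X_i^{(m)}\in B$ with $X_i^{(0)}=1$, $X_i^{(1)}=X_i$, $|X_i|>0$, $|X_i^{(m)}|=m|X_i|$; if $|X_i|$ is odd, then $X_i^{(m)}=0$ for $m\ge 2$; if $|X_i|$ is even, then $X_i^{(m)}X_i^{(l)}=\binom{m+l}{m}X_i^{(m+l)}$ and $d(X_i^{(m)})=X_i^{(m-1)}d(X_i)$ for $m\ge 1$; the monomials $X_1^{(m_1)}\cdots X_n^{(m_n)}$ (with $m_i\le 1$ if $|X_i|$ is odd) form a basis of the underlying graded $A$-module of $B$; and $d(X_i)$ lies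 in $A\langle X_1,\dots,X_{i-1}\rangle$ for each $i$. Let $N$ be a bounded below semifree DG $B$-module (that is, $N_i=0$ for $i\ll 0$, and $N$ has a well-ordered homogeneous basis $F$ over $B$ with $\partial(f)\in\sum_{e<f}eB$ for all $f\in F$), and suppose that $\operatorname{Ext}^i_B(N,N)=H_{-i}(\operatorname{Hom}_B(N,N))=0$ for all $i>0$. Then: (1) $N$ is \emph{naïvely liftable} to $A$: the DG $B$-module epimorphism $\pi_N\colon N|_A\otimes_A B\to N$, $\pi_N(x\otimes b)=xb$, where $N|_A$ is $N$ regarded as a DG $A$-module, has a right inverse in the category of DG $B$-modules. (2) $N$ is a direct summand of a DG $B$-module $N'$ that is \emph{liftable} to $A$, that is, $N'\cong M\otimes^{\mathbf L}_A B$ in the derived category $\mathcal D(B)$ for some DG $A$-module $M$. -/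

import Mathlib

open CategoryTheory
open scoped TensorProduct RightActions

universe u v

namespace DGLift

/-! ### Gradings -/

section Grading

variable {R : Type v} [CommRing R] {M : Type u} [AddCommGroup M] [Module R M]
  {Z : Type u} [AddCommGroup Z] [Module R Z]

/-- Two linear maps that agree on homogeneous elements are equal. -/
theorem eq_of_homogeneous {gr : ℤ → Submodule R M} (h : DirectSum.IsInternal gr)
    {f g : M →ₗ[R] Z} (hfg : ∀ i, ∀ x ∈ gr i, f x = g x) : f = g := by
  have htop := h.submodule_iSup_eq_top
  have hle : (⨆ i, gr i) ≤ LinearMap.eqLocus f g := iSup_le fun i x hx => hfg i x hx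
  ext x
  exact hle (htop ▸ Submodule.mem_top)

/-- The isomorphism `⨁ gr i ≃ M`. -/
noncomputable def gradedEquiv {gr : ℤ → Submodule R M} (h : DirectSum.IsInternal gr) :
    (DirectSum ℤ fun i => gr i) ≃ₗ[R] M :=
  LinearEquiv.ofBijective (DirectSum.coeLinearMap gr)
    (show Function.Bijective (DirectSum.coeLinearMap gr) from h)

/-- The linear map out of `M = ⨁ gr i` that is `F i` on `gr i`. -/
noncomputable def assemble {gr : ℤ → Submodule R M} (h : DirectSum.IsInternal gr)
    (F : ℤ → M →ₗ[R] Z) : M →ₗ[R] Z :=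
  (DirectSum.toModule R ℤ Z fun i => (F i).comp (gr i).subtype).comp
    (gradedEquiv h).symm.toLinearMap

theorem assemble_of_mem {gr : ℤ → Submodule R M} (h : DirectSum.IsInternal gr)
    (F : ℤ → M →ₗ[R] Z) {i : ℤ} {x : M} (hx : x ∈ gr i) : assemble h F x = F i x := by
  have : (gradedEquiv h).symm x = DirectSum.lof R ℤ (fun i => gr i) i ⟨x, hx⟩ := by
    rw [LinearEquiv.symm_apply_eq]
    exact (DirectSum.coeLinearMap_lof gr i ⟨x, hx⟩).symm
  simp [assemble, this]

/-- The sign operator `x ↦ (-1)^|x| x`. -/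
noncomputable def signOp {gr : ℤ → Submodule R M} (h : DirectSum.IsInternal gr) : M →ₗ[R] M :=
  assemble h fun i => (i.negOnePow : ℤ) • LinearMap.id

theorem signOp_of_mem {gr : ℤ → Submodule R M} (h : DirectSum.IsInternal gr) {i : ℤ} {x : M}
    (hx : x ∈ gr i) : signOp h x = (i.negOnePow : ℤ) • x := by
  rw [signOp, assemble_of_mem h _ hx]
  rfl

/-- The projection `M → M` onto the component of degree `k`. -/
noncomputable def gproj {gr : ℤ → Submodule R M} (h : DirectSum.IsInternal gr) (k : ℤ) :
    M →ₗ[R] M :=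
  assemble h fun i => if i = k then LinearMap.id else 0

theorem gproj_of_mem {gr : ℤ → Submodule R M} (h : DirectSum.IsInternal gr) {i k : ℤ} {x : M}
    (hx : x ∈ gr i) : gproj h k x = if i = k then x else 0 := by
  rw [gproj, assemble_of_mem h _ hx]
  split_ifs <;> rfl

theorem isInternal_of_proj (gr : ℤ → Submodule R M) (p : ℤ → M →ₗ[R] M)
    (h1 : ∀ n, ∀ x ∈ gr n, p n x = x) (h2 : ∀ n k, k ≠ n → ∀ x ∈ gr k, p n x = 0)
    (htop : (⨆ i, gr i) = ⊤) : DirectSum.IsInternal gr := by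
  rw [DirectSum.isInternal_submodule_iff_iSupIndep_and_iSup_eq_top]
  refine ⟨?_, htop⟩
  rw [iSupIndep_def]
  intro n
  rw [Submodule.disjoint_def]
  intro x hx hx'
  have hle : (⨆ j, ⨆ (_ : j ≠ n), gr j) ≤ LinearMap.ker (p n) :=
    iSup_le fun j => iSup_le fun hj y hy => h2 n j hj y hy
  rw [← h1 n x hx]
  exact hle hx'

end Grading

/-! ### DG algebras -/

/-- A strongly commutative, non-negatively graded DG `R`-algebra. The grading is indexed by `ℤ`,
with vanishing components in negative degrees; the differential has degree `-1`. -/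
structure DGAlg (R : Type v) [CommRing R] where
  carrier : Type u
  [ring : Ring carrier]
  [algebra : Algebra R carrier]
  gr : ℤ → Submodule R carrier
  isInternal : DirectSum.IsInternal gr
  gr_neg : ∀ i, i < 0 → gr i = ⊥
  one_mem : (1 : carrier) ∈ gr 0
  mul_mem : ∀ {i j : ℤ} {a b : carrier}, a ∈ gr i → b ∈ gr j → a * b ∈ gr (i + j)
  mul_comm_sign : ∀ {i j : ℤ} {a b : carrier}, a ∈ gr i → b ∈ gr j →
    a * b = ((i * j).negOnePow : ℤ) • (b * a)
  mul_self_odd : ∀ {i : ℤ} {a : carrier}, Odd i → a ∈ gr i → a * a = 0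
  d : carrier →ₗ[R] carrier
  d_mem : ∀ {i : ℤ} {a : carrier}, a ∈ gr i → d a ∈ gr (i - 1)
  d_d : ∀ a : carrier, d (d a) = 0
  leibniz : ∀ {i : ℤ} {a : carrier}, a ∈ gr i → ∀ b : carrier,
    d (a * b) = d a * b + (i.negOnePow : ℤ) • (a * d b)

attribute [instance] DGAlg.ring DGAlg.algebra

variable {R : Type v} [CommRing R]

instance : CoeSort (DGAlg.{u} R) (Type u) := ⟨DGAlg.carrier⟩

/-- A homomorphism of DG `R`-algebras. -/
structure DGAlg.Hom (A B : DGAlg.{u} R) where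
  toAlgHom : A →ₐ[R] B
  map_mem : ∀ {i : ℤ} {a : A}, a ∈ A.gr i → toAlgHom a ∈ B.gr i
  map_d : ∀ a : A, toAlgHom (A.d a) = B.d (toAlgHom a)

instance (A B : DGAlg.{u} R) : CoeFun (DGAlg.Hom A B) (fun _ => A → B) := ⟨fun f => f.toAlgHom⟩

/-- A divided power structure on the underlying graded algebra of `A`: `γ i u = u^{(i)}` is
meaningful for homogeneous `u` of positive even degree. -/
structure DividedPowerStructure (A : DGAlg.{u} R) where
  γ : ℕ → A → A
  γ_zero : ∀ {k : ℤ} {u : A}, 0 < k → Even k → u ∈ A.gr k → γ 0 u = 1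
  γ_one : ∀ {k : ℤ} {u : A}, 0 < k → Even k → u ∈ A.gr k → γ 1 u = u
  γ_mem : ∀ {k : ℤ} {u : A}, 0 < k → Even k → u ∈ A.gr k → ∀ i : ℕ, γ i u ∈ A.gr (i * k)
  γ_mul : ∀ {k : ℤ} {u : A}, 0 < k → Even k → u ∈ A.gr k → ∀ i j : ℕ,
    γ i u * γ j u = (i + j).choose i • γ (i + j) u
  γ_add : ∀ {k : ℤ} {u v : A}, 0 < k → Even k → u ∈ A.gr k → v ∈ A.gr k → ∀ i : ℕ,
    γ i (u + v) = ∑ j ∈ Finset.range (i + 1), γ j u * γ (i - j) v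
  γ_odd_mul_odd : ∀ {k l : ℤ} {v w : A}, Odd k → Odd l → v ∈ A.gr k → w ∈ A.gr l →
    ∀ i : ℕ, 2 ≤ i → γ i (v * w) = 0
  γ_even_mul_even : ∀ {k l : ℤ} {v w : A}, Even k → Even l → 0 < l → v ∈ A.gr k → w ∈ A.gr l →
    ∀ i : ℕ, 2 ≤ i → γ i (v * w) = v ^ i * γ i w
  -- the quotient of factorials is an exact division of natural numbers
  γ_γ : ∀ {k : ℤ} {u : A}, 0 < k → Even k → u ∈ A.gr k → ∀ i j : ℕ, 1 ≤ i →
    γ j (γ i u) =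
      ((i * j).factorial / (j.factorial * i.factorial ^ j)) • γ (i * j) u

/-! ### Polynomial and free extensions -/

/-- Exponents of monomials in variables of degrees `deg i`: a variable of odd degree occurs with
exponent at most one. -/
def Exponent {n : ℕ} (deg : Fin n → ℤ) : Type :=
  {m : Fin n → ℕ // ∀ i, Odd (deg i) → m i ≤ 1}

/-- The ordered product `P 1 (m 1) ⋯ P n (m n)`. -/
def monomial {n : ℕ} {B : Type u} [Ring B] (P : Fin n → ℕ → B) (m : Fin n → ℕ) : B :=
  (List.ofFn fun i => P i (m i)).prod

/-- The elements `monomial P m`, for `m` an exponent, form a basis of `B` as a right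
module over `A`, where `A` acts through `φ`. -/
def MonomialBasis {A B : DGAlg.{u} R} (φ : A.Hom B) {n : ℕ} (deg : Fin n → ℤ)
    (P : Fin n → ℕ → B) : Prop :=
  Function.Bijective fun c : Exponent deg →₀ A => c.sum fun m a => monomial P m.1 * φ a

/-- `φ : A → B` exhibits `B` as the polynomial extension `A[X 1, …, X n]`, where `|X i| = deg i`
is positive. The differential of `X i` is (automatically) a cycle and lies in
`A[X 1, …, X (i-1)]`. -/
structure IsPolynomialExtensionWith {A B : DGAlg.{u} R} (φ : A.Hom B) {n : ℕ} (deg : Fin n → ℤ)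
    (X : Fin n → B) : Prop where
  deg_pos : ∀ i, 0 < deg i
  mem : ∀ i, X i ∈ B.gr (deg i)
  basis : MonomialBasis φ deg fun i m => X i ^ m
  d_mem : ∀ i, B.d (X i) ∈ Algebra.adjoin R (Set.range φ ∪ {b | ∃ j, j < i ∧ b = X j})

/-- `φ : A → B` exhibits `B` as the free extension `A⟨X 1, …, X n⟩`, where `|X i| = deg i` is
positive; `X i m` is the divided power `X_i^{(m)}`, so that the variable is `X i 1`. The
differential of the variable is (automatically) a cycle and lies in `A⟨X 1, …, X (i-1)⟩`. -/
structure IsFreeExtensionWith {A B : DGAlg.{u} R} (φ : A.Hom B) {n : ℕ} (deg : Fin n → ℤ)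
    (X : Fin n → ℕ → B) : Prop where
  deg_pos : ∀ i, 0 < deg i
  mem : ∀ i (m : ℕ), X i m ∈ B.gr (m * deg i)
  zero : ∀ i, X i 0 = 1
  odd : ∀ i, Odd (deg i) → ∀ m, 2 ≤ m → X i m = 0
  even_mul : ∀ i, Even (deg i) → ∀ m l, X i m * X i l = (m + l).choose m • X i (m + l)
  basis : MonomialBasis φ deg X
  d_mem : ∀ i, B.d (X i 1) ∈ Algebra.adjoin R (Set.range φ ∪ {b | ∃ j m, j < i ∧ b = X j m})
  even_d : ∀ i, Even (deg i) → ∀ m, B.d (X i (m + 1)) = X i m * B.d (X i 1)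

/-- `B = A[X_1, …, X_n]` for some variables of positive degrees. -/
def IsPolynomialExtension {A B : DGAlg.{u} R} (φ : A.Hom B) (n : ℕ) : Prop :=
  ∃ (deg : Fin n → ℤ) (X : Fin n → B), IsPolynomialExtensionWith φ deg X

/-- `B = A⟨X_1, …, X_n⟩` for some variables of positive degrees. -/
def IsFreeExtension {A B : DGAlg.{u} R} (φ : A.Hom B) (n : ℕ) : Prop :=
  ∃ (deg : Fin n → ℤ) (X : Fin n → ℕ → B), IsFreeExtensionWith φ deg X

/-! ### DG modules -/

/-- A right DG `A`-module; `x <• a` denotes the right action. -/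
structure DGMod (A : DGAlg.{u} R) where
  carrier : Type u
  [addCommGroup : AddCommGroup carrier]
  [moduleBase : Module R carrier]
  [module : Module (A : Type u)ᵐᵒᵖ carrier]
  [isScalarTower : IsScalarTower R (A : Type u)ᵐᵒᵖ carrier]
  gr : ℤ → Submodule R carrier
  isInternal : DirectSum.IsInternal gr
  smul_mem : ∀ {i j : ℤ} {x : carrier} {a : A}, x ∈ gr i → a ∈ A.gr j → x <• a ∈ gr (i + j)
  d : carrier →ₗ[R] carrier
  d_mem : ∀ {i : ℤ} {x : carrier}, x ∈ gr i → d x ∈ gr (i - 1)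
  d_d : ∀ x : carrier, d (d x) = 0
  leibniz : ∀ {i : ℤ} {x : carrier}, x ∈ gr i → ∀ a : A,
    d (x <• a) = d x <• a + (i.negOnePow : ℤ) • (x <• A.d a)

attribute [instance] DGMod.addCommGroup DGMod.moduleBase DGMod.module DGMod.isScalarTower

namespace DGMod

instance (A : DGAlg.{u} R) : CoeSort (DGMod A) (Type u) := ⟨DGMod.carrier⟩

variable {A : DGAlg.{u} R}

/-- A homomorphism of DG modules: linear, of degree zero, commuting with the differentials. -/
@[ext]
structure Hom (M N : DGMod A) where
  toLinearMap : M →ₗ[(A : Type u)ᵐᵒᵖ] N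
  map_mem : ∀ {i : ℤ} {x : M}, x ∈ M.gr i → toLinearMap x ∈ N.gr i
  map_d : ∀ x : M, toLinearMap (M.d x) = N.d (toLinearMap x)

/-- The category of right DG `A`-modules. -/
instance : Category (DGMod A) where
  Hom M N := Hom M N
  id M := ⟨LinearMap.id, fun hx => hx, fun _ => rfl⟩
  comp f g := ⟨g.toLinearMap.comp f.toLinearMap, fun hx => g.map_mem (f.map_mem hx),
    fun x => by simp [f.map_d, g.map_d]⟩

/-- `M` is bounded below. -/
def IsBoundedBelow (M : DGMod A) : Prop := ∃ k : ℤ, ∀ i, i < k → M.gr i = ⊥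

/-- `M` has a semifree basis: a well-ordered homogeneous basis `e` over `A` such that `∂ (e i)`
lies in the span of the `e j` with `j < i`. -/
def IsSemifree (M : DGMod A) : Prop :=
  ∃ (ι : Type u) (_ : LinearOrder ι) (_ : WellFoundedLT ι)
    (e : Module.Basis ι (A : Type u)ᵐᵒᵖ M),
    (∀ i, ∃ k : ℤ, e i ∈ M.gr k) ∧
    ∀ i, M.d (e i) ∈ Submodule.span (A : Type u)ᵐᵒᵖ (e '' {j | j < i})

/-! #### Homology, quasi-isomorphisms and the derived category -/

/-- The homology `ker ∂ / im ∂`. -/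
abbrev Homology (M : DGMod A) : Type u :=
  LinearMap.ker M.d ⧸ (LinearMap.range M.d).submoduleOf (LinearMap.ker M.d)

/-- The map induced on cycles. -/
def Hom.cyclesMap {M N : DGMod A} (f : M ⟶ N) : LinearMap.ker M.d →ₗ[R] LinearMap.ker N.d :=
  (f.toLinearMap.restrictScalars R).restrict fun x hx => by
    have h : M.d x = 0 := hx
    have := f.map_d x
    rw [h, map_zero] at this
    exact this.symm

/-- The map induced on homology. -/
def Hom.homologyMap {M N : DGMod A} (f : M ⟶ N) : M.Homology →ₗ[R] N.Homology :=
  Submodule.mapQ _ _ (Hom.cyclesMap f) (by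
    rintro ⟨x, hx⟩ ⟨y, hy⟩
    exact ⟨f.toLinearMap y, (f.map_d y).symm.trans (congrArg f.toLinearMap hy)⟩)

/-- The class of quasi-isomorphisms. -/
def quasiIso (A : DGAlg.{u} R) : MorphismProperty (DGMod A) :=
  fun _ _ f => Function.Bijective (Hom.homologyMap f)

/-- The derived category: formally invert the quasi-isomorphisms. -/
abbrev Derived (A : DGAlg.{u} R) := (quasiIso A).Localization

/-- The localization functor. -/
abbrev toDerived (A : DGAlg.{u} R) : DGMod A ⥤ Derived A := (quasiIso A).Q

/-! #### Ext -/

theorem leibniz_signOp (M : DGMod A) (x : M) (a : A) :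
    M.d (x <• a) = M.d x <• a + signOp M.isInternal x <• A.d a := by
  have key := eq_of_homogeneous M.isInternal
    (f := M.d.comp (Algebra.lsmul R R M (MulOpposite.op a)))
    (g := (Algebra.lsmul R R M (MulOpposite.op a)).comp M.d
      + (Algebra.lsmul R R M (MulOpposite.op (A.d a))).comp (signOp M.isInternal))
    (fun i x hx => by
      simp only [LinearMap.comp_apply, LinearMap.add_apply, Algebra.lsmul_coe,
        signOp_of_mem M.isInternal hx]
      rw [M.leibniz hx a, smul_comm])
  simpa using LinearMap.congr_fun key x

/-- The graded `A`-linear maps `M → L` of degree `p`. -/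
def HomDeg (M L : DGMod A) (p : ℤ) : AddSubgroup (M →ₗ[(A : Type u)ᵐᵒᵖ] L) where
  carrier := {f | ∀ i, ∀ x ∈ M.gr i, f x ∈ L.gr (i + p)}
  zero_mem' := fun _ _ _ => zero_mem _
  add_mem' := fun hf hg i x hx => add_mem (hf i x hx) (hg i x hx)
  neg_mem' := fun hf i x hx => neg_mem (hf i x hx)

theorem signOp_homDeg {M L : DGMod A} {p : ℤ} {f : M →ₗ[(A : Type u)ᵐᵒᵖ] L}
    (hf : f ∈ HomDeg M L p) (x : M) :
    signOp L.isInternal (f x) = (p.negOnePow : ℤ) • f (signOp M.isInternal x) := by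
  have key := eq_of_homogeneous M.isInternal
    (f := (signOp L.isInternal).comp (f.restrictScalars R))
    (g := (p.negOnePow : ℤ) • (f.restrictScalars R).comp (signOp M.isInternal))
    (fun i x hx => by
      simp only [LinearMap.comp_apply, LinearMap.smul_apply, LinearMap.coe_restrictScalars,
        signOp_of_mem M.isInternal hx, signOp_of_mem L.isInternal (hf i x hx)]
      rw [map_zsmul, smul_smul, Int.negOnePow_add, Units.val_mul, mul_comm])
  simpa using LinearMap.congr_fun key x

/-- The differential `∂ f = ∂ ∘ f - (-1)^p f ∘ ∂` on maps of degree `p`. -/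
def homD (M L : DGMod A) (p : ℤ) : HomDeg M L p →+ (M →ₗ[(A : Type u)ᵐᵒᵖ] L) where
  toFun f :=
    { toFun := fun x => L.d (f.1 x) - (p.negOnePow : ℤ) • f.1 (M.d x)
      map_add' := fun x y => by simp only [map_add, smul_add]; abel
      map_smul' := fun a x => by
        obtain ⟨a, rfl⟩ := MulOpposite.op_surjective a
        simp only [map_smul, RingHom.id_apply, leibniz_signOp, signOp_homDeg f.2, map_add,
          smul_add, smul_sub]
        rw [smul_comm (MulOpposite.op a) (p.negOnePow : ℤ),
          smul_comm (MulOpposite.op (A.d a)) (p.negOnePow : ℤ)]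
        abel }
  map_zero' := by ext x; simp
  map_add' f g := by ext x; simp [smul_add]; abel

/-- The cycles of degree `p` of the complex `Hom_A(M, L)`. -/
def homCycles (M L : DGMod A) (p : ℤ) : AddSubgroup (M →ₗ[(A : Type u)ᵐᵒᵖ] L) :=
  (homD M L p).ker.map (HomDeg M L p).subtype

/-- The boundaries of degree `p` of the complex `Hom_A(M, L)`. -/
def homBoundaries (M L : DGMod A) (p : ℤ) : AddSubgroup (M →ₗ[(A : Type u)ᵐᵒᵖ] L) :=
  (homD M L (p + 1)).range

theorem homBoundaries_le_homCycles (M L : DGMod A) (p : ℤ) :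
    homBoundaries M L p ≤ homCycles M L p := by
  rintro _ ⟨f, rfl⟩
  have hmem : homD M L (p + 1) f ∈ HomDeg M L p := by
    intro i x hx
    refine sub_mem ?_ (zsmul_mem ?_ _)
    · have := L.d_mem (f.2 i x hx)
      rwa [← add_assoc, add_sub_cancel_right] at this
    · have := f.2 _ _ (M.d_mem hx)
      rwa [show i - 1 + (p + 1) = i + p by ring] at this
  refine ⟨⟨_, hmem⟩, ?_, rfl⟩
  ext x
  change L.d (L.d (f.1 x) - ((p + 1).negOnePow : ℤ) • f.1 (M.d x))
    - (p.negOnePow : ℤ) • (L.d (f.1 (M.d x)) - ((p + 1).negOnePow : ℤ) • f.1 (M.d (M.d x))) = 0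
  rw [map_sub, map_zsmul, L.d_d, M.d_d, Int.negOnePow_succ]
  simp

/-- `Ext^i_A(M, L) = H_{-i}(Hom_A(M, L))`, for `M` semifree. -/
abbrev Ext (M L : DGMod A) (i : ℤ) : Type u :=
  homCycles M L (-i) ⧸ (homBoundaries M L (-i)).addSubgroupOf (homCycles M L (-i))

/-- `N` is a direct summand of `N'`: there are a DG module `C` and homomorphisms `N → N'` and
`C → N'` that induce an isomorphism `N ⊕ C → N'`. -/
def IsDirectSummand (N N' : DGMod A) : Prop :=
  ∃ (C : DGMod A) (i : N ⟶ N') (j : C ⟶ N'),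
    Function.Bijective fun p : N × C => i.toLinearMap p.1 + j.toLinearMap p.2

end DGMod

/-! ### Restriction and extension of scalars -/

section BaseChange

variable {A B : DGAlg.{u} R} (φ : A.Hom B)

/-- `N|_A`: the DG `B`-module `N` regarded as a DG `A`-module via `φ`. -/
def restrict (N : DGMod B) : DGMod A :=
  letI : Module (A : Type u)ᵐᵒᵖ N := Module.compHom N φ.toAlgHom.toRingHom.op
  have hs : ∀ (a : (A : Type u)ᵐᵒᵖ) (x : N), a • x = x <• φ a.unop := fun _ _ => rfl
  { carrier := N
    isScalarTower := ⟨fun r a x => by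
      rw [hs, hs, MulOpposite.unop_smul, map_smul, MulOpposite.op_smul, smul_assoc]⟩
    gr := N.gr
    isInternal := N.isInternal
    smul_mem := fun hx ha => N.smul_mem hx (φ.map_mem ha)
    d := N.d
    d_mem := N.d_mem
    d_d := N.d_d
    leibniz := fun hx a => by
      have := N.leibniz hx (φ a)
      rw [← φ.map_d] at this
      exact this }

variable (M : DGMod A)

/-- The relations `x a ⊗ b = x ⊗ φ(a) b`. -/
def tensorRel : Submodule R (M ⊗[R] B) :=
  Submodule.span R {t | ∃ (x : M) (a : A) (b : B), t = (x <• a) ⊗ₜ[R] b - x ⊗ₜ[R] (φ a * b)}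

/-- The underlying `R`-module of `M ⊗_A B`. -/
abbrev TensorCarrier : Type u := (M ⊗[R] B) ⧸ tensorRel φ M

/-- The pure tensor `x ⊗ b` in `M ⊗_A B`. -/
def tmk (x : M) (b : B) : TensorCarrier φ M := Submodule.Quotient.mk (x ⊗ₜ[R] b)

theorem tmk_balanced (x : M) (a : A) (b : B) : tmk φ M (x <• a) b = tmk φ M x (φ a * b) :=
  (Submodule.Quotient.eq _).2 (Submodule.subset_span ⟨x, a, b, rfl⟩)

variable {φ M} in
theorem tensor_hom_ext {Z : Type u} [AddCommGroup Z] [Module R Z]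
    {f g : TensorCarrier φ M →ₗ[R] Z} (h : ∀ x b, f (tmk φ M x b) = g (tmk φ M x b)) : f = g := by
  apply Submodule.linearMap_qext
  ext x b
  exact h x b

/-- The linear map out of `M ⊗_A B` induced by an `A`-balanced bilinear map. -/
def tensorLift {Z : Type u} [AddCommGroup Z] [Module R Z] (F : M →ₗ[R] B →ₗ[R] Z)
    (hF : ∀ x a b, F (x <• a) b = F x (φ a * b)) : TensorCarrier φ M →ₗ[R] Z :=
  (tensorRel φ M).liftQ (TensorProduct.lift F) (by
    refine Submodule.span_le.2 ?_
    rintro _ ⟨x, a, b, rfl⟩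
    simp [hF])

@[simp]
theorem tensorLift_tmk {Z : Type u} [AddCommGroup Z] [Module R Z] (F : M →ₗ[R] B →ₗ[R] Z)
    (hF : ∀ x a b, F (x <• a) b = F x (φ a * b)) (x : M) (b : B) :
    tensorLift φ M F hF (tmk φ M x b) = F x b := by
  rfl

/-- The `R`-bilinear map `(x, b) ↦ x ⊗ b`. -/
def tmkBilin : M →ₗ[R] B →ₗ[R] TensorCarrier φ M :=
  (TensorProduct.mk R M B).compr₂ (tensorRel φ M).mkQ

@[simp]
theorem tmkBilin_apply (x : M) (b : B) : tmkBilin φ M x b = tmk φ M x b := rfl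

/-- Right multiplication `(x ⊗ b) ↦ (x ⊗ b) b'`. -/
def tensorAct (b' : B) : TensorCarrier φ M →ₗ[R] TensorCarrier φ M :=
  tensorLift φ M ((tmkBilin φ M).compl₂ (LinearMap.mulRight R b')) (fun x a b => by
    simp [tmk_balanced, mul_assoc])

@[simp]
theorem tensorAct_tmk (b' : B) (x : M) (b : B) :
    tensorAct φ M b' (tmk φ M x b) = tmk φ M x (b * b') := by
  simp [tensorAct]

/-- The right `B`-action on `M ⊗_A B`. -/
def tensorActHom : (B : Type u)ᵐᵒᵖ →+* Module.End R (TensorCarrier φ M) where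
  toFun b := tensorAct φ M b.unop
  map_one' := tensor_hom_ext fun x b => by simp
  map_mul' b c := tensor_hom_ext fun x b => by simp [mul_assoc]
  map_zero' := tensor_hom_ext fun x b => by
    simp only [MulOpposite.unop_zero, tensorAct_tmk, mul_zero]
    exact map_zero (tmkBilin φ M x)
  map_add' b c := tensor_hom_ext fun x b => by
    simp only [MulOpposite.unop_add, tensorAct_tmk, mul_add, LinearMap.add_apply]
    exact map_add (tmkBilin φ M x) _ _

instance tensorModule : Module (B : Type u)ᵐᵒᵖ (TensorCarrier φ M) :=
  Module.compHom _ (tensorActHom φ M)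

theorem tensor_smul_def (t : TensorCarrier φ M) (b : B) : t <• b = tensorAct φ M b t := rfl

@[simp]
theorem tmk_smul (x : M) (b b' : B) : tmk φ M x b <• b' = tmk φ M x (b * b') :=
  tensorAct_tmk φ M b' x b

instance tensorTower : IsScalarTower R (B : Type u)ᵐᵒᵖ (TensorCarrier φ M) where
  smul_assoc r b t := by
    obtain ⟨b, rfl⟩ := MulOpposite.op_surjective b
    have : tensorAct φ M (r • b) = r • tensorAct φ M b := tensor_hom_ext fun x c => by
      simp only [tensorAct_tmk, mul_smul_comm, LinearMap.smul_apply]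
      exact map_smul (tmkBilin φ M x) _ _
    exact LinearMap.congr_fun this t

/-- The elements of degree `n` of `M ⊗_A B`: sums of `x ⊗ b` with `|x| + |b| = n`. -/
def tensorGr (n : ℤ) : Submodule R (TensorCarrier φ M) :=
  Submodule.span R {t | ∃ (i j : ℤ) (x : M) (b : B),
    i + j = n ∧ x ∈ M.gr i ∧ b ∈ B.gr j ∧ t = tmk φ M x b}

variable {φ M} in
theorem tmk_mem {i j n : ℤ} (h : i + j = n) {x : M} {b : B} (hx : x ∈ M.gr i) (hb : b ∈ B.gr j) :
    tmk φ M x b ∈ tensorGr φ M n :=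
  Submodule.subset_span ⟨i, j, x, b, h, hx, hb, rfl⟩

variable {φ M} in
theorem tensor_hom_ext_homogeneous {Z : Type u} [AddCommGroup Z] [Module R Z]
    {f g : TensorCarrier φ M →ₗ[R] Z}
    (h : ∀ i j, ∀ x ∈ M.gr i, ∀ b ∈ B.gr j, f (tmk φ M x b) = g (tmk φ M x b)) : f = g := by
  have key : (tmkBilin φ M).compr₂ f = (tmkBilin φ M).compr₂ g := by
    refine eq_of_homogeneous M.isInternal fun i x hx => ?_
    exact eq_of_homogeneous B.isInternal fun j b hb => h i j x hx b hb
  exact tensor_hom_ext fun x b => LinearMap.congr_fun (LinearMap.congr_fun key x) b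

/-- The bilinear map sending `(x, b)` to the component of degree `n` of `x ⊗ b`. -/
noncomputable def tensorProjBilin (n : ℤ) : M →ₗ[R] B →ₗ[R] TensorCarrier φ M :=
  assemble M.isInternal fun i => (tmkBilin φ M).compl₂ (gproj B.isInternal (n - i))

theorem tensorProjBilin_of_mem (n : ℤ) {i : ℤ} {x : M} (hx : x ∈ M.gr i) (b : B) :
    tensorProjBilin φ M n x b = tmk φ M x (gproj B.isInternal (n - i) b) := by
  rw [tensorProjBilin, assemble_of_mem M.isInternal _ hx]
  rfl

theorem tensorProjBilin_balanced (n : ℤ) (x : M) (a : A) (b : B) :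
    tensorProjBilin φ M n (x <• a) b = tensorProjBilin φ M n x (φ a * b) := by
  have key : ∀ b : B, ∀ a : A, (tensorProjBilin φ M n).flip b ∘ₗ
        (Algebra.lsmul R R M (MulOpposite.op a))
      = (tensorProjBilin φ M n).flip (φ a * b) := by
    intro b a
    refine eq_of_homogeneous M.isInternal fun i x hx => ?_
    have h2 : (tensorProjBilin φ M n).flip b ∘ₗ
        ((Algebra.lsmul R R M).toLinearMap.flip x) ∘ₗ
          (MulOpposite.opLinearEquiv R : (A : Type u) ≃ₗ[R] (A : Type u)ᵐᵒᵖ).toLinearMap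
        = (tensorProjBilin φ M n x) ∘ₗ (LinearMap.mulRight R b) ∘ₗ
          φ.toAlgHom.toLinearMap := by
      refine eq_of_homogeneous A.isInternal fun j a ha => ?_
      have h3 : tensorProjBilin φ M n (x <• a)
          = (tensorProjBilin φ M n x) ∘ₗ (LinearMap.mulLeft R (φ a)) := by
        refine eq_of_homogeneous B.isInternal fun k b hb => ?_
        rw [LinearMap.comp_apply, tensorProjBilin_of_mem φ M n (M.smul_mem hx ha),
          tensorProjBilin_of_mem φ M n hx, tmk_balanced, gproj_of_mem _ hb, LinearMap.mulLeft_apply,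
          gproj_of_mem _ (B.mul_mem (φ.map_mem ha) hb)]
        by_cases h : k = n - (i + j)
        · rw [if_pos h, if_pos (by omega)]
        · rw [if_neg h, if_neg (by omega), mul_zero]
      exact LinearMap.congr_fun h3 b
    exact LinearMap.congr_fun h2 a
  exact LinearMap.congr_fun (key b a) x

/-- The projection to the component of degree `n` of `M ⊗_A B`. -/
noncomputable def tensorProj (n : ℤ) : TensorCarrier φ M →ₗ[R] TensorCarrier φ M :=
  tensorLift φ M (tensorProjBilin φ M n) (tensorProjBilin_balanced φ M n)

theorem tensorProj_tmk (n : ℤ) {i j : ℤ} {x : M} {b : B} (hx : x ∈ M.gr i) (hb : b ∈ B.gr j) :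
    tensorProj φ M n (tmk φ M x b) = if i + j = n then tmk φ M x b else 0 := by
  rw [tensorProj, tensorLift_tmk, tensorProjBilin_of_mem φ M n hx, gproj_of_mem _ hb]
  by_cases h : i + j = n
  · rw [if_pos h, if_pos (by omega)]
  · rw [if_neg h, if_neg (by omega), ← tmkBilin_apply, map_zero]

theorem tensorProj_self (n : ℤ) (t : TensorCarrier φ M) (ht : t ∈ tensorGr φ M n) :
    tensorProj φ M n t = t := by
  have hle : tensorGr φ M n ≤ LinearMap.eqLocus (tensorProj φ M n) LinearMap.id := by
    refine Submodule.span_le.2 ?_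
    rintro _ ⟨i, j, x, b, h, hx, hb, rfl⟩
    change tensorProj φ M n _ = _
    rw [tensorProj_tmk φ M n hx hb, if_pos h]
    rfl
  exact hle ht

theorem tensorProj_ne (n k : ℤ) (hk : k ≠ n) (t : TensorCarrier φ M)
    (ht : t ∈ tensorGr φ M k) : tensorProj φ M n t = 0 := by
  have hle : tensorGr φ M k ≤ LinearMap.ker (tensorProj φ M n) := by
    refine Submodule.span_le.2 ?_
    rintro _ ⟨i, j, x, b, h, hx, hb, rfl⟩
    change tensorProj φ M n _ = _
    rw [tensorProj_tmk φ M n hx hb, if_neg (by omega)]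
  exact hle ht

theorem tensorGr_isInternal : DirectSum.IsInternal (tensorGr φ M) := by
  refine isInternal_of_proj _ (tensorProj φ M) (tensorProj_self φ M) (tensorProj_ne φ M) ?_
  have key : (⨆ n, tensorGr φ M n).mkQ = 0 :=
    tensor_hom_ext_homogeneous fun i j x hx b hb => by
      rw [LinearMap.zero_apply, Submodule.mkQ_apply, Submodule.Quotient.mk_eq_zero]
      exact Submodule.mem_iSup_of_mem (i + j) (tmk_mem rfl hx hb)
  rw [← Submodule.ker_mkQ (⨆ n, tensorGr φ M n), key, LinearMap.ker_zero]

theorem signOp_smul (x : M) (a : A) :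
    signOp M.isInternal (x <• a) = signOp M.isInternal x <• signOp A.isInternal a := by
  have h1 : ∀ a : A, (signOp M.isInternal) ∘ₗ (Algebra.lsmul R R M (MulOpposite.op a))
      = (Algebra.lsmul R R M (MulOpposite.op (signOp A.isInternal a))) ∘ₗ
        (signOp M.isInternal) := by
    intro a
    refine eq_of_homogeneous M.isInternal fun i x hx => ?_
    have h2 : (signOp M.isInternal) ∘ₗ ((Algebra.lsmul R R M).toLinearMap.flip x) ∘ₗ
          (MulOpposite.opLinearEquiv R : (A : Type u) ≃ₗ[R] (A : Type u)ᵐᵒᵖ).toLinearMap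
        = ((Algebra.lsmul R R M).toLinearMap.flip (signOp M.isInternal x)) ∘ₗ
          (MulOpposite.opLinearEquiv R : (A : Type u) ≃ₗ[R] (A : Type u)ᵐᵒᵖ).toLinearMap ∘ₗ
            (signOp A.isInternal) := by
      refine eq_of_homogeneous A.isInternal fun j a ha => ?_
      change signOp M.isInternal (x <• a) = signOp M.isInternal x <• signOp A.isInternal a
      rw [signOp_of_mem _ hx, signOp_of_mem _ ha, signOp_of_mem _ (M.smul_mem hx ha),
        Int.negOnePow_add, Units.val_mul, mul_smul, MulOpposite.op_smul, smul_assoc,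
        smul_comm (MulOpposite.op a) (i.negOnePow : ℤ), smul_comm (i.negOnePow : ℤ)]
    exact LinearMap.congr_fun h2 a
  exact LinearMap.congr_fun (h1 a) x

theorem signOp_map (a : A) :
    φ (signOp A.isInternal a) = signOp B.isInternal (φ a) := by
  have := eq_of_homogeneous A.isInternal
    (f := φ.toAlgHom.toLinearMap ∘ₗ signOp A.isInternal)
    (g := signOp B.isInternal ∘ₗ φ.toAlgHom.toLinearMap) fun i a ha => by
      simp [signOp_of_mem _ ha, signOp_of_mem _ (φ.map_mem ha)]
  exact LinearMap.congr_fun this a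

theorem DGAlg.leibniz_signOp (a b : B) :
    B.d (a * b) = B.d a * b + signOp B.isInternal a * B.d b := by
  have := eq_of_homogeneous B.isInternal
    (f := B.d ∘ₗ LinearMap.mulRight R b)
    (g := LinearMap.mulRight R b ∘ₗ B.d + LinearMap.mulRight R (B.d b) ∘ₗ signOp B.isInternal)
    fun i a ha => by
      simp only [LinearMap.comp_apply, LinearMap.add_apply, LinearMap.mulRight_apply,
        signOp_of_mem _ ha, B.leibniz ha, smul_mul_assoc]
  simpa using LinearMap.congr_fun this a

/-- The differential `∂ (x ⊗ b) = ∂ x ⊗ b + (-1)^|x| x ⊗ d b` of `M ⊗_A B`. -/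
noncomputable def tensorD : TensorCarrier φ M →ₗ[R] TensorCarrier φ M :=
  tensorLift φ M
    ((tmkBilin φ M).comp M.d + (tmkBilin φ M).compl₁₂ (signOp M.isInternal) B.d) (by
      intro x a b
      simp only [LinearMap.add_apply, LinearMap.comp_apply, LinearMap.compl₁₂_apply,
        M.leibniz_signOp, signOp_smul, DGAlg.leibniz_signOp, map_add, tmkBilin_apply,
        tmk_balanced, ← φ.map_d, ← signOp_map]
      rw [add_assoc])

theorem tensorD_tmk {i : ℤ} {x : M} (hx : x ∈ M.gr i) (b : B) :
    tensorD φ M (tmk φ M x b)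
      = tmk φ M (M.d x) b + (i.negOnePow : ℤ) • tmk φ M x (B.d b) := by
  simp only [tensorD, tensorLift_tmk, LinearMap.add_apply, LinearMap.comp_apply,
    LinearMap.compl₁₂_apply, signOp_of_mem _ hx, map_zsmul, LinearMap.smul_apply, tmkBilin_apply]

/-- The DG `B`-module `M ⊗_A B`, for a DG `A`-module `M`. -/
noncomputable def baseChange : DGMod B where
  carrier := TensorCarrier φ M
  gr := tensorGr φ M
  isInternal := tensorGr_isInternal φ M
  smul_mem := by
    intro n k t c ht hc
    have hle : tensorGr φ M n ≤ (tensorGr φ M (n + k)).comap (tensorAct φ M c) := by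
      refine Submodule.span_le.2 ?_
      rintro _ ⟨i, j, x, b, h, hx, hb, rfl⟩
      change tensorAct φ M c (tmk φ M x b) ∈ tensorGr φ M (n + k)
      rw [tensorAct_tmk]
      exact tmk_mem (by omega) hx (B.mul_mem hb hc)
    exact hle ht
  d := tensorD φ M
  d_mem := by
    intro n t ht
    have hle : tensorGr φ M n ≤ (tensorGr φ M (n - 1)).comap (tensorD φ M) := by
      refine Submodule.span_le.2 ?_
      rintro _ ⟨i, j, x, b, h, hx, hb, rfl⟩
      change tensorD φ M (tmk φ M x b) ∈ tensorGr φ M (n - 1)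
      rw [tensorD_tmk φ M hx]
      exact add_mem (tmk_mem (by omega) (M.d_mem hx) hb)
        (zsmul_mem (tmk_mem (by omega) hx (B.d_mem hb)) _)
    exact hle ht
  d_d := by
    have : tensorD φ M ∘ₗ tensorD φ M = 0 := tensor_hom_ext_homogeneous fun i j x hx b hb => by
      rw [LinearMap.comp_apply, tensorD_tmk φ M hx, map_add, map_zsmul, tensorD_tmk φ M hx,
        tensorD_tmk φ M (M.d_mem hx), M.d_d, B.d_d, Int.negOnePow_sub]
      simp [← tmkBilin_apply]
    exact fun t => LinearMap.congr_fun this t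
  leibniz := by
    intro n t ht c
    have hle : tensorGr φ M n ≤ LinearMap.eqLocus (tensorD φ M ∘ₗ tensorAct φ M c)
        (tensorAct φ M c ∘ₗ tensorD φ M + (n.negOnePow : ℤ) • tensorAct φ M (B.d c)) := by
      refine Submodule.span_le.2 ?_
      rintro _ ⟨i, j, x, b, rfl, hx, hb, rfl⟩
      change tensorD φ M (tensorAct φ M c (tmk φ M x b))
        = tensorAct φ M c (tensorD φ M (tmk φ M x b))
          + ((i + j).negOnePow : ℤ) • tensorAct φ M (B.d c) (tmk φ M x b)
      rw [tensorAct_tmk, tensorAct_tmk, tensorD_tmk φ M hx, tensorD_tmk φ M hx, map_add,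
        map_zsmul, tensorAct_tmk, tensorAct_tmk, B.leibniz hb, Int.negOnePow_add,
        Units.val_mul, mul_smul]
      simp only [← tmkBilin_apply, map_add, map_zsmul, smul_add]
      rw [add_assoc]
    exact hle ht

/-- The map `N|_A ⊗_A B → N`, `x ⊗ b ↦ x b`. -/
def counitLin (N : DGMod B) : TensorCarrier φ (restrict φ N) →ₗ[R] N :=
  tensorLift φ (restrict φ N)
    ((((Algebra.lsmul R R N).toLinearMap.comp
      (MulOpposite.opLinearEquiv R : (B : Type u) ≃ₗ[R] (B : Type u)ᵐᵒᵖ).toLinearMap).flip :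
        N →ₗ[R] B →ₗ[R] N))
    (fun x a b => by
      change MulOpposite.op b • MulOpposite.op (φ a) • (show N from x)
        = MulOpposite.op (φ a * b) • (show N from x)
      rw [MulOpposite.op_mul, mul_smul])

theorem counitLin_tmk (N : DGMod B) (x : N) (b : B) :
    counitLin φ N (tmk φ (restrict φ N) x b) = x <• b := rfl

/-- The homomorphism `π_N : N|_A ⊗_A B → N`, `x ⊗ b ↦ x b`, of DG `B`-modules. -/
noncomputable def counit (N : DGMod B) : baseChange φ (restrict φ N) ⟶ N where
  toLinearMap :=
    { toFun := counitLin φ N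
      map_add' := map_add (counitLin φ N)
      map_smul' := fun c t => by
        obtain ⟨c, rfl⟩ := MulOpposite.op_surjective c
        have : counitLin φ N ∘ₗ tensorAct φ (restrict φ N) c
            = (Algebra.lsmul R R N (MulOpposite.op c)) ∘ₗ counitLin φ N :=
          tensor_hom_ext fun x b => by
            rw [LinearMap.comp_apply, LinearMap.comp_apply, tensorAct_tmk]
            exact mul_smul (MulOpposite.op c) (MulOpposite.op b) (show N from x)
        exact LinearMap.congr_fun this t }
  map_mem := by
    intro n t ht
    have hle : tensorGr φ (restrict φ N) n ≤ (N.gr n).comap (counitLin φ N) := by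
      refine Submodule.span_le.2 ?_
      rintro _ ⟨i, j, x, b, rfl, hx, hb, rfl⟩
      exact N.smul_mem hx hb
    exact hle ht
  map_d := by
    have : counitLin φ N ∘ₗ tensorD φ (restrict φ N) = N.d ∘ₗ counitLin φ N :=
      tensor_hom_ext_homogeneous fun i j x hx b hb => by
        rw [LinearMap.comp_apply, LinearMap.comp_apply, tensorD_tmk φ _ hx, map_add, map_zsmul]
        exact (N.leibniz hx b).symm
    exact fun t => LinearMap.congr_fun this t

theorem counit_tmk (N : DGMod B) (x : N) (b : B) :
    (counit φ N).toLinearMap (show baseChange φ (restrict φ N) from tmk φ (restrict φ N) x b)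
      = x <• b := rfl

/-- `N` is naïvely liftable to `A`: the epimorphism `π_N : N|_A ⊗_A B → N` has a right inverse
in the category of DG `B`-modules. -/
def IsNaivelyLiftable (N : DGMod B) : Prop :=
  ∃ ρ : N ⟶ baseChange φ (restrict φ N), ρ ≫ counit φ N = 𝟙 N

/-- `N` is liftable to `A`: there is a DG `A`-module `M` with `M ⊗ᴸ_A B ≅ N` in the derived
category of `B`. Here `M ⊗ᴸ_A B` is computed by a semifree resolution `P → M`. -/
def IsLiftable (N : DGMod B) : Prop :=
  ∃ (M P : DGMod A) (q : P ⟶ M), P.IsSemifree ∧ DGMod.quasiIso A q ∧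
    Nonempty ((DGMod.toDerived B).obj (baseChange φ P) ≅ (DGMod.toDerived B).obj N)

end BaseChange

end DGLift

namespace DGLift

variable {R : Type v} [CommRing R]

/-! ### Graded modules -/

section Graded

variable {M : Type u} [AddCommGroup M] [Module R M] {gr : ℤ → Submodule R M}

/-! Let E = N|_A ⊗_A B. Besides its right B-action, E carries a left one, through the factor N, and
the two agree on A. For each variable X_i consider the operator T_i = 1⊗X_i - X_i⊗1 on E, with its
powers in case (a) or divided powers in case (b). Up to terms with fewer factors, a monomial T^m
acts as right multiplication by X^m, so E is also the direct sum of copies of N indexed by the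
monomials T^m (`Diagonal.bijective_cell`).

Give T_i the weight n - i, with i counted from 0. Since dX_i involves only earlier variables, which
are heavier, d(T_i) = 1⊗dX_i - dX_i⊗1 has weight larger than that of T_i. Hence filtering E by
weight gives DG submodules whose subquotients are direct sums of shifts of N by the degrees of the
monomials (`Diagonal.cellStructure`). The weight-zero quotient is N itself, the projection being π_N
(`Diagonal.mem_filt_one`).

A section of π_N is now found by obstruction theory. Start with a graded B-linear section that need
not commute with differentials; its boundary has values in positive weight. If the boundary of f has
values in weight at least K > 0, its coordinate at a monomial m of weight K is, up to sign, a cycle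
of Hom_B(N,N) representing a class in Ext^{1+|m|}_B(N,N) = 0. Subtracting bounding maps pushes the
boundary to weight K+1 (`CellStructure.exists_correction`). As N is bounded below and the variables
have positive degrees, large weights vanish in each fixed degree, so the corrections stabilise
degreewise to a chain map (`CellStructure.exists_hom`).

For (2), the section makes N a summand of N|_A ⊗_A B. Ordering the products of basis elements of N
with monomials suitably shows that N|_A is semifree over A (`isSemifree_restrict`), so this tensor
product is already the derived one. -/

theorem eq_top_of_gr_le (h : DirectSum.IsInternal gr) {S : Submodule R M}
    (hS : ∀ i, gr i ≤ S) : S = ⊤ :=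
  top_le_iff.1 (h.submodule_iSup_eq_top ▸ iSup_le hS)

theorem mem_of_gr_le (h : DirectSum.IsInternal gr) {S : Submodule R M}
    (hS : ∀ i, gr i ≤ S) (x : M) : x ∈ S :=
  eq_top_of_gr_le h hS ▸ Submodule.mem_top

theorem gproj_mem (h : DirectSum.IsInternal gr) (k : ℤ) (x : M) : gproj h k x ∈ gr k := by
  refine mem_of_gr_le h (S := (gr k).comap (gproj h k)) (fun i y hy => ?_) x
  rw [Submodule.mem_comap, gproj_of_mem h hy]
  split_ifs with hik
  · exact hik ▸ hy
  · exact zero_mem _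

theorem gproj_self (h : DirectSum.IsInternal gr) {k : ℤ} {x : M} (hx : x ∈ gr k) :
    gproj h k x = x := by
  rw [gproj_of_mem h hx, if_pos rfl]

/-- Turns a degree condition into a linear equation, so that degrees can be checked on generators.
-/
theorem mem_gr_of_gproj_eq (h : DirectSum.IsInternal gr) {k : ℤ} {x : M}
    (hx : gproj h k x = x) : x ∈ gr k := hx ▸ gproj_mem h k x

/-- The operator `x ↦ (-1)^(j|x|) x`. -/
noncomputable def twist (h : DirectSum.IsInternal gr) (j : ℤ) : M →ₗ[R] M :=
  assemble h fun i => ((j * i).negOnePow : ℤ) • LinearMap.id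

theorem twist_of_mem (h : DirectSum.IsInternal gr) (j : ℤ) {i : ℤ} {x : M}
    (hx : x ∈ gr i) : twist h j x = ((j * i).negOnePow : ℤ) • x := by
  rw [twist, assemble_of_mem h _ hx]
  rfl

theorem twist_mem (h : DirectSum.IsInternal gr) (j : ℤ) {i : ℤ} {x : M}
    (hx : x ∈ gr i) : twist h j x ∈ gr i := by
  rw [twist_of_mem h j hx]
  exact zsmul_mem hx _

theorem negOnePow_mul_self (i : ℤ) : (i.negOnePow : ℤ) * (i.negOnePow : ℤ) = 1 :=
  Int.units_coe_mul_self _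

theorem negOnePow_smul_smul (i : ℤ) (x : M) :
    (i.negOnePow : ℤ) • (i.negOnePow : ℤ) • x = x := by
  rw [smul_smul, negOnePow_mul_self, one_smul]

theorem twist_twist (h : DirectSum.IsInternal gr) (j : ℤ) (x : M) :
    twist h j (twist h j x) = x := by
  have : twist h j ∘ₗ twist h j = LinearMap.id := eq_of_homogeneous h fun i x hx => by
    rw [LinearMap.comp_apply, twist_of_mem h j hx, map_zsmul, twist_of_mem h j hx,
      negOnePow_smul_smul]
    rfl
  exact LinearMap.congr_fun this x

theorem twist_zero (h : DirectSum.IsInternal gr) (x : M) : twist h 0 x = x := by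
  have : twist h 0 = LinearMap.id := eq_of_homogeneous h fun i x hx => by
    rw [twist_of_mem h 0 hx]
    simp
  exact LinearMap.congr_fun this x

theorem twist_add (h : DirectSum.IsInternal gr) (j k : ℤ) (x : M) :
    twist h (j + k) x = twist h j (twist h k x) := by
  have : twist h (j + k) = twist h j ∘ₗ twist h k := eq_of_homogeneous h fun i x hx => by
    rw [LinearMap.comp_apply, twist_of_mem h _ hx, twist_of_mem h _ hx, map_zsmul,
      twist_of_mem h _ hx, smul_smul, add_mul, Int.negOnePow_add, Units.val_mul, mul_comm]
  exact LinearMap.congr_fun this x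

end Graded

/-! ### Ordered products -/

section OrderedProducts

/-- The weights `w i` record how far each factor shifts a filtration. Facts about a monomial
(leading term, weight, behaviour under the differential) follow from facts about single powers of
variables. -/
theorem prod_ofFn_induction {S : Type*} [Monoid S] (P : S → ℕ → Prop) (h1 : P 1 0)
    (hmul : ∀ s t k l, P s k → P t l → P (s * t) (k + l)) :
    ∀ {n : ℕ} (g : Fin n → S) (w : Fin n → ℕ), (∀ i, P (g i) (w i)) →
      P (List.ofFn g).prod (∑ i, w i)
  | 0, g, w, _ => by simpa using h1
  | n + 1, g, w, h => by
    rw [List.ofFn_succ, List.prod_cons, Fin.sum_univ_succ]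
    exact hmul _ _ _ _ (h 0) (prod_ofFn_induction P h1 hmul _ _ fun i => h i.succ)

/-- Two elements commute up to a sign. -/
def SignCommute {S : Type*} [Ring S] (x y : S) : Prop := ∃ ε : ℤˣ, x * y = (ε : ℤ) • (y * x)

/-- The factor `y` travels left past the factors of index larger than `i`, at the cost of a sign
each time. The sign is not computed: only submodules spanned by monomials matter later. -/
theorem prod_ofFn_mul {S : Type*} [Ring S] : ∀ {n : ℕ} (g : Fin n → S) (y : S)
    (_ : ∀ i, SignCommute (g i) y) (i : Fin n), ∃ ε : ℤˣ,
      (List.ofFn g).prod * y = (ε : ℤ) • (List.ofFn (Function.update g i (g i * y))).prod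
  | 0, _, _, _, i => i.elim0
  | n + 1, g, y, h, i => by
    rw [List.ofFn_succ, List.prod_cons, List.ofFn_succ, List.prod_cons]
    refine Fin.cases ?_ (fun i => ?_) i
    -- When the target is the first factor, `y` has to cross the whole tail.
    · have key : ∀ {n : ℕ} (g : Fin n → S), (∀ i, SignCommute (g i) y) → ∃ ε : ℤˣ,
          (List.ofFn g).prod * y = (ε : ℤ) • (y * (List.ofFn g).prod) := by
        intro n
        induction n with
        | zero => exact fun g _ => ⟨1, by simp⟩
        | succ n ih =>
          intro g h
          obtain ⟨ε, hε⟩ := ih (fun i => g i.succ) fun i => h i.succ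
          obtain ⟨ε', hε'⟩ := h 0
          refine ⟨ε * ε', ?_⟩
          rw [List.ofFn_succ, List.prod_cons, mul_assoc, hε, mul_smul_comm, ← mul_assoc, hε',
            smul_mul_assoc, smul_smul, mul_assoc, Units.val_mul]
      obtain ⟨ε, hε⟩ := key (fun i => g i.succ) fun i => h i.succ
      refine ⟨ε, ?_⟩
      simp only [Function.update_self, ne_eq, Fin.succ_ne_zero, not_false_eq_true,
        Function.update_of_ne]
      rw [mul_assoc, hε, mul_smul_comm, mul_assoc]
    · obtain ⟨ε, hε⟩ := prod_ofFn_mul (fun i => g i.succ) y (fun i => h i.succ) i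
      refine ⟨ε, ?_⟩
      have h0 : Function.update g i.succ (g i.succ * y) 0 = g 0 :=
        Function.update_of_ne (Fin.succ_ne_zero i).symm _ _
      have h1 : (fun k : Fin n => Function.update g i.succ (g i.succ * y) k.succ)
          = Function.update (fun k => g k.succ) i (g i.succ * y) :=
        Function.update_comp_eq_of_injective g (Fin.succ_injective n) i _
      rw [h0, h1, mul_assoc, hε, mul_smul_comm]

theorem prod_ofFn_update_zsmul {S : Type*} [Ring S] : ∀ {n : ℕ} (g : Fin n → S) (i : Fin n)
    (c : ℤ) (y : S), (List.ofFn (Function.update g i (c • y))).prod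
      = c • (List.ofFn (Function.update g i y)).prod
  | 0, _, i, _, _ => i.elim0
  | n + 1, g, i, c, y => by
    simp only [List.ofFn_succ, List.prod_cons]
    refine Fin.cases ?_ (fun i => ?_) i
    · simp [mul_assoc]
    · have h0 : ∀ z, Function.update g i.succ z 0 = g 0 := fun z =>
        Function.update_of_ne (Fin.succ_ne_zero i).symm _ _
      have h1 : ∀ z, (fun k : Fin n => Function.update g i.succ z k.succ)
          = Function.update (fun k => g k.succ) i z := fun z =>
        Function.update_comp_eq_of_injective g (Fin.succ_injective n) i _
      rw [h0, h0, h1, h1, prod_ofFn_update_zsmul, mul_smul_comm]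

theorem prod_ofFn_update_zero {S : Type*} [Ring S] {n : ℕ} (g : Fin n → S) (i : Fin n) :
    (List.ofFn (Function.update g i 0)).prod = 0 := by
  have := prod_ofFn_update_zsmul g i 0 0
  rwa [zero_smul, zero_smul] at this

end OrderedProducts

/-! ### Unitriangular families -/

/-- A family of maps `t i : N → E` that agrees with a family inducing an isomorphism `⨁ N ≃ E`
up to terms of smaller size also induces an isomorphism. -/
theorem bijective_of_unitriangular {I N E : Type*} [AddCommGroup N] [Module R N]
    [AddCommGroup E] [Module R E] (size : I → ℕ) (u t : I → N →ₗ[R] E)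
    (hu : Function.Bijective (Finsupp.lsum R u))
    (ht : ∀ i x, t i x - u i x ∈ ⨆ (j) (_ : size j < size i), LinearMap.range (u j)) :
    Function.Bijective (Finsupp.lsum R t) := by
  classical
  -- Surjectivity, by induction on size: `u i x` is `t i x` minus a combination of values of `u` of
  -- smaller size.
  have hle : ∀ k i, size i < k →
      LinearMap.range (u i) ≤ LinearMap.range (Finsupp.lsum R t) := by
    intro k
    induction k with
    | zero => exact fun i hi => absurd hi (Nat.not_lt_zero _)
    | succ k ih =>
      rintro i hi _ ⟨x, rfl⟩
      have h1 : t i x ∈ LinearMap.range (Finsupp.lsum R t) := ⟨Finsupp.single i x, by simp⟩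
      have h2 : t i x - u i x ∈ LinearMap.range (Finsupp.lsum R t) :=
        (iSup_le fun j => iSup_le fun hj => ih j (by omega) :
          (⨆ (j) (_ : size j < size i), LinearMap.range (u j)) ≤ _) (ht i x)
      simpa using sub_mem h1 h2
  refine ⟨?_, ?_⟩
  · rw [← LinearMap.ker_eq_bot, LinearMap.ker_eq_bot']
    intro c hc
    by_contra hne
    let e := LinearEquiv.ofBijective _ hu
    -- Injectivity: at an index of maximal size in the support, the error terms have no component,
    -- so that coefficient must vanish.
    obtain ⟨m, hm, hmax⟩ := c.support.exists_max_image size (Finsupp.support_nonempty_iff.2 hne)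
    have hsm : ∀ j, size j < size m →
        LinearMap.range (u j) ≤ LinearMap.ker (Finsupp.lapply m ∘ₗ e.symm.toLinearMap) := by
      rintro j hj _ ⟨x, rfl⟩
      have : u j x = e (Finsupp.single j x) := by simp [e]
      rw [LinearMap.mem_ker, LinearMap.comp_apply, this, LinearEquiv.coe_coe, e.symm_apply_apply,
        Finsupp.lapply_apply, Finsupp.single_eq_of_ne]
      rintro rfl
      exact lt_irrefl _ hj
    have hsum : Finsupp.lsum R t c = e c + c.sum fun i x => (t i x - u i x) := by
      simp only [e, LinearEquiv.ofBijective_apply, Finsupp.lsum_apply, Finsupp.sum,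
        ← Finset.sum_add_distrib]
      exact Finset.sum_congr rfl fun i _ => (add_sub_cancel _ _).symm
    have herr : (c.sum fun i x => (t i x - u i x))
        ∈ LinearMap.ker (Finsupp.lapply m ∘ₗ e.symm.toLinearMap) :=
      Submodule.sum_mem _ fun i hi => (iSup_le fun j => iSup_le fun hj =>
        hsm j (hj.trans_le (hmax i hi)) :
          (⨆ (j) (_ : size j < size i), LinearMap.range (u j)) ≤ _) (ht i _)
    have h0 := congrArg (Finsupp.lapply m ∘ₗ e.symm.toLinearMap : E →ₗ[R] N) (hsum.symm.trans hc)
    rw [map_add, LinearMap.mem_ker.1 herr, add_zero, map_zero, LinearMap.comp_apply,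
      LinearEquiv.coe_coe, e.symm_apply_apply] at h0
    exact Finsupp.mem_support_iff.1 hm h0
  · intro y
    obtain ⟨c, rfl⟩ := hu.2 y
    change _ ∈ LinearMap.range (Finsupp.lsum R t)
    rw [Finsupp.lsum_apply]
    exact Submodule.sum_mem _ fun i _ => hle _ i (Nat.lt_succ_self _) ⟨_, rfl⟩

/-! ### DG modules with a homogeneous basis -/

namespace DGMod

variable {A : DGAlg.{u} R}

/-- A homogeneous basis of the underlying graded module. -/
def HomogeneousBasis {ι : Type*} (M : DGMod A) (e : Module.Basis ι (A : Type u)ᵐᵒᵖ M)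
    (k : ι → ℤ) : Prop := ∀ i, e i ∈ M.gr (k i)

/-- Linear maps that agree on `e i <• a` for `a` homogeneous are equal. -/
theorem basis_hom_ext {ι : Type*} {M : DGMod A} (e : Module.Basis ι (A : Type u)ᵐᵒᵖ M)
    {Z : Type*} [AddCommGroup Z] [Module R Z] {f g : M →ₗ[R] Z}
    (h : ∀ i l, ∀ a ∈ A.gr l, f (e i <• a) = g (e i <• a)) : f = g := by
  have h' : ∀ i (a : A), f (e i <• a) = g (e i <• a) := fun i a => by
    refine mem_of_gr_le A.isInternal (S := LinearMap.eqLocus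
      (f ∘ₗ ((Algebra.lsmul R R M).toLinearMap.flip (e i)) ∘ₗ
        (MulOpposite.opLinearEquiv R : (A : Type u) ≃ₗ[R] (A : Type u)ᵐᵒᵖ).toLinearMap)
      (g ∘ₗ ((Algebra.lsmul R R M).toLinearMap.flip (e i)) ∘ₗ
        (MulOpposite.opLinearEquiv R : (A : Type u) ≃ₗ[R] (A : Type u)ᵐᵒᵖ).toLinearMap))
      (fun l a ha => h i l a ha) a
  ext x
  rw [← e.linearCombination_repr x, Finsupp.linearCombination_apply, Finsupp.sum, map_sum,
    map_sum]
  exact Finset.sum_congr rfl fun i _ => h' i (MulOpposite.unop (e.repr x i))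

/-- Homogeneity amounts to commuting with the projections onto degrees `i` and `i + p`, which is
tested on the elements `e j <• a`. -/
theorem constr_mem_homDeg {ι : Type*} {M L : DGMod A} (e : Module.Basis ι (A : Type u)ᵐᵒᵖ M)
    {k : ι → ℤ} (he : M.HomogeneousBasis e k) (p : ℤ) (y : ι → L)
    (hy : ∀ i, y i ∈ L.gr (k i + p)) : e.constr ℕ y ∈ HomDeg M L p := by
  intro i x hx
  have key : (e.constr ℕ y).restrictScalars R ∘ₗ gproj M.isInternal i
      = gproj L.isInternal (i + p) ∘ₗ (e.constr ℕ y).restrictScalars R := by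
    refine basis_hom_ext e fun j l a ha => ?_
    have h2 : e.constr ℕ y (e j <• a) = y j <• a := by rw [map_smul, e.constr_basis]
    have h3 : y j <• a ∈ L.gr (k j + p + l) := L.smul_mem (hy j) ha
    simp only [LinearMap.comp_apply, gproj_of_mem _ (M.smul_mem (he j) ha),
      LinearMap.coe_restrictScalars, h2, gproj_of_mem _ h3]
    by_cases hi : k j + l = i
    · rw [if_pos hi, if_pos (by omega), h2]
    · rw [if_neg hi, if_neg (by omega), map_zero]
  have := LinearMap.congr_fun key x
  simp only [LinearMap.comp_apply, gproj_self _ hx] at this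
  exact mem_gr_of_gproj_eq _ this.symm

/-- Vanishing of `Ext^i` means that cycles of degree `-i` are boundaries. -/
theorem exists_boundary {M L : DGMod A} {i : ℤ} (h : Subsingleton (Ext M L i))
    (f : M →ₗ[(A : Type u)ᵐᵒᵖ] L) (hf : f ∈ HomDeg M L (-i))
    (hd : ∀ x, L.d (f x) = ((-i).negOnePow : ℤ) • f (M.d x)) :
    ∃ g ∈ HomDeg M L (-i + 1), ∀ x,
      L.d (g x) - ((-i + 1).negOnePow : ℤ) • g (M.d x) = f x := by
  have hc : f ∈ homCycles M L (-i) := by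
    refine ⟨⟨f, hf⟩, ?_, rfl⟩
    ext x
    change L.d (f x) - _ = 0
    rw [hd x]
    exact sub_self _
  have := Subsingleton.elim (QuotientAddGroup.mk ⟨f, hc⟩ : Ext M L i) (QuotientAddGroup.mk 0)
  rw [QuotientAddGroup.eq] at this
  have h2 : -f ∈ homBoundaries M L (-i) := by
    simpa [AddSubgroup.mem_addSubgroupOf] using this
  obtain ⟨⟨g, hg⟩, hgf⟩ := neg_mem_iff.1 h2
  exact ⟨g, hg, fun x => LinearMap.congr_fun hgf x⟩

end DGMod

/-! ### DG modules filtered by shifted copies of another DG module -/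

namespace DGMod

/-- An isomorphism `⨁ N ≃ E` that describes a decreasing filtration of the DG module `E` whose
subquotients are direct sums of shifted copies of `N`, up to signs. -/
structure CellStructure {B : DGAlg.{u} R} (N E : DGMod B) (I : Type*) where
  wt : I → ℕ
  deg : I → ℤ
  equiv : (I →₀ N) ≃ₗ[R] E
  -- Ensures that the correction made in one weight is a finite sum.
  finite_wt : ∀ k, {m | wt m = k}.Finite
  bound : ℕ
  -- Large weight forces large degree; together with boundedness below of `N` this makes the
  -- filtration finite in each degree.
  wt_le : ∀ m, (wt m : ℤ) ≤ bound * deg m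
  single_mem : ∀ m i, ∀ x ∈ N.gr i, equiv (Finsupp.single m x) ∈ E.gr (i + deg m)
  -- Vanishing of all coordinates of weight at most `wt m` says that the error lies in strictly
  -- higher weight; likewise for the differential.
  single_smul : ∀ m x (b : B), ∀ m', wt m' ≤ wt m →
    equiv.symm (equiv (Finsupp.single m x) <• b - equiv (Finsupp.single m (x <• b))) m' = 0
  single_d : ∀ m x m', wt m' ≤ wt m →
    equiv.symm (E.d (equiv (Finsupp.single m x))
      - equiv (Finsupp.single m (((deg m).negOnePow : ℤ) • N.d x))) m' = 0

namespace CellStructure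

variable {B : DGAlg.{u} R} {N E : DGMod B} {I : Type*} (C : CellStructure N E I)

/-- The coordinate `m`. -/
noncomputable def coord (m : I) : E →ₗ[R] N := Finsupp.lapply m ∘ₗ C.equiv.symm.toLinearMap

theorem coord_single_self (m : I) (x : N) : C.coord m (C.equiv (Finsupp.single m x)) = x := by
  simp [coord]

theorem coord_single_ne {m m' : I} (h : m ≠ m') (x : N) :
    C.coord m' (C.equiv (Finsupp.single m x)) = 0 := by
  simp [coord, h]

theorem eq_sum (t : E) :
    t = ∑ m ∈ (C.equiv.symm t).support, C.equiv (Finsupp.single m (C.coord m t)) := by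
  conv_lhs => rw [← C.equiv.apply_symm_apply t, ← Finsupp.sum_single (C.equiv.symm t)]
  rw [Finsupp.sum, map_sum]
  rfl

theorem eq_zero_of_coord {t : E} (h : ∀ m, C.coord m t = 0) : t = 0 := by
  rw [C.eq_sum t]
  exact Finset.sum_eq_zero fun m _ => by rw [h, Finsupp.single_zero, map_zero]

/-- The filtration by weight. -/
noncomputable def filt (k : ℕ) : Submodule R E := ⨅ (m) (_ : C.wt m < k), LinearMap.ker (C.coord m)

theorem mem_filt {k : ℕ} {t : E} : t ∈ C.filt k ↔ ∀ m, C.wt m < k → C.coord m t = 0 := by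
  simp [filt]

theorem filt_mono {k l : ℕ} (h : k ≤ l) : C.filt l ≤ C.filt k := fun _ ht =>
  C.mem_filt.2 fun m hm => C.mem_filt.1 ht m (hm.trans_le h)

theorem single_mem_filt {k : ℕ} {m : I} (h : k ≤ C.wt m) (x : N) :
    C.equiv (Finsupp.single m x) ∈ C.filt k := C.mem_filt.2 fun m' hm' =>
  C.coord_single_ne (by rintro rfl; omega) x

theorem coord_mem (m : I) {i : ℤ} {t : E} (ht : t ∈ E.gr i) :
    C.coord m t ∈ N.gr (i - C.deg m) := by
  have key : gproj N.isInternal (i - C.deg m) ∘ₗ C.coord m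
      = C.coord m ∘ₗ gproj E.isInternal i := by
    suffices h : (gproj N.isInternal (i - C.deg m) ∘ₗ C.coord m) ∘ₗ C.equiv.toLinearMap
        = (C.coord m ∘ₗ gproj E.isInternal i) ∘ₗ C.equiv.toLinearMap by
      ext t
      have := LinearMap.congr_fun h (C.equiv.symm t)
      simpa using this
    refine Finsupp.lhom_ext' fun m' => eq_of_homogeneous N.isInternal fun j x hx => ?_
    simp only [LinearMap.comp_apply, Finsupp.lsingle_apply, LinearEquiv.coe_coe,
      gproj_of_mem _ (C.single_mem m' j x hx)]
    by_cases h : m' = m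
    · subst h
      rw [C.coord_single_self, gproj_of_mem _ hx]
      by_cases hj : j + C.deg m' = i
      · rw [if_pos hj, if_pos (by omega), C.coord_single_self]
      · rw [if_neg hj, if_neg (by omega), map_zero]
    · rw [C.coord_single_ne h, map_zero]
      split_ifs
      · rw [C.coord_single_ne h]
      · rw [map_zero]
  have := LinearMap.congr_fun key t
  simp only [LinearMap.comp_apply, gproj_self _ ht] at this
  exact mem_gr_of_gproj_eq _ this

/-- An operator that is diagonal up to terms of higher weight acts diagonally on the leading
terms of an element. -/
theorem coord_of_diagonal (G : E →ₗ[R] E) (g : I → N →ₗ[R] N)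
    (h : ∀ m x m', C.wt m' ≤ C.wt m →
      C.coord m' (G (C.equiv (Finsupp.single m x)) - C.equiv (Finsupp.single m (g m x))) = 0)
    {k : ℕ} {t : E} (ht : t ∈ C.filt k) {m : I} (hm : C.wt m ≤ k) :
    C.coord m (G t) = g m (C.coord m t) := by
  have h1 : ∀ m' ∈ (C.equiv.symm t).support,
      C.coord m (G (C.equiv (Finsupp.single m' (C.coord m' t))))
        = C.coord m (C.equiv (Finsupp.single m' (g m' (C.coord m' t)))) := fun m' hm' => by
    rw [← sub_eq_zero, ← map_sub]
    -- An index in the support of an element of `filt k` has weight at least `k`, hence at least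
    -- that of `m`.
    refine h _ _ _ (hm.trans ?_)
    by_contra hlt
    exact Finsupp.mem_support_iff.1 hm' (C.mem_filt.1 ht m' (by omega))
  conv_lhs => rw [C.eq_sum t, map_sum, map_sum, Finset.sum_congr rfl h1]
  rw [Finset.sum_eq_single m]
  · rw [C.coord_single_self]
  · intro m' _ hne
    exact C.coord_single_ne hne _
  · intro hm'
    rw [Finsupp.notMem_support_iff] at hm'
    have h0 : C.coord m t = 0 := hm'
    rw [h0, map_zero, Finsupp.single_zero, map_zero, map_zero]

/-- `equiv` is not B-linear, but on `filt k` the coordinates of weight at most `k` are. This makes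
the leading coordinates of the obstruction elements of Hom_B(N,N). -/
theorem coord_smul {k : ℕ} {t : E} (ht : t ∈ C.filt k) {m : I} (hm : C.wt m ≤ k) (b : B) :
    C.coord m (t <• b) = C.coord m t <• b :=
  C.coord_of_diagonal (Algebra.lsmul R R E (MulOpposite.op b))
    (fun _ => Algebra.lsmul R R N (MulOpposite.op b))
    (fun m x m' hm' => C.single_smul m x b m' hm') ht hm

theorem coord_d {k : ℕ} {t : E} (ht : t ∈ C.filt k) {m : I} (hm : C.wt m ≤ k) :
    C.coord m (E.d t) = ((C.deg m).negOnePow : ℤ) • N.d (C.coord m t) :=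
  C.coord_of_diagonal E.d (fun m => ((C.deg m).negOnePow : ℤ) • N.d)
    (fun m x m' hm' => C.single_d m x m' hm') ht hm

theorem smul_mem_filt {k : ℕ} {t : E} (ht : t ∈ C.filt k) (b : B) : t <• b ∈ C.filt k :=
  C.mem_filt.2 fun m hm => by
    rw [C.coord_smul ht hm.le, C.mem_filt.1 ht m hm, smul_zero]

theorem d_mem_filt {k : ℕ} {t : E} (ht : t ∈ C.filt k) : E.d t ∈ C.filt k :=
  C.mem_filt.2 fun m hm => by
    rw [C.coord_d ht hm.le, C.mem_filt.1 ht m hm, map_zero, smul_zero]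

/-- Guarantees that obstructions in positive weight lie in Ext groups of positive index. -/
theorem deg_pos {m : I} (h : 0 < C.wt m) : 0 < C.deg m := by
  have := C.wt_le m
  by_contra hneg
  have : (C.bound : ℤ) * C.deg m ≤ 0 :=
    mul_nonpos_of_nonneg_of_nonpos (Int.natCast_nonneg _) (by omega)
  omega

/-- Elements of a fixed degree and of large weight vanish. -/
theorem eq_zero_of_mem_filt {k₀ : ℤ} (hk₀ : ∀ i, i < k₀ → N.gr i = ⊥) {i : ℤ} {t : E}
    (ht : t ∈ E.gr i) {k : ℕ} (hk : C.bound * (i - k₀) < k) (htk : t ∈ C.filt k) : t = 0 := by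
  refine C.eq_zero_of_coord fun m => ?_
  by_cases hm : C.wt m < k
  · exact C.mem_filt.1 htk m hm
  · have h1 := C.coord_mem m ht
    have h2 := C.wt_le m
    -- A coordinate of weight at least `k` would have to lie in a degree where `N` vanishes.
    have h3 : i - C.deg m < k₀ := by
      by_contra hcon
      have : (C.bound : ℤ) * C.deg m ≤ C.bound * (i - k₀) :=
        mul_le_mul_of_nonneg_left (by omega) (Int.natCast_nonneg _)
      omega
    rw [hk₀ _ h3] at h1
    exact h1

variable {ι : Type*} {e : Module.Basis ι (B : Type u)ᵐᵒᵖ N} {k : ι → ℤ}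

/-- A graded linear map `N → E` that is a chain map up to weight `K` can be corrected to be a
chain map up to weight `K + 1`. -/
theorem exists_correction (he : N.HomogeneousBasis e k)
    (hExt : ∀ i : ℤ, 0 < i → Subsingleton (Ext N N i)) {K : ℕ} (hK : 0 < K)
    (f : HomDeg N E 0) (hf : ∀ x, E.d (f.1 x) - f.1 (N.d x) ∈ C.filt K) :
    ∃ f' : HomDeg N E 0, (∀ x, f'.1 x - f.1 x ∈ C.filt K) ∧
      ∀ x, E.d (f'.1 x) - f'.1 (N.d x) ∈ C.filt (K + 1) := by
  classical
  -- The obstruction is the boundary of `f`: a B-linear map of degree -1, itself a cycle, with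
  -- values in `filt K`.
  have hz : ∀ x, homD N E 0 f x = E.d (f.1 x) - f.1 (N.d x) := fun x => by
    change E.d (f.1 x) - _ = _
    simp
  have hzd : ∀ x, E.d (homD N E 0 f x) = - homD N E 0 f (N.d x) := fun x => by
    rw [hz, hz, map_sub, E.d_d, N.d_d, map_zero]
    abel
  have hzmem : ∀ i, ∀ x ∈ N.gr i, homD N E 0 f x ∈ E.gr (i - 1) := fun i x hx => by
    rw [hz]
    refine sub_mem ?_ ?_
    · simpa using E.d_mem (f.2 i x hx)
    · simpa using f.2 _ _ (N.d_mem hx)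
  have hzf : ∀ x, homD N E 0 f x ∈ C.filt K := fun x => hz x ▸ hf x
  have hg : ∀ m, ∃ g ∈ HomDeg N N (-C.deg m), C.wt m = K → ∀ x,
      N.d (g x) - ((C.deg m).negOnePow : ℤ) • g (N.d x)
        = ((C.deg m).negOnePow : ℤ) • C.coord m (homD N E 0 f x) := by
    intro m
    by_cases hm : C.wt m = K
    swap
    · exact ⟨0, zero_mem _, fun h => absurd h hm⟩
    -- Coordinate `m` of the obstruction is a map `N → N` of degree `-1 - deg m`, so the relevant
    -- group is Ext^{1 + deg m}.
    have hw : 0 < 1 + C.deg m := by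
      have := C.deg_pos (m := m) (by omega)
      omega
    -- The sign is that of the shift by `deg m`. With it, the equation for `g` says exactly that the
    -- boundary of the correction has the same coordinate `m` as the obstruction.
    let q : N →ₗ[(B : Type u)ᵐᵒᵖ] N :=
      { toFun := fun x => ((C.deg m).negOnePow : ℤ) • C.coord m (homD N E 0 f x)
        map_add' := fun x y => by simp only [map_add, smul_add]
        map_smul' := fun b x => by
          obtain ⟨b, rfl⟩ := MulOpposite.op_surjective b
          rw [map_smul, C.coord_smul (hzf x) hm.le, RingHom.id_apply, smul_comm] }
    obtain ⟨g, hg, hgd⟩ := exists_boundary (hExt _ hw) q (fun i x hx => by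
        have := C.coord_mem m (hzmem i x hx)
        rw [show i + -(1 + C.deg m) = i - 1 - C.deg m by ring]
        exact zsmul_mem this _) (fun x => by
        change N.d (((C.deg m).negOnePow : ℤ) • C.coord m (homD N E 0 f x))
          = _ • ((C.deg m).negOnePow : ℤ) • C.coord m (homD N E 0 f (N.d x))
        rw [map_zsmul, ← C.coord_d (hzf x) hm.le, hzd, map_neg, Int.negOnePow_neg, add_comm,
          Int.negOnePow_succ, Units.val_neg, neg_smul, negOnePow_smul_smul])
    have h1 : -(1 + C.deg m) + 1 = -C.deg m := by ring
    rw [h1] at hg hgd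
    rw [Int.negOnePow_neg] at hgd
    exact ⟨g, hg, fun _ => hgd⟩
  choose g hgmem hgd using hg
  let s : Finset I := (C.finite_wt K).toFinset
  have hs : ∀ m, m ∈ s ↔ C.wt m = K := fun m => by simp [s]
  -- As `equiv` respects the action only modulo higher weight, the formula need not be B-linear in a
  -- general argument. It is imposed on the basis and extended linearly; the coordinates of weight
  -- `K` are still the `g m`.
  let y : ι → E := fun i => ∑ m ∈ s, C.equiv (Finsupp.single m (g m (e i)))
  let h : N →ₗ[(B : Type u)ᵐᵒᵖ] E := e.constr ℕ y
  have hmem : h ∈ HomDeg N E 0 := constr_mem_homDeg e he 0 y fun i =>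
    Submodule.sum_mem _ fun m _ => by
      have := C.single_mem m _ _ (hgmem m _ _ (he i))
      rwa [show k i + -C.deg m + C.deg m = k i + 0 by ring] at this
  have hK0 : ∀ x, h x ∈ C.filt K := by
    let S : Submodule (B : Type u)ᵐᵒᵖ E :=
      { C.filt K with
        smul_mem' := fun b t ht => C.smul_mem_filt ht (MulOpposite.unop b) }
    have hr : LinearMap.range h ≤ S := by
      rw [e.constr_range, Submodule.span_le]
      rintro _ ⟨i, rfl⟩
      exact Submodule.sum_mem (C.filt K) fun m hm =>
        C.single_mem_filt ((hs m).1 hm).ge _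
    exact fun x => hr ⟨x, rfl⟩
  have hcoord : ∀ m, C.wt m = K → ∀ x, C.coord m (h x) = g m x := by
    intro m hm x
    let q : N →ₗ[(B : Type u)ᵐᵒᵖ] N :=
      { toFun := fun x => C.coord m (h x)
        map_add' := fun x y => by simp only [map_add]
        map_smul' := fun b x => by
          obtain ⟨b, rfl⟩ := MulOpposite.op_surjective b
          rw [map_smul, C.coord_smul (hK0 x) hm.le, RingHom.id_apply] }
    have hq : q = g m := e.ext fun i => by
      change C.coord m (h (e i)) = _
      rw [e.constr_basis, map_sum, Finset.sum_eq_single m]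
      · exact C.coord_single_self _ _
      · exact fun m' _ hne => C.coord_single_ne hne _
      · exact fun hns => absurd ((hs m).2 hm) hns
    exact LinearMap.congr_fun hq x
  refine ⟨f - ⟨h, hmem⟩, fun x => ?_, fun x => ?_⟩
  · have : (f - ⟨h, hmem⟩ : HomDeg N E 0).1 x - f.1 x = - h x := by
      change f.1 x - h x - f.1 x = _
      abel
    rw [this]
    exact neg_mem (hK0 x)
  · have hx : E.d ((f - ⟨h, hmem⟩ : HomDeg N E 0).1 x) - (f - ⟨h, hmem⟩ : HomDeg N E 0).1 (N.d x)
        = homD N E 0 f x - (E.d (h x) - h (N.d x)) := by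
      change E.d (f.1 x - h x) - (f.1 (N.d x) - h (N.d x)) = _
      rw [hz, map_sub]
      abel
    rw [hx]
    refine C.mem_filt.2 fun m hm => ?_
    rcases Nat.lt_succ_iff_lt_or_eq.1 hm with hm | hm
    · exact C.mem_filt.1 (sub_mem (hzf x) (sub_mem (C.d_mem_filt (hK0 x)) (hK0 _))) m hm
    -- In weight `K` the coordinate of the obstruction cancels against that of the boundary of `h`.
    · have h1 := hgd m hm x
      rw [map_sub, map_sub, C.coord_d (hK0 x) hm.le, hcoord m hm, hcoord m hm, sub_eq_zero]
      rw [← negOnePow_smul_smul (C.deg m) (C.coord m (homD N E 0 f x)), ← h1, smul_sub,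
        negOnePow_smul_smul]

/-- A graded linear map `N → E` that is a chain map modulo the first step of the filtration is
congruent to a homomorphism of DG modules. -/
theorem exists_hom (he : N.HomogeneousBasis e k) (hbb : N.IsBoundedBelow)
    (hExt : ∀ i : ℤ, 0 < i → Subsingleton (Ext N N i))
    (f : HomDeg N E 0) (hf : ∀ x, E.d (f.1 x) - f.1 (N.d x) ∈ C.filt 1) :
    ∃ ρ : N ⟶ E, ∀ x, ρ.toLinearMap x - f.1 x ∈ C.filt 1 := by
  obtain ⟨k₀, hk₀⟩ := hbb
  have step : ∀ (K : ℕ) (f : {f : HomDeg N E 0 //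
      ∀ x, E.d (f.1 x) - f.1 (N.d x) ∈ C.filt (K + 1)}), ∃ f' : {f : HomDeg N E 0 //
      ∀ x, E.d (f.1 x) - f.1 (N.d x) ∈ C.filt (K + 1 + 1)},
      ∀ x, f'.1.1 x - f.1.1 x ∈ C.filt (K + 1) := fun K f => by
    obtain ⟨f', h1, h2⟩ := C.exists_correction he hExt (Nat.succ_pos K) f.1 f.2
    exact ⟨⟨f', h2⟩, h1⟩
  choose next hnext using step
  let F : ∀ K : ℕ, {f : HomDeg N E 0 //
      ∀ x, E.d (f.1 x) - f.1 (N.d x) ∈ C.filt (K + 1)} := fun K =>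
    Nat.rec ⟨f, hf⟩ (fun K f => next K f) K
  let G : ℕ → N →ₗ[(B : Type u)ᵐᵒᵖ] E := fun K => (F K).1.1
  have hG : ∀ K x, G (K + 1) x - G K x ∈ C.filt (K + 1) := fun K x => hnext K (F K) x
  have hGmem : ∀ K i, ∀ x ∈ N.gr i, G K x ∈ E.gr i := fun K i x hx => by
    simpa using (F K).1.2 i x hx
  have hGd : ∀ K x, E.d (G K x) - G K (N.d x) ∈ C.filt (K + 1) := fun K => (F K).2
  have hG1 : ∀ K x, G K x - f.1 x ∈ C.filt 1 := by
    intro K x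
    induction K with
    | zero =>
      change f.1 x - f.1 x ∈ _
      rw [sub_self]
      exact zero_mem _
    | succ K ih =>
      have := add_mem (C.filt_mono (Nat.le_add_left 1 K) (hG K x)) ih
      rwa [sub_add_sub_cancel] at this
  -- From the index `b i` on, consecutive approximations agree in degree `i`, because `filt (K + 1)`
  -- vanishes there.
  let b : ℤ → ℕ := fun i => (C.bound * (i - k₀)).toNat
  have hb : ∀ {i : ℤ} {K : ℕ}, b i ≤ K → C.bound * (i - k₀) < (K + 1 : ℕ) := fun {i K} h => by
    have := Int.self_le_toNat (C.bound * (i - k₀))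
    have h' : ((b i : ℕ) : ℤ) ≤ K := by exact_mod_cast h
    push_cast
    change _ ≤ ((b i : ℕ) : ℤ) at this
    omega
  have hstable : ∀ {i : ℤ} {K : ℕ}, b i ≤ K → ∀ x ∈ N.gr i, G K x = G (b i) x := by
    intro i K hK x hx
    induction K, hK using Nat.le_induction with
    | base => rfl
    | succ K hK ih =>
      rw [← ih, ← sub_eq_zero]
      exact C.eq_zero_of_mem_filt hk₀ (sub_mem (hGmem (K + 1) i x hx) (hGmem K i x hx)) (hb hK)
        (hG K x)
  -- The limit of the approximations, taken separately in each degree.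
  let ρ₀ : N →ₗ[R] E := assemble N.isInternal fun i => (G (b i)).restrictScalars R
  have hρ : ∀ {i : ℤ} {K : ℕ}, b i ≤ K → ∀ x ∈ N.gr i, ρ₀ x = G K x := fun hK x hx => by
    rw [hstable hK x hx]
    exact assemble_of_mem _ _ hx
  have hsmul : ∀ x (a : B), ρ₀ (x <• a) = ρ₀ x <• a := by
    intro x a
    have h1 : ∀ a : B, ρ₀ ∘ₗ (Algebra.lsmul R R N (MulOpposite.op a))
        = (Algebra.lsmul R R E (MulOpposite.op a)) ∘ₗ ρ₀ := by
      intro a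
      refine eq_of_homogeneous N.isInternal fun i x hx => ?_
      have h2 : ρ₀ ∘ₗ ((Algebra.lsmul R R N).toLinearMap.flip x) ∘ₗ
            (MulOpposite.opLinearEquiv R : (B : Type u) ≃ₗ[R] (B : Type u)ᵐᵒᵖ).toLinearMap
          = ((Algebra.lsmul R R E).toLinearMap.flip (ρ₀ x)) ∘ₗ
            (MulOpposite.opLinearEquiv R : (B : Type u) ≃ₗ[R] (B : Type u)ᵐᵒᵖ).toLinearMap := by
        refine eq_of_homogeneous B.isInternal fun j a ha => ?_
        change ρ₀ (x <• a) = ρ₀ x <• a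
        -- A single approximation beyond both thresholds computes the limit on `x` and on `x a`, so
        -- its B-linearity passes to the limit.
        rw [hρ (le_max_left (b i) (b (i + j))) x hx,
          hρ (le_max_right (b i) (b (i + j))) _ (N.smul_mem hx ha), map_smul]
      exact LinearMap.congr_fun h2 a
    exact LinearMap.congr_fun (h1 a) x
  refine ⟨⟨{ toFun := ρ₀
             map_add' := map_add ρ₀
             map_smul' := fun a x => hsmul x (MulOpposite.unop a) }, ?_, ?_⟩, ?_⟩
  · intro i x hx
    change ρ₀ x ∈ _
    rw [hρ le_rfl x hx]
    exact hGmem _ i x hx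
  · intro x
    change ρ₀ (N.d x) = E.d (ρ₀ x)
    have : ρ₀ ∘ₗ N.d = E.d ∘ₗ ρ₀ := eq_of_homogeneous N.isInternal fun i x hx => by
      rw [LinearMap.comp_apply, LinearMap.comp_apply, hρ (le_max_left (b i) (b (i - 1))) x hx,
        hρ (le_max_right (b i) (b (i - 1))) _ (N.d_mem hx), ← sub_eq_zero, ← neg_eq_zero, neg_sub]
      exact C.eq_zero_of_mem_filt hk₀
        (sub_mem (E.d_mem (hGmem _ i x hx)) (hGmem _ _ _ (N.d_mem hx)))
        (hb (le_max_right (b i) (b (i - 1)))) (hGd _ x)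
    exact LinearMap.congr_fun this x
  · intro x
    change ρ₀ x - f.1 x ∈ _
    refine mem_of_gr_le N.isInternal
      (S := (C.filt 1).comap (ρ₀ - f.1.restrictScalars R)) (fun i x hx => ?_) x
    rw [Submodule.mem_comap, LinearMap.sub_apply, hρ le_rfl x hx]
    exact hG1 _ x

end CellStructure

end DGMod

/-! ### Signs in DG algebras -/

section Signs

variable {A B : DGAlg.{u} R} (φ : A.Hom B)

theorem DGAlg.mul_eq_twist_mul {i : ℤ} {a : B} (ha : a ∈ B.gr i) (c : B) :
    a * c = twist B.isInternal i c * a := by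
  have : LinearMap.mulLeft R a = LinearMap.mulRight R a ∘ₗ twist B.isInternal i :=
    eq_of_homogeneous B.isInternal fun j c hc => by
      simp only [LinearMap.mulLeft_apply, LinearMap.comp_apply, LinearMap.mulRight_apply,
        twist_of_mem _ _ hc, smul_mul_assoc, B.mul_comm_sign ha hc]
  exact LinearMap.congr_fun this c

theorem DGAlg.twist_mul (i : ℤ) (a b : B) :
    twist B.isInternal i (a * b) = twist B.isInternal i a * twist B.isInternal i b := by
  have h1 : ∀ b : B, twist B.isInternal i ∘ₗ LinearMap.mulRight R b
      = LinearMap.mulRight R (twist B.isInternal i b) ∘ₗ twist B.isInternal i := by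
    intro b
    refine eq_of_homogeneous B.isInternal fun j a ha => ?_
    have h2 : twist B.isInternal i ∘ₗ LinearMap.mulLeft R a
        = LinearMap.mulLeft R (twist B.isInternal i a) ∘ₗ twist B.isInternal i :=
      eq_of_homogeneous B.isInternal fun k b hb => by
        simp only [LinearMap.comp_apply, LinearMap.mulLeft_apply, twist_of_mem _ _ ha,
          twist_of_mem _ _ hb, twist_of_mem _ _ (B.mul_mem ha hb), mul_add, Int.negOnePow_add,
          Units.val_mul, smul_mul_assoc, mul_smul_comm, mul_smul]
        exact smul_comm _ _ _
    exact LinearMap.congr_fun h2 b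
  exact LinearMap.congr_fun (h1 b) a

theorem DGAlg.twist_one (i : ℤ) : twist B.isInternal i (1 : B) = 1 := by
  rw [twist_of_mem _ _ B.one_mem]
  simp

theorem DGAlg.Hom.map_twist (i : ℤ) (a : A) :
    φ (twist A.isInternal i a) = twist B.isInternal i (φ a) := by
  have : φ.toAlgHom.toLinearMap ∘ₗ twist A.isInternal i
      = twist B.isInternal i ∘ₗ φ.toAlgHom.toLinearMap :=
    eq_of_homogeneous A.isInternal fun j a ha => by
      simp only [LinearMap.comp_apply, AlgHom.toLinearMap_apply, twist_of_mem _ _ ha,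
        twist_of_mem _ _ (φ.map_mem ha), map_zsmul]
  exact LinearMap.congr_fun this a

theorem twist_smul (N : DGMod B) (i : ℤ) (x : N) (b : B) :
    twist N.isInternal i (x <• b) = twist N.isInternal i x <• twist B.isInternal i b := by
  have h1 : ∀ b : B, twist N.isInternal i ∘ₗ (Algebra.lsmul R R N (MulOpposite.op b))
      = (Algebra.lsmul R R N (MulOpposite.op (twist B.isInternal i b))) ∘ₗ
        twist N.isInternal i := by
    intro b
    refine eq_of_homogeneous N.isInternal fun j x hx => ?_
    have h2 : twist N.isInternal i ∘ₗ ((Algebra.lsmul R R N).toLinearMap.flip x) ∘ₗ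
          (MulOpposite.opLinearEquiv R : (B : Type u) ≃ₗ[R] (B : Type u)ᵐᵒᵖ).toLinearMap
        = ((Algebra.lsmul R R N).toLinearMap.flip (twist N.isInternal i x)) ∘ₗ
          (MulOpposite.opLinearEquiv R : (B : Type u) ≃ₗ[R] (B : Type u)ᵐᵒᵖ).toLinearMap ∘ₗ
            twist B.isInternal i := by
      refine eq_of_homogeneous B.isInternal fun k b hb => ?_
      change twist N.isInternal i (x <• b)
        = twist N.isInternal i x <• twist B.isInternal i b
      rw [twist_of_mem _ _ hx, twist_of_mem _ _ hb, twist_of_mem _ _ (N.smul_mem hx hb), mul_add,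
        Int.negOnePow_add, Units.val_mul, mul_smul, MulOpposite.op_smul, smul_assoc,
        smul_comm (MulOpposite.op b) ((i * j).negOnePow : ℤ),
        smul_comm ((i * j).negOnePow : ℤ)]
    exact LinearMap.congr_fun h2 b
  exact LinearMap.congr_fun (h1 b) x

theorem DGMod.d_twist (N : DGMod B) (i : ℤ) (x : N) :
    N.d (twist N.isInternal i x) = (i.negOnePow : ℤ) • twist N.isInternal i (N.d x) := by
  have : N.d ∘ₗ twist N.isInternal i = (i.negOnePow : ℤ) • (twist N.isInternal i ∘ₗ N.d) :=
    eq_of_homogeneous N.isInternal fun j x hx => by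
      simp only [LinearMap.comp_apply, LinearMap.smul_apply, twist_of_mem _ _ hx,
        twist_of_mem _ _ (N.d_mem hx), map_zsmul, mul_sub, mul_one, Int.negOnePow_sub,
        Units.val_mul, smul_smul]
      rw [mul_left_comm, negOnePow_mul_self, mul_one]
  exact LinearMap.congr_fun this x

end Signs

/-! ### Monomials -/

section Monomials

variable {B : DGAlg.{u} R} {n : ℕ}

/-- The degree of a monomial. -/
def Exponent.degree {deg : Fin n → ℤ} (m : Exponent deg) : ℤ := ∑ i, m.1 i * deg i

theorem monomial_mem_gr {deg : Fin n → ℤ} {P : Fin n → ℕ → B}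
    (hP : ∀ i (m : ℕ), P i m ∈ B.gr (m * deg i)) (m : Fin n → ℕ) :
    monomial P m ∈ B.gr (∑ i, m i * deg i) := by
  have key : ∀ {n : ℕ} (g : Fin n → B) (k : Fin n → ℤ), (∀ i, g i ∈ B.gr (k i)) →
      (List.ofFn g).prod ∈ B.gr (∑ i, k i) := by
    intro n
    induction n with
    | zero => exact fun g k _ => by simpa using B.one_mem
    | succ n ih =>
      intro g k h
      rw [List.ofFn_succ, List.prod_cons, Fin.sum_univ_succ]
      exact B.mul_mem (h 0) (ih _ _ fun i => h i.succ)
  exact key _ _ fun i => hP i (m i)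

end Monomials

/-! ### Monomial decompositions of B and of M ⊗_A B -/

section TensorBasis

variable {A B : DGAlg.{u} R} (φ : A.Hom B) {n : ℕ} {deg : Fin n → ℤ} {P : Fin n → ℕ → B}

/-- Monomials form a basis of `B` as a left `A`-module. -/
theorem MonomialBasis.bijective_left (h : MonomialBasis φ deg P)
    (hP : ∀ i (m : ℕ), P i m ∈ B.gr (m * deg i)) :
    Function.Bijective (Finsupp.lsum R fun m : Exponent deg =>
      LinearMap.mulRight R (monomial P m.1) ∘ₗ φ.toAlgHom.toLinearMap) := by
  -- The given basis has its coefficients on the right of the monomials. Moving them to the left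
  -- introduces exactly these signs.
  let τ : (Exponent deg →₀ A) →ₗ[R] (Exponent deg →₀ A) := Finsupp.lsum R fun m : Exponent deg =>
    Finsupp.lsingle m ∘ₗ twist A.isInternal m.degree
  have hτ : τ ∘ₗ τ = LinearMap.id := Finsupp.lhom_ext' fun m => LinearMap.ext fun a => by
    simp [τ, twist_twist]
  have hτ' : Function.Involutive τ := fun x => LinearMap.congr_fun hτ x
  let o : (Exponent deg →₀ A) →ₗ[R] B := Finsupp.lsum R fun m : Exponent deg =>
    LinearMap.mulLeft R (monomial P m.1) ∘ₗ φ.toAlgHom.toLinearMap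
  have ho : Function.Bijective o := h
  have : (Finsupp.lsum R fun m : Exponent deg =>
      LinearMap.mulRight R (monomial P m.1) ∘ₗ φ.toAlgHom.toLinearMap) = o ∘ₗ τ :=
    Finsupp.lhom_ext' fun m => LinearMap.ext fun a => by
      simp only [LinearMap.comp_apply, Finsupp.lsingle_apply, τ, o, Finsupp.lsum_single,
        AlgHom.toLinearMap_apply, LinearMap.mulRight_apply, LinearMap.mulLeft_apply,
        φ.map_twist]
      rw [B.mul_eq_twist_mul (monomial_mem_gr hP m.1)]
      change _ = twist B.isInternal m.degree (twist B.isInternal m.degree (φ a)) * _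
      rw [twist_twist]
  rw [this]
  exact ho.comp hτ'.bijective

/-- `M ⊗_A B` is the direct sum of the `M ⊗ X^m`. -/
theorem MonomialBasis.bijective_tensor (h : MonomialBasis φ deg P)
    (hP : ∀ i (m : ℕ), P i m ∈ B.gr (m * deg i)) (M : DGMod A) :
    Function.Bijective (Finsupp.lsum R fun m : Exponent deg =>
      (tmkBilin φ M).flip (monomial P m.1)) := by
  let l := LinearEquiv.ofBijective _ (h.bijective_left φ hP)
  have hl : ∀ m a, l (Finsupp.single m a) = φ a * monomial P m.1 := fun m a => by simp [l]
  have hext : ∀ {Z : Type u} [AddCommGroup Z] [Module R Z] {f g : B →ₗ[R] Z},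
      (∀ (m : Exponent deg) (a : A), f (φ a * monomial P m.1) = g (φ a * monomial P m.1)) →
        f = g := by
    intro Z _ _ f g hfg
    have : f ∘ₗ l.toLinearMap = g ∘ₗ l.toLinearMap :=
      Finsupp.lhom_ext' fun m => LinearMap.ext fun a => by
        simpa [hl] using hfg m a
    ext b
    simpa using LinearMap.congr_fun this (l.symm b)
  let G : (Exponent deg →₀ A) →ₗ[R] M →ₗ[R] (Exponent deg →₀ M) := Finsupp.lsum R fun m =>
    ((Algebra.lsmul R R M).toLinearMap.compr₂ (Finsupp.lsingle m)) ∘ₗ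
      (MulOpposite.opLinearEquiv R : (A : Type u) ≃ₗ[R] (A : Type u)ᵐᵒᵖ).toLinearMap
  have hG : ∀ m a x, G (Finsupp.single m a) x = Finsupp.single m (x <• a) := fun m a x => by
    simp [G]
  -- The inverse map sends x ⊗ a X^m to x a in position m; that it is balanced is checked for
  -- elements a X^m of B.
  let F : M →ₗ[R] B →ₗ[R] (Exponent deg →₀ M) := (G ∘ₗ l.symm.toLinearMap).flip
  have hF : ∀ m a x, F x (φ a * monomial P m.1) = Finsupp.single m (x <• a) := fun m a x => by
    rw [← hl, ← hG]
    simp [F]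
  obtain ⟨V, hV⟩ : ∃ V : TensorCarrier φ M →ₗ[R] (Exponent deg →₀ M),
      ∀ x b, V (tmk φ M x b) = F x b := by
    refine ⟨tensorLift φ M F fun x a b => ?_, fun _ _ => rfl⟩
    have : F (x <• a) = F x ∘ₗ LinearMap.mulLeft R (φ a) := hext fun m a' => by
      rw [LinearMap.comp_apply, LinearMap.mulLeft_apply, ← mul_assoc, ← map_mul, hF, hF,
        MulOpposite.op_mul, mul_smul]
    exact LinearMap.congr_fun this b
  set U := Finsupp.lsum R fun m : Exponent deg => (tmkBilin φ M).flip (monomial P m.1) with hU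
  have hUs : ∀ m x, U (Finsupp.single m x) = tmk φ M x (monomial P m.1) := fun m x => by
    simp [hU]
  have hVU : V ∘ₗ U = LinearMap.id := Finsupp.lhom_ext' fun m => LinearMap.ext fun x => by
    rw [LinearMap.comp_apply, LinearMap.comp_apply, Finsupp.lsingle_apply, hUs, hV,
      ← one_mul (monomial P m.1), ← map_one φ.toAlgHom, hF]
    simp
  have hUV : U ∘ₗ V = LinearMap.id := by
    have : (tmkBilin φ M).compr₂ (U ∘ₗ V) = tmkBilin φ M := LinearMap.ext fun x =>
      hext fun m a => by
        rw [LinearMap.compr₂_apply, LinearMap.comp_apply, tmkBilin_apply, hV, hF, hUs,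
          tmk_balanced]
    exact tensor_hom_ext fun x b => LinearMap.congr_fun (LinearMap.congr_fun this x) b
  exact Function.bijective_iff_has_inverse.2
    ⟨V, fun x => LinearMap.congr_fun hVU x, fun t => LinearMap.congr_fun hUV t⟩

end TensorBasis

/-! ### The left action of `B` on `N ⊗_A B` -/

/-- Right multiplication, as a homomorphism to the opposite of the endomorphism ring. -/
def DGMod.rightAct {B : DGAlg.{u} R} (E : DGMod B) : B →ₐ[R] (Module.End R E)ᵐᵒᵖ :=
  AlgHom.ofLinearMap
    ((MulOpposite.opLinearEquiv R).toLinearMap ∘ₗ (Algebra.lsmul R R E).toLinearMap ∘ₗ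
      (MulOpposite.opLinearEquiv R : (B : Type u) ≃ₗ[R] (B : Type u)ᵐᵒᵖ).toLinearMap)
    (congrArg MulOpposite.op (map_one (Algebra.lsmul R R E)))
    (fun b c => congrArg MulOpposite.op
      (map_mul (Algebra.lsmul R R E) (MulOpposite.op c) (MulOpposite.op b)))

theorem DGMod.rightAct_apply {B : DGAlg.{u} R} (E : DGMod B) (b : B) (t : E) :
    (E.rightAct b).unop t = t <• b := rfl

section LeftAct

variable {A B : DGAlg.{u} R} (φ : A.Hom B) (N : DGMod B)

/-- The action of `B` on `N|_A`. -/
def restrictAct : B →ₗ[R] restrict φ N →ₗ[R] restrict φ N :=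
  ((Algebra.lsmul R R N).toLinearMap ∘ₗ
    (MulOpposite.opLinearEquiv R : (B : Type u) ≃ₗ[R] (B : Type u)ᵐᵒᵖ).toLinearMap :
      B →ₗ[R] N →ₗ[R] N)

theorem restrictAct_mul (b c : B) (x : restrict φ N) :
    restrictAct φ N (b * c) x = restrictAct φ N c (restrictAct φ N b x) :=
  mul_smul (MulOpposite.op c) (MulOpposite.op b) (show N from x)

theorem restrictAct_one (x : restrict φ N) : restrictAct φ N 1 x = x :=
  one_smul (B : Type u)ᵐᵒᵖ (show N from x)

theorem restrictAct_map (a : A) (x : restrict φ N) : restrictAct φ N (φ a) x = x <• a := rfl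

theorem restrictAct_mem {i j : ℤ} {x : restrict φ N} {b : B} (hx : x ∈ (restrict φ N).gr i)
    (hb : b ∈ B.gr j) : restrictAct φ N b x ∈ (restrict φ N).gr (i + j) := N.smul_mem hx hb

theorem restrictAct_d {i : ℤ} {x : restrict φ N} (hx : x ∈ (restrict φ N).gr i) (b : B) :
    (restrict φ N).d (restrictAct φ N b x) = restrictAct φ N b ((restrict φ N).d x)
      + (i.negOnePow : ℤ) • restrictAct φ N (B.d b) x := N.leibniz hx b

/-- The bilinear map `(x, b) ↦ x (-1)^(|b||c|) c ⊗ b`. -/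
noncomputable def leftActBilin (c : B) :
    restrict φ N →ₗ[R] B →ₗ[R] TensorCarrier φ (restrict φ N) :=
  (assemble B.isInternal fun j => (tmkBilin φ (restrict φ N)).flip.compl₂
    (restrictAct φ N (twist B.isInternal j c))).flip

theorem leftActBilin_of_mem (c : B) (x : restrict φ N) {j : ℤ} {b : B} (hb : b ∈ B.gr j) :
    leftActBilin φ N c x b
      = tmk φ (restrict φ N) (restrictAct φ N (twist B.isInternal j c) x) b := by
  rw [leftActBilin, LinearMap.flip_apply, assemble_of_mem _ _ hb]
  rfl

/-- The sign (-1)^(|b||c|) is what makes the operator well defined over A: commuting a past c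
contributes (-1)^(|a||c|), which is the change of sign when b is replaced by ab. -/
theorem leftActBilin_balanced (c : B) (x : restrict φ N) (a : A) (b : B) :
    leftActBilin φ N c (x <• a) b = leftActBilin φ N c x (φ a * b) := by
  have h1 : ∀ b : B, (leftActBilin φ N c).flip b ∘ₗ
        (Algebra.lsmul R R (restrict φ N)).toLinearMap.flip x ∘ₗ
          (MulOpposite.opLinearEquiv R : (A : Type u) ≃ₗ[R] (A : Type u)ᵐᵒᵖ).toLinearMap
      = (leftActBilin φ N c x) ∘ₗ LinearMap.mulRight R b ∘ₗ φ.toAlgHom.toLinearMap := by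
    intro b
    refine eq_of_homogeneous A.isInternal fun i a ha => ?_
    have h2 : leftActBilin φ N c (x <• a)
        = leftActBilin φ N c x ∘ₗ LinearMap.mulLeft R (φ a) := by
      refine eq_of_homogeneous B.isInternal fun j b hb => ?_
      rw [LinearMap.comp_apply, LinearMap.mulLeft_apply, leftActBilin_of_mem φ N c _ hb,
        leftActBilin_of_mem φ N c _ (B.mul_mem (φ.map_mem ha) hb), ← tmk_balanced,
        ← restrictAct_map φ N, ← restrictAct_map φ N, ← restrictAct_mul, ← restrictAct_mul,
        B.mul_eq_twist_mul (φ.map_mem ha), twist_add]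
    exact LinearMap.congr_fun h2 b
  exact LinearMap.congr_fun (h1 b) a

/-- The operator `x ⊗ b ↦ x (-1)^(|b||c|) c ⊗ b`. -/
noncomputable def leftActLin (c : B) :
    TensorCarrier φ (restrict φ N) →ₗ[R] TensorCarrier φ (restrict φ N) :=
  tensorLift φ (restrict φ N) (leftActBilin φ N c) (leftActBilin_balanced φ N c)

theorem leftActLin_of_mem (c : B) (x : restrict φ N) {j : ℤ} {b : B} (hb : b ∈ B.gr j) :
    leftActLin φ N c (tmk φ (restrict φ N) x b)
      = tmk φ (restrict φ N) (restrictAct φ N (twist B.isInternal j c) x) b := by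
  rw [leftActLin, tensorLift_tmk, leftActBilin_of_mem φ N c x hb]

theorem leftActLin_add (c c' : B) :
    leftActLin φ N (c + c') = leftActLin φ N c + leftActLin φ N c' :=
  tensor_hom_ext_homogeneous fun i j x _ b hb => by
    rw [LinearMap.add_apply, leftActLin_of_mem φ N _ x hb, leftActLin_of_mem φ N _ x hb,
      leftActLin_of_mem φ N _ x hb, map_add, map_add, LinearMap.add_apply]
    exact map_add ((tmkBilin φ (restrict φ N)).flip b) _ _

theorem leftActLin_smul (r : R) (c : B) : leftActLin φ N (r • c) = r • leftActLin φ N c :=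
  tensor_hom_ext_homogeneous fun i j x _ b hb => by
    rw [LinearMap.smul_apply, leftActLin_of_mem φ N _ x hb, leftActLin_of_mem φ N _ x hb,
      map_smul, map_smul, LinearMap.smul_apply]
    exact map_smul ((tmkBilin φ (restrict φ N)).flip b) _ _

theorem leftActLin_one : leftActLin φ N 1 = 1 :=
  tensor_hom_ext_homogeneous fun i j x _ b hb => by
    rw [leftActLin_of_mem φ N _ x hb, DGAlg.twist_one, restrictAct_one]
    rfl

theorem leftActLin_mul (c c' : B) :
    leftActLin φ N (c * c') = leftActLin φ N c' * leftActLin φ N c :=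
  tensor_hom_ext_homogeneous fun i j x _ b hb => by
    rw [Module.End.mul_apply, leftActLin_of_mem φ N _ x hb, leftActLin_of_mem φ N _ x hb,
      leftActLin_of_mem φ N _ _ hb, DGAlg.twist_mul, restrictAct_mul]

/-- Left multiplication, as a homomorphism to the opposite of the endomorphism ring. -/
noncomputable def leftAct : B →ₐ[R] (Module.End R (TensorCarrier φ (restrict φ N)))ᵐᵒᵖ :=
  AlgHom.ofLinearMap
    { toFun := fun c => MulOpposite.op (leftActLin φ N c)
      map_add' := fun c c' => congrArg MulOpposite.op (leftActLin_add φ N c c')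
      map_smul' := fun r c => congrArg MulOpposite.op (leftActLin_smul φ N r c) }
    (congrArg MulOpposite.op (leftActLin_one φ N))
    (fun c c' => congrArg MulOpposite.op (leftActLin_mul φ N c c'))

theorem leftAct_of_mem (c : B) (x : restrict φ N) {j : ℤ} {b : B} (hb : b ∈ B.gr j) :
    (leftAct φ N c).unop (tmk φ (restrict φ N) x b)
      = tmk φ (restrict φ N) (restrictAct φ N (twist B.isInternal j c) x) b :=
  leftActLin_of_mem φ N c x hb

end LeftAct

theorem DGAlg.d_one (B : DGAlg.{u} R) : B.d 1 = 0 := by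
  have := B.leibniz B.one_mem 1
  simpa using this

theorem DGAlg.d_twist (B : DGAlg.{u} R) (i : ℤ) (b : B) :
    B.d (twist B.isInternal i b) = (i.negOnePow : ℤ) • twist B.isInternal i (B.d b) := by
  have : B.d ∘ₗ twist B.isInternal i = (i.negOnePow : ℤ) • (twist B.isInternal i ∘ₗ B.d) :=
    eq_of_homogeneous B.isInternal fun j x hx => by
      simp only [LinearMap.comp_apply, LinearMap.smul_apply, twist_of_mem _ _ hx,
        twist_of_mem _ _ (B.d_mem hx), map_zsmul, mul_sub, mul_one, Int.negOnePow_sub,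
        Units.val_mul, smul_smul]
      rw [mul_left_comm, negOnePow_mul_self, mul_one]
  exact LinearMap.congr_fun this b

/-- The structure of the DG module `E = N|_A ⊗_A B`: the left action of `B`, the map
`x ↦ x ⊗ 1` and the map `x ⊗ b ↦ x b`. -/
structure Diagonal {A B : DGAlg.{u} R} (φ : A.Hom B) (N E : DGMod B) where
  L : B →ₐ[R] (Module.End R E)ᵐᵒᵖ
  L_mem : ∀ {i j : ℤ} {t : E} {c : B}, t ∈ E.gr i → c ∈ B.gr j → (L c).unop t ∈ E.gr (i + j)
  L_mul_rightAct : ∀ {i j : ℤ} {c b : B}, c ∈ B.gr i → b ∈ B.gr j →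
    L c * E.rightAct b = ((i * j).negOnePow : ℤ) • (E.rightAct b * L c)
  -- Because the tensor product is over A, 1⊗a - a⊗1 acts as zero.
  L_map : ∀ a : A, L (φ a) = E.rightAct (φ a)
  L_d : ∀ {i : ℤ} {c : B}, c ∈ B.gr i → ∀ t : E,
    E.d ((L c).unop t) = (L c).unop (E.d t) + (L (B.d c)).unop (signOp E.isInternal t)
  j : N →ₗ[R] E
  j_mem : ∀ {i : ℤ} {x : N}, x ∈ N.gr i → j x ∈ E.gr i
  j_d : ∀ x, E.d (j x) = j (N.d x)
  j_smul : ∀ x (c : B), j (x <• c) = (L c).unop (j x)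
  π : E ⟶ N
  π_j : ∀ x, π.toLinearMap (j x) = x
  π_L : ∀ t (c : B), π.toLinearMap ((L c).unop t) = π.toLinearMap t <• c

/-! ### The two actions of B on N|_A ⊗_A B -/

section DiagonalOfBaseChange

variable {A B : DGAlg.{u} R} (φ : A.Hom B) (N : DGMod B)

theorem leftAct_mem {n k : ℤ} {t : TensorCarrier φ (restrict φ N)} {c : B}
    (ht : t ∈ tensorGr φ (restrict φ N) n) (hc : c ∈ B.gr k) :
    (leftAct φ N c).unop t ∈ tensorGr φ (restrict φ N) (n + k) := by
  have hle : tensorGr φ (restrict φ N) n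
      ≤ (tensorGr φ (restrict φ N) (n + k)).comap (leftAct φ N c).unop := by
    refine Submodule.span_le.2 ?_
    rintro _ ⟨i, j, x, b, h, hx, hb, rfl⟩
    change (leftAct φ N c).unop (tmk φ (restrict φ N) x b) ∈ tensorGr φ (restrict φ N) (n + k)
    rw [leftAct_of_mem φ N c x hb]
    exact tmk_mem (i := i + k) (by omega) (restrictAct_mem φ N hx (twist_mem _ _ hc)) hb
  exact hle ht

theorem zsmul_tmk (k : ℤ) (x : restrict φ N) (b : B) :
    tmk φ (restrict φ N) (k • x) b = k • tmk φ (restrict φ N) x b :=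
  map_zsmul ((tmkBilin φ (restrict φ N)).flip b) k x

theorem add_tmk (x y : restrict φ N) (b : B) :
    tmk φ (restrict φ N) (x + y) b = tmk φ (restrict φ N) x b + tmk φ (restrict φ N) y b :=
  map_add ((tmkBilin φ (restrict φ N)).flip b) x y

theorem leftAct_comm {i k : ℤ} {c b' : B} (hc : c ∈ B.gr i) (hb' : b' ∈ B.gr k) :
    tensorAct φ (restrict φ N) b' ∘ₗ (leftAct φ N c).unop
      = ((i * k).negOnePow : ℤ) • ((leftAct φ N c).unop ∘ₗ tensorAct φ (restrict φ N) b') :=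
  tensor_hom_ext_homogeneous fun p j x hx b hb => by
    rw [LinearMap.smul_apply, LinearMap.comp_apply, LinearMap.comp_apply,
      leftAct_of_mem φ N c x hb, tensorAct_tmk, tensorAct_tmk,
      leftAct_of_mem φ N c x (B.mul_mem hb hb'), add_comm j k, twist_add,
      twist_of_mem _ k (twist_mem _ j hc), map_zsmul, LinearMap.smul_apply, zsmul_tmk,
      mul_comm k i, negOnePow_smul_smul]

theorem leftAct_map (a : A) :
    (leftAct φ N (φ a)).unop = tensorAct φ (restrict φ N) (φ a) :=
  tensor_hom_ext_homogeneous fun p j x hx b hb => by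
    rw [leftAct_of_mem φ N _ x hb, tensorAct_tmk, B.mul_eq_twist_mul hb, ← φ.map_twist,
      restrictAct_map, tmk_balanced]

/-- On x ⊗ b with |b| = j, differentiating the j-twist of c contributes (-1)^j, which turns (-1)^|x|
into the sign of the total degree. In the term with db the twist is by j - 1 instead, and this
accounts for (-1)^|c|. -/
theorem leftAct_d {i : ℤ} {c : B} (hc : c ∈ B.gr i) :
    tensorD φ (restrict φ N) ∘ₗ (leftAct φ N c).unop
      = (leftAct φ N c).unop ∘ₗ tensorD φ (restrict φ N)
        + (leftAct φ N (B.d c)).unop ∘ₗ signOp (tensorGr_isInternal φ (restrict φ N)) :=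
  tensor_hom_ext_homogeneous fun p j x hx b hb => by
    have h1 : twist B.isInternal (j - 1) c = (i.negOnePow : ℤ) • twist B.isInternal j c := by
      rw [twist_of_mem _ _ hc, twist_of_mem _ _ hc, smul_smul, sub_mul, one_mul,
        Int.negOnePow_sub, Units.val_mul, mul_comm]
    rw [LinearMap.add_apply, LinearMap.comp_apply, LinearMap.comp_apply, LinearMap.comp_apply,
      leftAct_of_mem φ N c x hb, signOp_of_mem _ (tmk_mem rfl hx hb), map_zsmul,
      leftAct_of_mem φ N _ x hb, tensorD_tmk φ _ hx, map_add, map_zsmul,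
      leftAct_of_mem φ N c _ hb, leftAct_of_mem φ N c _ (B.d_mem hb), h1,
      tensorD_tmk φ _ (restrictAct_mem φ N hx (twist_mem _ j hc)), restrictAct_d φ N hx,
      DGAlg.d_twist, add_tmk, map_zsmul, LinearMap.smul_apply, map_zsmul, LinearMap.smul_apply,
      zsmul_tmk, zsmul_tmk, zsmul_tmk, smul_smul, smul_smul, Int.negOnePow_add,
      Int.negOnePow_add, Units.val_mul, Units.val_mul]
    abel

/-- The diagonal structure of `N|_A ⊗_A B`. -/
noncomputable def diagonal : Diagonal φ N (baseChange φ (restrict φ N)) where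
  L := leftAct φ N
  L_mem := leftAct_mem φ N
  L_mul_rightAct := fun hc hb => congrArg MulOpposite.op (leftAct_comm φ N hc hb)
  L_map := fun a => congrArg MulOpposite.op (leftAct_map φ N a)
  L_d := fun hc t => LinearMap.congr_fun (leftAct_d φ N hc) t
  j := (tmkBilin φ (restrict φ N)).flip 1
  j_mem := fun hx => tmk_mem (add_zero _) hx B.one_mem
  j_d := fun x => by
    have : tensorD φ (restrict φ N) ∘ₗ (tmkBilin φ (restrict φ N)).flip 1
        = (tmkBilin φ (restrict φ N)).flip 1 ∘ₗ (restrict φ N).d :=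
      eq_of_homogeneous (restrict φ N).isInternal fun i x hx => by
        rw [LinearMap.comp_apply, LinearMap.flip_apply, tmkBilin_apply, tensorD_tmk φ _ hx,
          B.d_one, ← tmkBilin_apply _ _ x 0, map_zero, smul_zero, add_zero]
        rfl
    exact LinearMap.congr_fun this x
  j_smul := fun x c => by
    change tmk φ (restrict φ N) (restrictAct φ N c x) 1
      = (leftAct φ N c).unop (tmk φ (restrict φ N) x 1)
    rw [leftAct_of_mem φ N c x B.one_mem, twist_zero]
  π := counit φ N
  π_j := fun x => one_smul (B : Type u)ᵐᵒᵖ (show N from x)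
  π_L := fun t c => by
    have : counitLin φ N ∘ₗ (leftAct φ N c).unop
        = (Algebra.lsmul R R N (MulOpposite.op c)) ∘ₗ counitLin φ N :=
      tensor_hom_ext_homogeneous fun i j x hx b hb => by
        rw [LinearMap.comp_apply, LinearMap.comp_apply, leftAct_of_mem φ N c x hb]
        change MulOpposite.op b • MulOpposite.op (twist B.isInternal j c) • (show N from x)
          = MulOpposite.op c • MulOpposite.op b • (show N from x)
        rw [← mul_smul, ← mul_smul, ← MulOpposite.op_mul, ← MulOpposite.op_mul,
          B.mul_eq_twist_mul hb]
    exact LinearMap.congr_fun this t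

end DiagonalOfBaseChange

/-! ### Operators and filtrations -/

section Shift

variable {E : Type u} [AddCommGroup E] [Module R E]

/-- The operators that shift a filtration by `k`. Operators act on the right. -/
def shift (F : ℕ → Submodule R E) (k : ℕ) : Submodule R (Module.End R E)ᵐᵒᵖ where
  carrier := {s | ∀ j, ∀ t ∈ F j, s.unop t ∈ F (j + k)}
  zero_mem' := fun _ _ _ => zero_mem _
  add_mem' := fun hs ht j x hx => add_mem (hs j x hx) (ht j x hx)
  smul_mem' := fun r _ hs j x hx => Submodule.smul_mem _ r (hs j x hx)

theorem mul_mem_shift {F : ℕ → Submodule R E} {k l : ℕ} {s t : (Module.End R E)ᵐᵒᵖ}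
    (hs : s ∈ shift F k) (ht : t ∈ shift F l) : s * t ∈ shift F (k + l) := fun j x hx => by
  rw [← add_assoc]
  exact ht _ _ (hs j x hx)

theorem one_mem_shift (F : ℕ → Submodule R E) : 1 ∈ shift F 0 := fun _ _ hx => hx

/-- The operators that preserve a filtration. -/
def shiftSubalgebra (F : ℕ → Submodule R E) : Subalgebra R (Module.End R E)ᵐᵒᵖ where
  carrier := shift F 0
  mul_mem' := fun hs ht => mul_mem_shift (k := 0) (l := 0) hs ht
  add_mem' := fun hs ht => add_mem hs ht
  algebraMap_mem' := fun r j _ hx => Submodule.smul_mem (F j) r hx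

theorem shift_antitone {F : ℕ → Submodule R E} (hF : Antitone F) {k l : ℕ} (h : k ≤ l) :
    shift F l ≤ shift F k := fun _ hs j x hx => hF (by omega) (hs j x hx)

end Shift

/-- Lets two monomials be compared factor by factor, by applying `prod_ofFn_induction` to pairs. -/
theorem prod_ofFn_pair {S T : Type*} [Monoid S] [Monoid T] {n : ℕ} (g : Fin n → S × T) :
    (List.ofFn g).prod
      = ((List.ofFn fun i => (g i).1).prod, (List.ofFn fun i => (g i).2).prod) := by
  refine Prod.ext ?_ ?_
  · have := map_list_prod (MonoidHom.fst S T) (List.ofFn g)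
    rw [List.map_ofFn] at this
    exact this
  · have := map_list_prod (MonoidHom.snd S T) (List.ofFn g)
    rw [List.map_ofFn] at this
    exact this

theorem map_monomial {S T : Type u} [Ring S] [Ring T] (f : S →+* T) {n : ℕ} (P : Fin n → ℕ → S)
    (m : Fin n → ℕ) : f (monomial P m) = monomial (fun i k => f (P i k)) m := by
  rw [monomial, map_list_prod, List.map_ofFn]
  rfl

/-! ### Multiplication of monomials -/

section MonomialMul

variable {n : ℕ} {deg : Fin n → ℤ}

theorem sum_update_add_mul {α : Type*} [CommSemiring α] (m : Fin n → ℕ) (i : Fin n) (l : ℕ)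
    (w : Fin n → α) : ∑ k, (Function.update m i (m i + l) k : ℕ) * w k
      = ∑ k, (m k : α) * w k + l * w i := by
  have : ∀ k, ((Function.update m i (m i + l) k : ℕ) : α) * w k
      = m k * w k + if k = i then l * w k else 0 := by
    intro k
    by_cases h : k = i
    · subst h
      simp [add_mul]
    · simp [h]
  simp [this, Finset.sum_add_distrib]

/-- The product of a monomial with a power of a variable is a multiple of a monomial. -/
theorem monomial_mul {S : Type u} [Ring S] {P : Fin n → ℕ → S}
    (hodd : ∀ i, Odd (deg i) → ∀ l, 2 ≤ l → P i l = 0)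
    (hmul : ∀ i l l', ∃ c : ℤ, P i l * P i l' = c • P i (l + l'))
    (hcomm : ∀ i i' l l', SignCommute (P i l) (P i' l'))
    (m : Exponent deg) (i : Fin n) (l : ℕ) :
    monomial P m.1 * P i l = 0 ∨ ∃ (m' : Exponent deg) (c : ℤ),
      m'.1 = Function.update m.1 i (m.1 i + l) ∧ monomial P m.1 * P i l = c • monomial P m'.1 := by
  obtain ⟨ε, hε⟩ := prod_ofFn_mul (fun k => P k (m.1 k)) (P i l) (fun k => hcomm _ _ _ _) i
  obtain ⟨c, hc⟩ := hmul i (m.1 i) l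
  rw [hc, prod_ofFn_update_zsmul, smul_smul] at hε
  -- The updated exponent is illegal only when an odd variable would occur at least twice, and then
  -- the product is zero.
  by_cases h : Odd (deg i) ∧ 2 ≤ m.1 i + l
  · left
    rw [hodd i h.1 _ h.2, prod_ofFn_update_zero, smul_zero] at hε
    exact hε
  · right
    refine ⟨⟨Function.update m.1 i (m.1 i + l), fun k hk => ?_⟩, ε * c, rfl, ?_⟩
    · by_cases hki : k = i
      · subst hki
        rw [Function.update_self]
        by_contra hcon
        exact h ⟨hk, by omega⟩
      · rw [Function.update_of_ne hki]
        exact m.2 k hk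
    · refine hε.trans ?_
      congr 3
      funext k
      by_cases hki : k = i
      · subst hki
        simp
      · simp [hki]

end MonomialMul

/-! ### Bihomogeneous operators -/

namespace Diagonal

variable {A B : DGAlg.{u} R} {φ : A.Hom B} {N E : DGMod B} (D : Diagonal φ N E)

/-- The operators of degree `p` generated by left and right multiplications. -/
def gen (p : ℤ) : Submodule R (Module.End R E)ᵐᵒᵖ :=
  Submodule.span R {s | ∃ (i j : ℤ) (c b : B), i + j = p ∧ c ∈ B.gr i ∧ b ∈ B.gr j ∧
    s = D.L c * E.rightAct b}

theorem L_mem_gen {i : ℤ} {c : B} (hc : c ∈ B.gr i) : D.L c ∈ D.gen i :=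
  Submodule.subset_span ⟨i, 0, c, 1, add_zero i, hc, B.one_mem, by rw [map_one, mul_one]⟩

theorem rightAct_mem_gen {i : ℤ} {b : B} (hb : b ∈ B.gr i) : E.rightAct b ∈ D.gen i :=
  Submodule.subset_span ⟨0, i, 1, b, zero_add i, B.one_mem, hb, by rw [map_one, one_mul]⟩

theorem one_mem_gen : 1 ∈ D.gen 0 := by
  simpa using D.L_mem_gen B.one_mem

theorem map_comm_sign {S : Type*} [Ring S] [Algebra R S] (f : B →ₐ[R] S) {i j : ℤ} {a b : B}
    (ha : a ∈ B.gr i) (hb : b ∈ B.gr j) :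
    f a * f b = ((i * j).negOnePow : ℤ) • (f b * f a) := by
  rw [← map_mul, ← map_mul, B.mul_comm_sign ha hb, map_zsmul]

theorem rightAct_mul_L {i j : ℤ} {c b : B} (hc : c ∈ B.gr i) (hb : b ∈ B.gr j) :
    E.rightAct b * D.L c = ((j * i).negOnePow : ℤ) • (D.L c * E.rightAct b) := by
  rw [D.L_mul_rightAct hc hb, mul_comm j i, negOnePow_smul_smul]

theorem sign_mul_mul {S : Type*} [Ring S] {p q j : ℤ} {s t y : S}
    (hs : s * y = ((p * j).negOnePow : ℤ) • (y * s))
    (ht : t * y = ((q * j).negOnePow : ℤ) • (y * t)) :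
    s * t * y = (((p + q) * j).negOnePow : ℤ) • (y * (s * t)) := by
  rw [mul_assoc, ht, mul_smul_comm, ← mul_assoc, hs, smul_mul_assoc, smul_smul, mul_assoc,
    add_mul, Int.negOnePow_add, Units.val_mul, mul_comm ((q * j).negOnePow : ℤ)]

theorem sign_mul_mul' {S : Type*} [Ring S] {p q j : ℤ} {s t y : S}
    (hs : y * s = ((j * p).negOnePow : ℤ) • (s * y))
    (ht : y * t = ((j * q).negOnePow : ℤ) • (t * y)) :
    y * (s * t) = ((j * (p + q)).negOnePow : ℤ) • (s * t * y) := by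
  rw [← mul_assoc, hs, smul_mul_assoc, mul_assoc, ht, mul_smul_comm, smul_smul, mul_assoc,
    mul_add, Int.negOnePow_add, Units.val_mul]

theorem gen_mul_act {p : ℤ} {s : (Module.End R E)ᵐᵒᵖ} (hs : s ∈ D.gen p) {j : ℤ} {b : B}
    (hb : b ∈ B.gr j) :
    s * E.rightAct b = ((p * j).negOnePow : ℤ) • (E.rightAct b * s) ∧
      s * D.L b = ((p * j).negOnePow : ℤ) • (D.L b * s) := by
  induction hs using Submodule.span_induction with
  | mem s hs =>
    obtain ⟨i, k, c, b', rfl, hc, hb', rfl⟩ := hs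
    exact ⟨sign_mul_mul (D.L_mul_rightAct hc hb) (map_comm_sign E.rightAct hb' hb),
      sign_mul_mul (map_comm_sign D.L hc hb) (D.rightAct_mul_L hb hb')⟩
  | zero => simp
  | add s t _ _ hs ht =>
    rw [add_mul, add_mul, mul_add, mul_add, smul_add, smul_add, hs.1, hs.2, ht.1, ht.2]
    exact ⟨rfl, rfl⟩
  | smul r s _ hs =>
    rw [smul_mul_assoc, smul_mul_assoc, mul_smul_comm, mul_smul_comm, hs.1, hs.2]
    exact ⟨smul_comm _ _ _, smul_comm _ _ _⟩

/-- Both actions are images of a graded commutative algebra, and they commute with each other up to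
the usual sign. Hence reordering the factors of a monomial in diagonal variables costs only signs.
-/
theorem gen_comm {p q : ℤ} {s t : (Module.End R E)ᵐᵒᵖ} (hs : s ∈ D.gen p) (ht : t ∈ D.gen q) :
    s * t = ((p * q).negOnePow : ℤ) • (t * s) := by
  induction ht using Submodule.span_induction with
  | mem t ht =>
    obtain ⟨i, k, c, b, rfl, hc, hb, rfl⟩ := ht
    exact sign_mul_mul' (D.gen_mul_act hs hc).2 (D.gen_mul_act hs hb).1
  | zero => simp
  | add t t' _ _ ht ht' => rw [mul_add, add_mul, ht, ht', smul_add]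
  | smul r t _ ht => rw [mul_smul_comm, smul_mul_assoc, ht, smul_comm]

theorem mul_mem_gen {p q : ℤ} {s t : (Module.End R E)ᵐᵒᵖ} (hs : s ∈ D.gen p)
    (ht : t ∈ D.gen q) : s * t ∈ D.gen (p + q) := by
  induction hs using Submodule.span_induction with
  | mem s hs =>
    obtain ⟨i, j, c, b, rfl, hc, hb, rfl⟩ := hs
    induction ht using Submodule.span_induction with
    | mem t ht =>
      obtain ⟨i', j', c', b', rfl, hc', hb', rfl⟩ := ht
      have : D.L c * E.rightAct b * (D.L c' * E.rightAct b')
          = ((j * i').negOnePow : ℤ) • (D.L (c * c') * E.rightAct (b * b')) := by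
        rw [mul_assoc, ← mul_assoc (E.rightAct b), D.rightAct_mul_L hc' hb, smul_mul_assoc,
          mul_smul_comm, map_mul, map_mul]
        simp only [mul_assoc]
      rw [this]
      have h : D.L (c * c') * E.rightAct (b * b') ∈ D.gen (i + j + (i' + j')) :=
        Submodule.subset_span ⟨i + i', j + j', _, _, by ring, B.mul_mem hc hc',
          B.mul_mem hb hb', rfl⟩
      exact zsmul_mem h _
    | zero => rw [mul_zero]; exact zero_mem _
    | add t t' _ _ h h' => rw [mul_add]; exact add_mem h h'
    | smul r t _ h => rw [mul_smul_comm]; exact Submodule.smul_mem _ r h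
  | zero => rw [zero_mul]; exact zero_mem _
  | add s s' _ _ h h' => rw [add_mul]; exact add_mem h h'
  | smul r s _ h => rw [smul_mul_assoc]; exact Submodule.smul_mem _ r h

theorem gen_mem {p i : ℤ} {s : (Module.End R E)ᵐᵒᵖ} (hs : s ∈ D.gen p) {t : E}
    (ht : t ∈ E.gr i) : s.unop t ∈ E.gr (i + p) := by
  induction hs using Submodule.span_induction with
  | mem s hs =>
    obtain ⟨k, l, c, b, rfl, hc, hb, rfl⟩ := hs
    rw [← add_assoc]
    exact E.smul_mem (D.L_mem ht hc) hb
  | zero => exact zero_mem _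
  | add s s' _ _ h h' => exact add_mem h h'
  | smul r s _ h => exact Submodule.smul_mem _ r h

theorem gen_signOp {p : ℤ} {s : (Module.End R E)ᵐᵒᵖ} (hs : s ∈ D.gen p) (t : E) :
    signOp E.isInternal (s.unop t) = (p.negOnePow : ℤ) • s.unop (signOp E.isInternal t) := by
  have : signOp E.isInternal ∘ₗ s.unop = (p.negOnePow : ℤ) • (s.unop ∘ₗ signOp E.isInternal) :=
    eq_of_homogeneous E.isInternal fun i t ht => by
      rw [LinearMap.smul_apply, LinearMap.comp_apply, LinearMap.comp_apply,
        signOp_of_mem _ (D.gen_mem hs ht), signOp_of_mem _ ht, map_zsmul, smul_smul,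
        Int.negOnePow_add, Units.val_mul, mul_comm]
  exact LinearMap.congr_fun this t

theorem gen_prod {n : ℕ} (g : Fin n → (Module.End R E)ᵐᵒᵖ) (k : Fin n → ℤ)
    (h : ∀ i, g i ∈ D.gen (k i)) : (List.ofFn g).prod ∈ D.gen (∑ i, k i) := by
  induction n with
  | zero => simpa using D.one_mem_gen
  | succ n ih =>
    rw [List.ofFn_succ, List.prod_cons, Fin.sum_univ_succ]
    exact D.mul_mem_gen (h 0) (ih _ _ fun i => h i.succ)

end Diagonal

/-! ### Extensions and their diagonal variables -/

/-- The common properties of polynomial and free extensions. -/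
structure IsVariableExtension {A B : DGAlg.{u} R} (φ : A.Hom B) {n : ℕ} (deg : Fin n → ℤ)
    (X : Fin n → ℕ → B) : Prop where
  deg_pos : ∀ i, 0 < deg i
  mem : ∀ i (m : ℕ), X i m ∈ B.gr (m * deg i)
  zero : ∀ i, X i 0 = 1
  odd : ∀ i, Odd (deg i) → ∀ m, 2 ≤ m → X i m = 0
  -- The multiple is left open, which covers powers and divided powers alike.
  mul : ∀ i m l, ∃ c : ℤ, X i m * X i l = c • X i (m + l)
  basis : MonomialBasis φ deg X
  d_mem : ∀ i, B.d (X i 1) ∈ Algebra.adjoin R (Set.range φ ∪ {b | ∃ j m, j < i ∧ b = X j m})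

/-- The (divided) powers `T l` of a diagonal variable `1 ⊗ x - x ⊗ 1` of degree `e`, acting on
`N|_A ⊗_A B`, where `X l` are the (divided) powers of `x`. -/
structure IsDiagonalPowers {A B : DGAlg.{u} R} {φ : A.Hom B} {N E : DGMod B}
    (D : Diagonal φ N E) (e : ℤ) (X : ℕ → B) (T : ℕ → (Module.End R E)ᵐᵒᵖ) : Prop where
  mem_gen : ∀ l : ℕ, T l ∈ D.gen (l * e)
  zero : T 0 = 1
  odd : Odd e → ∀ l, 2 ≤ l → T l = 0
  mul : ∀ l l', ∃ c : ℤ, T l * T l' = c • T (l + l')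
  -- The leading term of `T l` is right multiplication by `X l`; this gives the change of basis from
  -- X^m to T^m.
  sub_rightAct_mem : ∀ l, T l - E.rightAct (X l) ∈ Submodule.span R
    {s | ∃ (k : ℕ) (b : B), k < l ∧ s = E.rightAct (X k) * D.L b}
  -- The difference of the two multiplications by `X l` involves only positive powers of the
  -- diagonal variable. The condition `1 ≤ k` is what makes it raise the weight and be killed by π.
  sub_mem : ∀ l, 1 ≤ l → E.rightAct (X l) - D.L (X l) - T l ∈ Submodule.span R
    {s | ∃ (k : ℕ) (b : B), 1 ≤ k ∧ k < l ∧ s = T k * D.L b}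
  -- In even degree `c` is `l + 1` for ordinary powers and 1 for divided powers.
  d : ∀ l, ∃ c : ℤ, ∀ t, E.d ((T (l + 1)).unop t) = (T (l + 1)).unop (E.d t)
    + (c • (T l * (E.rightAct (B.d (X 1)) - D.L (B.d (X 1))))).unop (signOp E.isInternal t)

/-! ### The filtration by powers of the diagonal variables -/

section ExponentLemmas

variable {n : ℕ} {deg : Fin n → ℤ}

/-- The number of factors of a monomial. -/
def Exponent.size (m : Exponent deg) : ℕ := ∑ i, m.1 i

/-- The weight of a monomial; the variable `i` has weight `n - i`. -/
def Exponent.weight (m : Exponent deg) : ℕ := ∑ i, m.1 i * (n - i)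

/-- The exponent of the monomial `1`. -/
def Exponent.unit (deg : Fin n → ℤ) : Exponent deg := ⟨fun _ => 0, fun _ _ => Nat.zero_le 1⟩

theorem Exponent.size_unit : (Exponent.unit deg).size = 0 := by simp [size, unit]

theorem Exponent.weight_unit : (Exponent.unit deg).weight = 0 := by simp [weight, unit]

theorem Exponent.degree_unit : (Exponent.unit deg).degree = 0 := by simp [degree, unit]

theorem Exponent.eq_unit {m : Exponent deg} (h : m.size = 0) : m = Exponent.unit deg := by
  refine Subtype.ext (funext fun i => ?_)
  exact (Finset.sum_eq_zero_iff.1 h) i (Finset.mem_univ i)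

theorem Exponent.le_weight (m : Exponent deg) (i : Fin n) : m.1 i ≤ m.weight :=
  calc m.1 i ≤ m.1 i * (n - i) := Nat.le_mul_of_pos_right _ (by have := i.2; omega)
    _ ≤ m.weight := Finset.single_le_sum (f := fun i : Fin n => m.1 i * (n - i))
      (fun _ _ => Nat.zero_le _) (Finset.mem_univ i)

theorem Exponent.eq_unit_of_weight {m : Exponent deg} (h : m.weight = 0) :
    m = Exponent.unit deg :=
  eq_unit (Finset.sum_eq_zero fun i _ => by have := m.le_weight i; omega)

theorem Exponent.finite_weight (k : ℕ) : {m : Exponent deg | m.weight = k}.Finite := by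
  refine Set.Finite.subset (Set.Finite.preimage (f := fun m : Exponent deg => m.1)
    Subtype.val_injective.injOn (Set.finite_Iic fun _ : Fin n => k)) ?_
  rintro m rfl
  exact fun i => m.le_weight i

/-- Each variable has weight at most n and degree at least 1. -/
theorem Exponent.weight_le (hdeg : ∀ i, 0 < deg i) (m : Exponent deg) :
    (m.weight : ℤ) ≤ n * m.degree := by
  simp only [weight, degree, Finset.mul_sum]
  push_cast
  refine Finset.sum_le_sum fun i _ => ?_
  have h1 : ((n - i : ℕ) : ℤ) ≤ n := by omega
  calc (m.1 i : ℤ) * ((n - i : ℕ) : ℤ) ≤ m.1 i * n :=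
        mul_le_mul_of_nonneg_left h1 (Int.natCast_nonneg _)
    _ = n * (m.1 i * 1) := by ring
    _ ≤ n * (m.1 i * deg i) := by
        have := hdeg i
        gcongr
        omega

end ExponentLemmas

/-! ### Decomposition and weight filtration of E by monomials in the diagonal variables -/

section CellStructureOfDiagonal

variable {A B : DGAlg.{u} R} {φ : A.Hom B} {N E : DGMod B} (D : Diagonal φ N E) {n : ℕ}
  {deg : Fin n → ℤ} {X : Fin n → ℕ → B} {T : Fin n → ℕ → (Module.End R E)ᵐᵒᵖ}

/-- The map `x ↦ ± x ⊗ T^m`. -/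
noncomputable def Diagonal.cell (deg : Fin n → ℤ) (T : Fin n → ℕ → (Module.End R E)ᵐᵒᵖ)
    (m : Exponent deg) : N →ₗ[R] E :=
  (monomial T m.1).unop ∘ₗ D.j ∘ₗ twist N.isInternal m.degree

theorem Diagonal.cell_apply (m : Exponent deg) (x : N) :
    D.cell deg T m x = (monomial T m.1).unop (D.j (twist N.isInternal m.degree x)) := rfl

theorem Diagonal.monomial_mem_range_cell (m : Exponent deg) (x : N) :
    (monomial T m.1).unop (D.j x) ∈ LinearMap.range (D.cell deg T m) :=
  ⟨twist N.isInternal m.degree x, by rw [cell_apply, twist_twist]⟩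

theorem Diagonal.monomial_mem_gen (hT : ∀ i (l : ℕ), T i l ∈ D.gen (l * deg i))
    (m : Exponent deg) : monomial T m.1 ∈ D.gen m.degree :=
  D.gen_prod _ _ fun i => hT i (m.1 i)

theorem Diagonal.signCommute {p q : ℤ} {s t : (Module.End R E)ᵐᵒᵖ} (hs : s ∈ D.gen p)
    (ht : t ∈ D.gen q) : SignCommute s t := ⟨_, D.gen_comm hs ht⟩

/-- Left multiplications preserve the range of `cell m`. -/
theorem Diagonal.L_cell_mem (hT : ∀ i (l : ℕ), T i l ∈ D.gen (l * deg i)) (m : Exponent deg)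
    (x : N) (b : B) : (D.L b).unop (D.cell deg T m x) ∈ LinearMap.range (D.cell deg T m) := by
  refine mem_of_gr_le B.isInternal (S := (LinearMap.range (D.cell deg T m)).comap
    (LinearMap.applyₗ (D.cell deg T m x) ∘ₗ
      (MulOpposite.opLinearEquiv R).symm.toLinearMap ∘ₗ D.L.toLinearMap))
    (fun j b hb => ?_) b
  change (D.L b).unop (D.cell deg T m x) ∈ LinearMap.range (D.cell deg T m)
  have h := congrArg MulOpposite.unop (D.gen_mul_act (D.monomial_mem_gen hT m) hb).2
  have h' := LinearMap.congr_fun h (D.j (twist N.isInternal m.degree x))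
  change (D.L b).unop (D.cell deg T m x) = ((m.degree * j).negOnePow : ℤ) •
    (monomial T m.1).unop ((D.L b).unop (D.j (twist N.isInternal m.degree x))) at h'
  rw [h', ← D.j_smul]
  exact zsmul_mem (D.monomial_mem_range_cell m _) _

/-- If left multiplications preserve the range of `cell m`, they preserve any filtration by such
ranges. -/
theorem Diagonal.L_mem_shift (hT : ∀ i (l : ℕ), T i l ∈ D.gen (l * deg i)) (b : B)
    (p : ℕ → Exponent deg → Prop) :
    D.L b ∈ shift (fun k => ⨆ (m) (_ : p k m), LinearMap.range (D.cell deg T m)) 0 := by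
  intro k t ht
  refine (iSup_le fun m => iSup_le fun hm => ?_ : (⨆ (m) (_ : p k m),
    LinearMap.range (D.cell deg T m)) ≤ (⨆ (m) (_ : p k m),
    LinearMap.range (D.cell deg T m)).comap (D.L b).unop) ht
  rintro _ ⟨x, rfl⟩
  exact (le_iSup₂_of_le m hm le_rfl : LinearMap.range (D.cell deg T m) ≤
    ⨆ (m) (_ : p k m), LinearMap.range (D.cell deg T m)) (D.L_cell_mem hT m x b)

/-- The operator `T i l` maps the range of `cell m` to the range of the `cell` of the product
monomial. -/
theorem Diagonal.mul_cell_mem (hT : ∀ i (l : ℕ), T i l ∈ D.gen (l * deg i))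
    (hodd : ∀ i, Odd (deg i) → ∀ l, 2 ≤ l → T i l = 0)
    (hmul : ∀ i l l', ∃ c : ℤ, T i l * T i l' = c • T i (l + l')) (m : Exponent deg) (x : N)
    (i : Fin n) (l : ℕ) : (T i l).unop (D.cell deg T m x) = 0 ∨
      ∃ m' : Exponent deg, m'.1 = Function.update m.1 i (m.1 i + l) ∧
        (T i l).unop (D.cell deg T m x) ∈ LinearMap.range (D.cell deg T m') := by
  have hval : (T i l).unop (D.cell deg T m x)
      = (monomial T m.1 * T i l).unop (D.j (twist N.isInternal m.degree x)) := rfl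
  rcases monomial_mul hodd hmul (fun i i' l l' => D.signCommute (hT i l) (hT i' l')) m i l
    with h | ⟨m', c, hm', h⟩
  · left
    rw [hval, h]
    rfl
  · right
    refine ⟨m', hm', ?_⟩
    rw [hval, h]
    exact zsmul_mem (D.monomial_mem_range_cell m' _) c

theorem Exponent.size_update {m m' : Exponent deg} {i : Fin n} {l : ℕ}
    (h : m'.1 = Function.update m.1 i (m.1 i + l)) : m'.size = m.size + l := by
  have := sum_update_add_mul m.1 i l (fun _ => (1 : ℕ))
  rw [← h] at this
  simpa [size] using this

theorem Exponent.weight_update {m m' : Exponent deg} {i : Fin n} {l : ℕ}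
    (h : m'.1 = Function.update m.1 i (m.1 i + l)) : m'.weight = m.weight + l * (n - i) := by
  have := sum_update_add_mul m.1 i l (fun k => (n - k : ℕ))
  rw [← h] at this
  simpa [weight] using this

/-- The submodule spanned by monomials of size less than `k`. -/
noncomputable def Diagonal.sizeFilt (deg : Fin n → ℤ) (T : Fin n → ℕ → (Module.End R E)ᵐᵒᵖ)
    (k : ℕ) : Submodule R E :=
  ⨆ (m : Exponent deg) (_ : m.size < k), LinearMap.range (D.cell deg T m)

/-- The submodule spanned by monomials of weight at least `k`. -/
noncomputable def Diagonal.weightFilt (deg : Fin n → ℤ) (T : Fin n → ℕ → (Module.End R E)ᵐᵒᵖ)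
    (k : ℕ) : Submodule R E :=
  ⨆ (m : Exponent deg) (_ : k ≤ m.weight), LinearMap.range (D.cell deg T m)

theorem Diagonal.sizeFilt_mono : Monotone (D.sizeFilt deg T) := fun _ _ h =>
  iSup₂_le fun m hm => le_iSup₂_of_le m (lt_of_lt_of_le hm h) le_rfl

theorem Diagonal.weightFilt_anti : Antitone (D.weightFilt deg T) := fun _ _ h =>
  iSup₂_le fun m hm => le_iSup₂_of_le m (le_trans h hm) le_rfl

theorem Diagonal.range_le_sizeFilt {k : ℕ} {m : Exponent deg} (h : m.size < k) :
    LinearMap.range (D.cell deg T m) ≤ D.sizeFilt deg T k := le_iSup₂_of_le m h le_rfl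

theorem Diagonal.range_le_weightFilt {k : ℕ} {m : Exponent deg} (h : k ≤ m.weight) :
    LinearMap.range (D.cell deg T m) ≤ D.weightFilt deg T k := le_iSup₂_of_le m h le_rfl

theorem Diagonal.mem_shift_sizeFilt (hT : ∀ i (l : ℕ), T i l ∈ D.gen (l * deg i))
    (hodd : ∀ i, Odd (deg i) → ∀ l, 2 ≤ l → T i l = 0)
    (hmul : ∀ i l l', ∃ c : ℤ, T i l * T i l' = c • T i (l + l')) (i : Fin n) (l : ℕ) :
    T i l ∈ shift (D.sizeFilt deg T) l := by
  intro k t ht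
  refine (iSup₂_le fun m hm => ?_ :
    D.sizeFilt deg T k ≤ (D.sizeFilt deg T (k + l)).comap (T i l).unop) ht
  rintro _ ⟨x, rfl⟩
  rw [Submodule.mem_comap]
  rcases D.mul_cell_mem hT hodd hmul m x i l with h | ⟨m', hm', h⟩
  · rw [h]
    exact zero_mem _
  · exact D.range_le_sizeFilt (by rw [Exponent.size_update hm']; omega) h

theorem Diagonal.mem_shift_weightFilt (hT : ∀ i (l : ℕ), T i l ∈ D.gen (l * deg i))
    (hodd : ∀ i, Odd (deg i) → ∀ l, 2 ≤ l → T i l = 0)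
    (hmul : ∀ i l l', ∃ c : ℤ, T i l * T i l' = c • T i (l + l')) (i : Fin n) (l : ℕ) :
    T i l ∈ shift (D.weightFilt deg T) (l * (n - i)) := by
  intro k t ht
  refine (iSup₂_le fun m hm => ?_ :
    D.weightFilt deg T k ≤ (D.weightFilt deg T (k + l * (n - i))).comap (T i l).unop) ht
  rintro _ ⟨x, rfl⟩
  rw [Submodule.mem_comap]
  rcases D.mul_cell_mem hT hodd hmul m x i l with h | ⟨m', hm', h⟩
  · rw [h]
    exact zero_mem _
  · exact D.range_le_weightFilt (by rw [Exponent.weight_update hm']; omega) h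

theorem IsVariableExtension.rightAct_mem_gen (hX : IsVariableExtension φ deg X) (i : Fin n)
    (l : ℕ) : E.rightAct (X i l) ∈ D.gen (l * deg i) := D.rightAct_mem_gen (hX.mem i l)

/-- The monomials `x ⊗ X^m` induce an isomorphism. -/
theorem Diagonal.bijective_rightAct (hu : Function.Bijective (Finsupp.lsum R fun m : Exponent deg =>
      (E.rightAct (monomial X m.1)).unop ∘ₗ D.j)) :
    Function.Bijective (Finsupp.lsum R (D.cell deg fun i l => E.rightAct (X i l))) := by
  let τ : (Exponent deg →₀ N) →ₗ[R] (Exponent deg →₀ N) := Finsupp.lsum R fun m : Exponent deg =>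
    Finsupp.lsingle m ∘ₗ twist N.isInternal m.degree
  have hτ : τ ∘ₗ τ = LinearMap.id := Finsupp.lhom_ext' fun m => LinearMap.ext fun a => by
    simp [τ, twist_twist]
  have hτ' : Function.Involutive τ := fun x => LinearMap.congr_fun hτ x
  have : Finsupp.lsum R (D.cell deg fun i l => E.rightAct (X i l))
      = (Finsupp.lsum R fun m : Exponent deg =>
          (E.rightAct (monomial X m.1)).unop ∘ₗ D.j) ∘ₗ τ :=
    Finsupp.lhom_ext' fun m => LinearMap.ext fun a => by
      have := map_monomial (E.rightAct : B →+* (Module.End R E)ᵐᵒᵖ) X m.1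
      change E.rightAct (monomial X m.1) = _ at this
      simp only [LinearMap.comp_apply, Finsupp.lsingle_apply, τ, Finsupp.lsum_single, this]
      rfl
  rw [this]
  exact hu.comp hτ'.bijective

/-- The monomials `x ⊗ T^m` induce an isomorphism. -/
theorem Diagonal.bijective_cell (hX : IsVariableExtension φ deg X)
    (hT : ∀ i, IsDiagonalPowers D (deg i) (X i) (T i))
    (hu : Function.Bijective (Finsupp.lsum R fun m : Exponent deg =>
      (E.rightAct (monomial X m.1)).unop ∘ₗ D.j)) :
    Function.Bijective (Finsupp.lsum R (D.cell deg T)) := by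
  have hgen := fun i l => hX.rightAct_mem_gen D i l
  have hmul : ∀ i l l', ∃ c : ℤ, E.rightAct (X i l) * E.rightAct (X i l')
      = c • E.rightAct (X i (l + l')) := fun i l l' => by
    obtain ⟨c, hc⟩ := hX.mul i l l'
    exact ⟨c, by rw [← map_mul, hc, map_zsmul]⟩
  have hodd : ∀ i, Odd (deg i) → ∀ l, 2 ≤ l → E.rightAct (X i l) = 0 := fun i hi l hl => by
    rw [hX.odd i hi l hl, map_zero]
  have hR := D.mem_shift_sizeFilt hgen hodd hmul
  set V := D.sizeFilt deg fun i l => E.rightAct (X i l) with hV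
  have hmono : Monotone V := D.sizeFilt_mono
  refine bijective_of_unitriangular Exponent.size _ _ (D.bijective_rightAct hu) fun m x => ?_
  -- The two operators of a pair add at most `k` factors, and their difference adds at most `k - 1`;
  -- the last clause is phrased from `j + 1` to `j + k` to avoid subtraction.
  let Q : (Module.End R E)ᵐᵒᵖ × (Module.End R E)ᵐᵒᵖ → ℕ → Prop := fun s k =>
    s.1 ∈ shift V k ∧ s.2 ∈ shift V k ∧ ∀ j, ∀ t ∈ V (j + 1), (s.1 - s.2).unop t ∈ V (j + k)
  have key := prod_ofFn_induction Q
    ⟨one_mem_shift V, one_mem_shift V, fun j t _ => by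
      have : (1 - 1 : (Module.End R E)ᵐᵒᵖ).unop t = 0 := by rw [sub_self]; rfl
      change (1 - 1 : (Module.End R E)ᵐᵒᵖ).unop t ∈ _
      rw [this]
      exact zero_mem _⟩
    (fun s t k l hs ht => ⟨mul_mem_shift hs.1 ht.1, mul_mem_shift hs.2.1 ht.2.1, fun j y hy => by
      have h1 : ((s * t).1 - (s * t).2).unop y
          = t.1.unop ((s.1 - s.2).unop y) + (t.1 - t.2).unop (s.2.unop y) := by
        -- Telescoping: one factor is replaced at a time, and each summand contains one difference.
        have : (s * t).1 - (s * t).2 = (s.1 - s.2) * t.1 + s.2 * (t.1 - t.2) := by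
          rw [Prod.fst_mul, Prod.snd_mul]
          noncomm_ring
        rw [this]
        rfl
      rw [h1, ← add_assoc]
      refine add_mem (ht.1 _ _ (hs.2.2 j y hy)) (ht.2.2 _ _ ?_)
      have := hs.2.1 _ y hy
      rwa [add_right_comm] at this⟩)
    (fun i => ((T i (m.1 i), E.rightAct (X i (m.1 i))) :
      (Module.End R E)ᵐᵒᵖ × (Module.End R E)ᵐᵒᵖ)) m.1 (fun i => by
        have hspan : ∀ (l j : ℕ), ∀ y ∈ V (j + 1),
            (T i l - E.rightAct (X i l)).unop y ∈ V (j + l) := by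
          intro l j y hy
          have hs := (hT i).sub_rightAct_mem l
          generalize T i l - E.rightAct (X i l) = s at hs ⊢
          induction hs using Submodule.span_induction with
          | mem s hs =>
            obtain ⟨k, b, hk, rfl⟩ := hs
            have h1 := D.L_mem_shift hgen b (fun k m => m.size < k) _ _ (hR i k _ _ hy)
            exact hmono (by omega) h1
          | zero => exact zero_mem _
          | add s s' _ _ h h' => exact add_mem h h'
          | smul r s _ h => exact Submodule.smul_mem _ r h
        refine ⟨fun j y hy => ?_, hR i _, hspan _⟩
        have h1 := add_mem (hR i (m.1 i) j y hy)
          (hspan (m.1 i) j y (hmono (Nat.le_succ j) hy))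
        change (T i (m.1 i)).unop y ∈ _
        have h2 : (T i (m.1 i)).unop y = (E.rightAct (X i (m.1 i))).unop y
            + (T i (m.1 i) - E.rightAct (X i (m.1 i))).unop y := by
          rw [MulOpposite.unop_sub, LinearMap.sub_apply, add_sub_cancel]
        rw [h2]
        exact h1)
  rw [prod_ofFn_pair] at key
  -- The monomial 1 has no factors, so x ⊗ 1 lies in the part of size less than 1.
  have hj : D.j (twist N.isInternal m.degree x) ∈ V (0 + 1) := by
    refine D.range_le_sizeFilt (m := Exponent.unit deg)
      (by rw [Exponent.size_unit]; exact Nat.one_pos) ?_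
    have h1 : monomial (fun i l => E.rightAct (X i l)) (Exponent.unit deg).1 = 1 := by
      simp [monomial, Exponent.unit, hX.zero]
    have := D.monomial_mem_range_cell (T := fun i l => E.rightAct (X i l)) (Exponent.unit deg)
      (twist N.isInternal m.degree x)
    rwa [h1] at this
  have := key.2.2 0 _ hj
  rw [zero_add] at this
  exact this

theorem Diagonal.mem_weightFilt_zero (h : Function.Surjective (Finsupp.lsum R (D.cell deg T)))
    (t : E) : t ∈ D.weightFilt deg T 0 := by
  obtain ⟨c, rfl⟩ := h t
  rw [Finsupp.lsum_apply]
  exact Submodule.sum_mem _ fun m _ => D.range_le_weightFilt (Nat.zero_le _) ⟨_, rfl⟩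

/-- B is generated by A and the powers of the variables. On A the right action equals the left one,
and right multiplication by `X i l` is left multiplication plus terms in `T i`; all of these
preserve the weight filtration. -/
theorem Diagonal.rightAct_mem_shift (hX : IsVariableExtension φ deg X)
    (hT : ∀ i, IsDiagonalPowers D (deg i) (X i) (T i)) (b : B) :
    E.rightAct b ∈ shift (D.weightFilt deg T) 0 := by
  have hL : ∀ b, D.L b ∈ shift (D.weightFilt deg T) 0 := fun b =>
    D.L_mem_shift (fun i => (hT i).mem_gen) b (fun k m => k ≤ m.weight)
  have hTm := D.mem_shift_weightFilt (fun i => (hT i).mem_gen) (fun i => (hT i).odd)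
    (fun i => (hT i).mul)
  have hXm : ∀ i l, E.rightAct (X i l) ∈ shift (D.weightFilt deg T) 0 := by
    intro i l
    rcases Nat.eq_zero_or_pos l with rfl | hl
    · rw [hX.zero, map_one]
      exact one_mem_shift _
    · have h1 : E.rightAct (X i l) - D.L (X i l) - T i l ∈ shift (D.weightFilt deg T) 0 := by
        refine Submodule.span_le.2 ?_ ((hT i).sub_mem l hl)
        rintro _ ⟨k, b, _, _, rfl⟩
        have := mul_mem_shift (hTm i k) (hL b)
        exact shift_antitone D.weightFilt_anti (Nat.zero_le _) this
      have h2 := add_mem (add_mem h1 (shift_antitone D.weightFilt_anti (Nat.zero_le _) (hTm i l)))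
        (hL (X i l))
      rwa [sub_sub, add_assoc, add_comm (T i l), sub_add_cancel] at h2
  let K : Subalgebra R B := (shiftSubalgebra (D.weightFilt deg T)).comap E.rightAct
  change b ∈ K
  obtain ⟨c, rfl⟩ := hX.basis.2 b
  refine Subalgebra.sum_mem _ fun m _ => Subalgebra.mul_mem _ ?_ ?_
  · refine Subalgebra.list_prod_mem _ fun b hb => ?_
    obtain ⟨i, rfl⟩ := List.mem_ofFn.1 hb
    exact hXm i _
  · change E.rightAct (φ (c m)) ∈ shift (D.weightFilt deg T) 0
    rw [← D.L_map]
    exact hL _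

/-- The elements `b` such that `1 ⊗ b - b ⊗ 1` raises the weight by at least `k`. -/
noncomputable def Diagonal.raising (hX : IsVariableExtension φ deg X)
    (hT : ∀ i, IsDiagonalPowers D (deg i) (X i) (T i)) (k : ℕ) : Subalgebra R B where
  carrier := {b | E.rightAct b - D.L b ∈ shift (D.weightFilt deg T) k}
  mul_mem' := by
    intro b c hb hc
    -- The difference of the two actions satisfies a derivation-like rule, so the elements on which
    -- it raises the weight by `k` are closed under products.
    have : E.rightAct (b * c) - D.L (b * c)
        = (E.rightAct b - D.L b) * E.rightAct c + D.L b * (E.rightAct c - D.L c) := by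
      rw [map_mul, map_mul]
      noncomm_ring
    change _ ∈ shift _ _
    rw [this]
    refine add_mem (mul_mem_shift (l := 0) hb (D.rightAct_mem_shift hX hT c)) ?_
    have := mul_mem_shift (k := 0)
      (D.L_mem_shift (fun i => (hT i).mem_gen) b (fun k m => k ≤ m.weight)) hc
    rwa [zero_add] at this
  add_mem' := by
    intro b c hb hc
    change _ ∈ shift _ _
    rw [map_add, map_add, add_sub_add_comm]
    exact add_mem hb hc
  algebraMap_mem' := by
    intro r
    change _ ∈ shift _ _
    rw [AlgHom.commutes, AlgHom.commutes, sub_self]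
    exact zero_mem _

theorem Diagonal.map_mem_raising (hX : IsVariableExtension φ deg X)
    (hT : ∀ i, IsDiagonalPowers D (deg i) (X i) (T i)) (k : ℕ) (a : A) :
    φ a ∈ D.raising hX hT k := by
  change _ ∈ shift _ _
  rw [D.L_map, sub_self]
  exact zero_mem _

/-- By `sub_mem`, the difference of the two actions of `X i l` is made of positive powers of the
diagonal variable, each raising the weight by at least n - i. -/
theorem Diagonal.variable_mem_raising (hX : IsVariableExtension φ deg X)
    (hT : ∀ i, IsDiagonalPowers D (deg i) (X i) (T i)) {k : ℕ} {i : Fin n}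
    (hk : k ≤ n - i) (l : ℕ) : X i l ∈ D.raising hX hT k := by
  change E.rightAct (X i l) - D.L (X i l) ∈ shift (D.weightFilt deg T) k
  rcases Nat.eq_zero_or_pos l with rfl | hl
  · rw [hX.zero, map_one, map_one, sub_self]
    exact zero_mem _
  · have hTm : ∀ l, 1 ≤ l → T i l ∈ shift (D.weightFilt deg T) k := fun l hl =>
      shift_antitone D.weightFilt_anti (hk.trans (Nat.le_mul_of_pos_left _ hl))
        (D.mem_shift_weightFilt (fun i => (hT i).mem_gen) (fun i => (hT i).odd)
          (fun i => (hT i).mul) i l)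
    have h1 : E.rightAct (X i l) - D.L (X i l) - T i l ∈ shift (D.weightFilt deg T) k := by
      refine Submodule.span_le.2 ?_ ((hT i).sub_mem l hl)
      rintro _ ⟨j, b, hj, _, rfl⟩
      exact mul_mem_shift (l := 0) (hTm j hj)
        (D.L_mem_shift (fun i => (hT i).mem_gen) b (fun k m => k ≤ m.weight))
    have := add_mem h1 (hTm l hl)
    rwa [sub_add_cancel] at this

/-- Every variable has weight at least 1. Hence the left and right actions coincide on the
associated graded module. -/
theorem Diagonal.mem_raising_one (hX : IsVariableExtension φ deg X)
    (hT : ∀ i, IsDiagonalPowers D (deg i) (X i) (T i)) (b : B) : b ∈ D.raising hX hT 1 := by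
  obtain ⟨c, rfl⟩ := hX.basis.2 b
  refine Subalgebra.sum_mem _ fun m _ => Subalgebra.mul_mem _ ?_ (D.map_mem_raising hX hT _ _)
  refine Subalgebra.list_prod_mem _ fun b hb => ?_
  obtain ⟨i, rfl⟩ := List.mem_ofFn.1 hb
  exact D.variable_mem_raising hX hT (by have := i.2; omega) _

/-- This is why weights decrease with the index: dX_i involves only variables X_j with j < i, of
weight n - j ≥ n - i + 1. -/
theorem Diagonal.d_mem_raising (hX : IsVariableExtension φ deg X)
    (hT : ∀ i, IsDiagonalPowers D (deg i) (X i) (T i)) (i : Fin n) :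
    B.d (X i 1) ∈ D.raising hX hT (n - i + 1) := by
  refine Algebra.adjoin_le ?_ (hX.d_mem i)
  rintro b (⟨a, rfl⟩ | ⟨j, m, hj, rfl⟩)
  · exact D.map_mem_raising hX hT _ a
  · have h1 : (j : ℕ) < i := hj
    have h2 := i.2
    exact D.variable_mem_raising hX hT (by omega) m

/-- The operator `T^m` commutes with the differential up to terms of higher weight. -/
theorem Diagonal.d_monomial (hX : IsVariableExtension φ deg X)
    (hT : ∀ i, IsDiagonalPowers D (deg i) (X i) (T i)) (m : Exponent deg) :
    ∃ s ∈ shift (D.weightFilt deg T) (m.weight + 1),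
    ∀ t, E.d ((monomial T m.1).unop t)
      = (monomial T m.1).unop (E.d t) + s.unop (signOp E.isInternal t) := by
  -- The third clause, commutation with the sign operator up to a sign, is needed to combine the
  -- error terms of two factors.
  let Q : (Module.End R E)ᵐᵒᵖ → ℕ → Prop := fun y k => y ∈ shift (D.weightFilt deg T) k ∧
    (∃ s ∈ shift (D.weightFilt deg T) (k + 1), ∀ t, E.d (y.unop t)
      = y.unop (E.d t) + s.unop (signOp E.isInternal t)) ∧
    ∃ ε : ℤˣ, ∀ t, signOp E.isInternal (y.unop t) = (ε : ℤ) • y.unop (signOp E.isInternal t)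
  have key := prod_ofFn_induction Q
    ⟨one_mem_shift _, ⟨0, zero_mem _, fun t => by simp⟩, 1, fun t => by simp⟩
    (fun y z k l hy hz => ⟨mul_mem_shift hy.1 hz.1, by
        obtain ⟨hy, ⟨s, hs, hsd⟩, ε, hε⟩ := hy
        obtain ⟨hz, ⟨s', hs', hsd'⟩, -⟩ := hz
        refine ⟨s * z + (ε : ℤ) • (y * s'), add_mem ?_ (zsmul_mem (mul_mem_shift hy hs') _), ?_⟩
        · rw [add_right_comm]
          exact mul_mem_shift hs hz
        · intro t
          change E.d (z.unop (y.unop t)) = z.unop (y.unop (E.d t)) +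
            (z.unop (s.unop (signOp E.isInternal t))
              + (ε : ℤ) • s'.unop (y.unop (signOp E.isInternal t)))
          rw [hsd', hsd, hε, map_add, map_zsmul, add_assoc], by
        obtain ⟨-, -, ε, hε⟩ := hy
        obtain ⟨-, -, ε', hε'⟩ := hz
        refine ⟨ε' * ε, fun t => ?_⟩
        change signOp E.isInternal (z.unop (y.unop t)) = _ • z.unop (y.unop _)
        rw [hε', hε, map_zsmul, smul_smul, Units.val_mul]⟩)
    (fun i => T i (m.1 i)) (fun i : Fin n => m.1 i * (n - i)) (fun i => by
      refine ⟨D.mem_shift_weightFilt (fun i => (hT i).mem_gen) (fun i => (hT i).odd)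
        (fun i => (hT i).mul) i _, ?_, _,
        D.gen_signOp ((hT i).mem_gen _)⟩
      rcases m.1 i with _ | l
      · exact ⟨0, zero_mem _, fun t => by simp [(hT _).zero]⟩
      · obtain ⟨c, hc⟩ := (hT i).d l
        refine ⟨_, zsmul_mem ?_ c, hc⟩
        -- The error raises the weight by at least l(n - i) + (n - i + 1), one more than the weight
        -- (l + 1)(n - i) of `T i (l + 1)`.
        have h := mul_mem_shift (D.mem_shift_weightFilt (fun i => (hT i).mem_gen)
          (fun i => (hT i).odd) (fun i => (hT i).mul) i l)
          (D.d_mem_raising hX hT i)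
        rwa [← add_assoc, ← Nat.succ_mul] at h)
  exact key.2.1

theorem Diagonal.π_cell_unit (hT : ∀ i, IsDiagonalPowers D (deg i) (X i) (T i)) (x : N) :
    D.π.toLinearMap (D.cell deg T (Exponent.unit deg) x) = x := by
  have h1 : monomial T (Exponent.unit deg).1 = 1 := by
    simp [monomial, Exponent.unit, (hT _).zero]
  rw [D.cell_apply, h1, Exponent.degree_unit, twist_zero]
  exact D.π_j x

/-- Under x ⊗ b ↦ xb both actions become the action on N, so π kills their difference. Strong
induction passes to higher powers, since `sub_mem` involves only smaller positive ones. -/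
theorem Diagonal.π_diagonal (hT : ∀ i, IsDiagonalPowers D (deg i) (X i) (T i)) (i : Fin n)
    {l : ℕ} (hl : 1 ≤ l) (t : E) : D.π.toLinearMap ((T i l).unop t) = 0 := by
  induction l using Nat.strong_induction_on generalizing t with
  | _ l ih =>
    have h0 : ∀ t, D.π.toLinearMap ((E.rightAct (X i l) - D.L (X i l)).unop t) = 0 := fun t => by
      rw [MulOpposite.unop_sub, LinearMap.sub_apply, map_sub, D.π_L, DGMod.rightAct_apply,
        map_smul, sub_self]
    have h1 : ∀ t, D.π.toLinearMap
        ((E.rightAct (X i l) - D.L (X i l) - T i l).unop t) = 0 := by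
      intro t
      have hs := (hT i).sub_mem l hl
      generalize E.rightAct (X i l) - D.L (X i l) - T i l = s at hs ⊢
      induction hs using Submodule.span_induction with
      | mem s hs =>
        obtain ⟨k, b, hk, hkl, rfl⟩ := hs
        change D.π.toLinearMap ((D.L b).unop ((T i k).unop t)) = 0
        rw [D.π_L, ih k hkl hk, smul_zero]
      | zero => exact map_zero _
      | add s s' _ _ h h' =>
        rw [MulOpposite.unop_add, LinearMap.add_apply, map_add, h, h', add_zero]
      | smul r s _ h =>
        rw [MulOpposite.unop_smul, LinearMap.smul_apply]
        have := map_smul (D.π.toLinearMap.restrictScalars R) r (s.unop t)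
        exact this.trans (by rw [LinearMap.coe_restrictScalars, h, smul_zero])
    have h2 := h1 t
    rw [MulOpposite.unop_sub, LinearMap.sub_apply, map_sub, h0, zero_sub, neg_eq_zero] at h2
    exact h2

/-- The factors of a monomial act one after the other, and π kills the image of the last nontrivial
one. -/
theorem Diagonal.π_cell (hT : ∀ i, IsDiagonalPowers D (deg i) (X i) (T i)) {m : Exponent deg}
    (hm : 0 < m.size) (x : N) : D.π.toLinearMap (D.cell deg T m x) = 0 := by
  let Q : (Module.End R E)ᵐᵒᵖ → ℕ → Prop := fun s k =>
    (k = 0 → s = 1) ∧ (0 < k → ∀ t, D.π.toLinearMap (s.unop t) = 0)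
  have key := prod_ofFn_induction Q ⟨fun _ => rfl, fun h => absurd h (lt_irrefl 0)⟩
    (fun s t k l hs ht => by
      refine ⟨fun h => ?_, fun h y => ?_⟩
      · rw [hs.1 (by omega), ht.1 (by omega), mul_one]
      · rcases Nat.eq_zero_or_pos l with hl | hl
        · rw [ht.1 hl, mul_one]
          exact hs.2 (by omega) y
        · exact ht.2 hl _)
    (fun i => T i (m.1 i)) m.1
    (fun i => ⟨fun h => by rw [h, (hT _).zero], fun h t => D.π_diagonal hT i h t⟩)
  exact key.2 hm _

/-- The filtration of `N|_A ⊗_A B` by the weight of the diagonal variables. -/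
noncomputable def Diagonal.cellStructure (hX : IsVariableExtension φ deg X)
    (hT : ∀ i, IsDiagonalPowers D (deg i) (X i) (T i))
    (hu : Function.Bijective (Finsupp.lsum R fun m : Exponent deg =>
      (E.rightAct (monomial X m.1)).unop ∘ₗ D.j)) : DGMod.CellStructure N E (Exponent deg) :=
  have hb := D.bijective_cell hX hT hu
  have hsingle : ∀ m x, LinearEquiv.ofBijective _ hb (Finsupp.single m x) = D.cell deg T m x :=
    fun m x => by simp
  have hcoord : ∀ k, ∀ t ∈ D.weightFilt deg T (k + 1), ∀ m : Exponent deg, m.weight ≤ k →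
      (LinearEquiv.ofBijective _ hb).symm t m = 0 := fun k t ht m hm => by
    refine (iSup₂_le fun m' hm' => ?_ : D.weightFilt deg T (k + 1) ≤ LinearMap.ker
      (Finsupp.lapply m ∘ₗ (LinearEquiv.ofBijective _ hb).symm.toLinearMap)) ht
    rintro _ ⟨x, rfl⟩
    rw [LinearMap.mem_ker, LinearMap.comp_apply, LinearEquiv.coe_coe, ← hsingle,
      LinearEquiv.symm_apply_apply, Finsupp.lapply_apply, Finsupp.single_eq_of_ne]
    rintro rfl
    omega
  { wt := Exponent.weight
    deg := Exponent.degree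
    equiv := LinearEquiv.ofBijective _ hb
    finite_wt := Exponent.finite_weight
    bound := n
    wt_le := Exponent.weight_le hX.deg_pos
    single_mem := fun m i x hx => by
      rw [hsingle]
      exact D.gen_mem (D.monomial_mem_gen (fun i => (hT i).mem_gen) m) (D.j_mem (twist_mem _ _ hx))
    single_smul := fun m x b m' hm' => by
      refine hcoord _ _ ?_ m' hm'
      rw [hsingle, hsingle]
      refine mem_of_gr_le B.isInternal (S := (D.weightFilt deg T (m.weight + 1)).comap
        ((Algebra.lsmul R R E).toLinearMap.flip (D.cell deg T m x) ∘ₗ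
          (MulOpposite.opLinearEquiv R : (B : Type u) ≃ₗ[R] (B : Type u)ᵐᵒᵖ).toLinearMap
        - D.cell deg T m ∘ₗ (Algebra.lsmul R R N).toLinearMap.flip x ∘ₗ
          (MulOpposite.opLinearEquiv R : (B : Type u) ≃ₗ[R] (B : Type u)ᵐᵒᵖ).toLinearMap))
        (fun j b hbj => ?_) b
      change D.cell deg T m x <• b - D.cell deg T m (x <• b)
        ∈ D.weightFilt deg T (m.weight + 1)
      set y := D.j (twist N.isInternal m.degree x) with hy
      -- Moving b across T^m gives the sign (-1)^(|m||b|), and the twist in `cell` gives the same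
      -- sign for x b. What remains is T^m applied to the difference of the two actions, which
      -- raises the weight by one more.
      have h1 : D.cell deg T m x <• b
          = ((m.degree * j).negOnePow : ℤ) • (monomial T m.1).unop ((E.rightAct b).unop y) :=
        LinearMap.congr_fun (congrArg MulOpposite.unop
          (D.gen_mul_act (D.monomial_mem_gen (fun i => (hT i).mem_gen) m) hbj).1) y
      have h2 : D.cell deg T m (x <• b)
          = ((m.degree * j).negOnePow : ℤ) • (monomial T m.1).unop ((D.L b).unop y) := by
        rw [D.cell_apply, twist_smul, twist_of_mem _ _ hbj, MulOpposite.op_smul, smul_assoc,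
          map_zsmul, map_zsmul, D.j_smul]
      rw [h1, h2, ← smul_sub, ← map_sub, add_comm]
      refine zsmul_mem ?_ _
      have h3 := D.mem_raising_one hX hT b 0 y (D.mem_weightFilt_zero hb.2 y)
      have h4 := prod_ofFn_induction (fun s k => s ∈ shift (D.weightFilt deg T) k)
        (one_mem_shift _) (fun s t k l hs ht => mul_mem_shift hs ht) (fun i => T i (m.1 i))
        (fun i : Fin n => m.1 i * (n - i))
        (fun i => D.mem_shift_weightFilt (fun i => (hT i).mem_gen) (fun i => (hT i).odd)
          (fun i => (hT i).mul) i _)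
      have h5 := h4 _ _ h3
      rw [zero_add] at h5
      exact h5
    single_d := fun m x m' hm' => by
      refine hcoord _ _ ?_ m' hm'
      obtain ⟨s, hs, hsd⟩ := D.d_monomial hX hT m
      -- Passing the differential through the twist produces the sign of the shift by |m|, so the
      -- main terms cancel and only the higher-weight error is left.
      rw [hsingle, hsingle, D.cell_apply, hsd, D.cell_apply, D.j_d, DGMod.d_twist, map_zsmul,
        map_zsmul, map_zsmul, map_zsmul, map_zsmul, add_sub_cancel_left]
      have h := hs 0 _ (D.mem_weightFilt_zero hb.2
        (signOp E.isInternal (D.j (twist N.isInternal m.degree x))))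
      rw [zero_add] at h
      exact h }

theorem Diagonal.cellStructure_single (hX : IsVariableExtension φ deg X)
    (hT : ∀ i, IsDiagonalPowers D (deg i) (X i) (T i))
    (hu : Function.Bijective (Finsupp.lsum R fun m : Exponent deg =>
      (E.rightAct (monomial X m.1)).unop ∘ₗ D.j)) (m : Exponent deg) (x : N) :
    (D.cellStructure hX hT hu).equiv (Finsupp.single m x) = D.cell deg T m x := by
  change LinearEquiv.ofBijective _ (D.bijective_cell hX hT hu) (Finsupp.single m x) = _
  simp

/-- The monomial 1 is the only one of weight zero, and π is its coordinate. -/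
theorem Diagonal.mem_filt_one (hX : IsVariableExtension φ deg X)
    (hT : ∀ i, IsDiagonalPowers D (deg i) (X i) (T i))
    (hu : Function.Bijective (Finsupp.lsum R fun m : Exponent deg =>
      (E.rightAct (monomial X m.1)).unop ∘ₗ D.j)) (t : E) :
    t ∈ (D.cellStructure hX hT hu).filt 1 ↔ D.π.toLinearMap t = 0 := by
  set C := D.cellStructure hX hT hu with hC
  have h1 : D.π.toLinearMap t = C.coord (Exponent.unit deg) t := by
    conv_lhs => rw [C.eq_sum t, map_sum]
    rw [Finset.sum_eq_single (Exponent.unit deg)]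
    · rw [hC, D.cellStructure_single, D.π_cell_unit hT]
    · intro m _ hm
      rw [hC, D.cellStructure_single, D.π_cell hT]
      by_contra h
      exact hm (Exponent.eq_unit (by omega))
    · intro hm
      have h0 : C.coord (Exponent.unit deg) t = 0 := Finsupp.notMem_support_iff.1 hm
      rw [h0, Finsupp.single_zero, map_zero, map_zero]
  rw [h1, C.mem_filt]
  constructor
  · intro h
    exact h _ (by change (Exponent.unit deg).weight < 1; rw [Exponent.weight_unit]; exact one_pos)
  · intro h m hm
    have : m = Exponent.unit deg := Exponent.eq_unit_of_weight (Nat.lt_one_iff.1 hm)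
    rw [this, h]

end CellStructureOfDiagonal

/-! ### Divided powers of a difference in a ring -/

section DividedPowers

open Finset.HasAntidiagonal (antidiagonal mem_antidiagonal)

variable {S : Type*} [Ring S] {a b : ℕ → S}

/-- The divided power `(x - y)^(l)`, where `a p` and `b q` are the divided powers of `x`
and `y`. -/
def subDividedPower (a b : ℕ → S) (l : ℕ) : S :=
  ∑ x ∈ antidiagonal l, (-1 : ℤ) ^ x.2 • (a x.1 * b x.2)

/-- Vandermonde's identity: for fixed z = x + y the coefficients add up to C(l + l', l). Pairs x
that do not fit below z contribute a vanishing binomial coefficient. -/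
theorem choose_smul_sum_antidiagonal (c : ℕ × ℕ → S) (l l' : ℕ) :
    ∑ x ∈ antidiagonal l, ∑ y ∈ antidiagonal l',
      ((x.1 + y.1).choose x.1 * (x.2 + y.2).choose x.2) • c (x.1 + y.1, x.2 + y.2)
      = (l + l').choose l • ∑ z ∈ antidiagonal (l + l'), c z := by
  have h1 : ∀ x ∈ antidiagonal l, ∑ y ∈ antidiagonal l',
      ((x.1 + y.1).choose x.1 * (x.2 + y.2).choose x.2) • c (x.1 + y.1, x.2 + y.2)
      = ∑ z ∈ antidiagonal (l + l'), (z.1.choose x.1 * z.2.choose x.2) • c z := by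
    intro x hx
    rw [mem_antidiagonal] at hx
    refine Finset.sum_of_injOn (fun y => (x.1 + y.1, x.2 + y.2)) ?_ ?_ ?_ fun _ _ => rfl
    · intro y _ z _ h
      simp only [Prod.mk.injEq, add_right_inj] at h
      exact Prod.ext h.1 h.2
    · intro y hy
      simp only [Finset.mem_coe, mem_antidiagonal] at hy ⊢
      omega
    · intro z hz hz'
      rw [mem_antidiagonal] at hz
      by_cases h : x.1 ≤ z.1 ∧ x.2 ≤ z.2
      · refine absurd ⟨(z.1 - x.1, z.2 - x.2), ?_, ?_⟩ hz'
        · simp only [Finset.mem_coe, mem_antidiagonal]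
          omega
        · exact Prod.ext (by simp only; omega) (by simp only; omega)
      · rcases not_and_or.1 h with h | h
        · rw [Nat.choose_eq_zero_of_lt (not_le.1 h), zero_mul, zero_smul]
        · rw [Nat.choose_eq_zero_of_lt (not_le.1 h), mul_zero, zero_smul]
  rw [Finset.sum_congr rfl h1, Finset.sum_comm, Finset.smul_sum]
  refine Finset.sum_congr rfl fun z hz => ?_
  rw [← mem_antidiagonal.1 hz, Nat.add_choose_eq, Finset.sum_smul]

theorem subDividedPower_mul (ha : ∀ p q, a p * a q = (p + q).choose p • a (p + q))
    (hb : ∀ p q, b p * b q = (p + q).choose p • b (p + q)) (hab : ∀ p q, Commute (a p) (b q))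
    (l l' : ℕ) : subDividedPower a b l * subDividedPower a b l'
      = (l + l').choose l • subDividedPower a b (l + l') := by
  rw [subDividedPower, subDividedPower, subDividedPower, Finset.sum_mul_sum,
    ← choose_smul_sum_antidiagonal]
  refine Finset.sum_congr rfl fun x _ => Finset.sum_congr rfl fun y _ => ?_
  rw [smul_mul_smul_comm, ← pow_add, mul_assoc, ← mul_assoc (b x.2), ← (hab y.1 x.2).eq,
    mul_assoc (a y.1), ← mul_assoc, ha, hb, smul_mul_smul_comm, smul_comm]

theorem subDividedPower_zero (ha : a 0 = 1) (hb : b 0 = 1) : subDividedPower a b 0 = 1 := by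
  simp [subDividedPower, ha, hb]

/-- This is exp((x - y)t) exp(yt) = exp(xt) for generating series. The series with coefficients
(-1)^q b_q is inverse to that of b because alternating sums of binomial coefficients vanish. -/
theorem sum_subDividedPower_mul (hb : ∀ p q, b p * b q = (p + q).choose p • b (p + q))
    (hb0 : b 0 = 1) (l : ℕ) :
    ∑ x ∈ antidiagonal l, subDividedPower a b x.1 * b x.2 = a l := by
  have h1 : PowerSeries.mk (fun q => (-1 : ℤ) ^ q • b q) * PowerSeries.mk b = 1 := by
    ext r
    rw [PowerSeries.coeff_mul, PowerSeries.coeff_one]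
    simp only [PowerSeries.coeff_mk, smul_mul_assoc, hb]
    have : ∀ x ∈ antidiagonal r, (-1 : ℤ) ^ x.1 • (x.1 + x.2).choose x.1 • b (x.1 + x.2)
        = ((-1 : ℤ) ^ x.1 * (r.choose x.1 : ℤ)) • b r := fun x hx => by
      rw [mem_antidiagonal.1 hx, mul_smul, natCast_zsmul]
    rw [Finset.sum_congr rfl this, ← Finset.sum_smul,
      Finset.Nat.sum_antidiagonal_eq_sum_range_succ (fun i _ => (-1 : ℤ) ^ i * (r.choose i : ℤ)),
      Int.alternating_sum_range_choose]
    split_ifs with h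
    · rw [h, hb0, one_smul]
    · rw [zero_smul]
  have h2 : PowerSeries.mk (subDividedPower a b)
      = PowerSeries.mk a * PowerSeries.mk (fun q => (-1 : ℤ) ^ q • b q) := by
    ext r
    simp only [PowerSeries.coeff_mul, PowerSeries.coeff_mk, mul_smul_comm, subDividedPower]
  have h3 : PowerSeries.mk (subDividedPower a b) * PowerSeries.mk b = PowerSeries.mk a := by
    rw [h2, mul_assoc, h1, mul_one]
  have := congrArg (PowerSeries.coeff l) h3
  simpa only [PowerSeries.coeff_mul, PowerSeries.coeff_mk] using this

end DividedPowers

/-! ### Powers of the diagonal variables -/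

open Finset.HasAntidiagonal (antidiagonal mem_antidiagonal)

namespace Diagonal

variable {A B : DGAlg.{u} R} {φ : A.Hom B} {N E : DGMod B} (D : Diagonal φ N E)

/-- The operator of multiplication by `1 ⊗ x - x ⊗ 1`. -/
def diff (x : B) : (Module.End R E)ᵐᵒᵖ := E.rightAct x - D.L x

variable {e : ℤ} {x : B}

theorem diff_mem_gen (hx : x ∈ B.gr e) : D.diff x ∈ D.gen e :=
  sub_mem (D.rightAct_mem_gen hx) (D.L_mem_gen hx)

theorem diff_pow_mem_gen (hx : x ∈ B.gr e) (l : ℕ) : D.diff x ^ l ∈ D.gen (l * e) := by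
  induction l with
  | zero => simpa using D.one_mem_gen
  | succ l ih =>
    rw [pow_succ, Nat.cast_succ, add_mul, one_mul]
    exact D.mul_mem_gen ih (D.diff_mem_gen hx)

theorem rightAct_d (b : B) (t : E) : E.d ((E.rightAct b).unop t)
    = (E.rightAct b).unop (E.d t) + (E.rightAct (B.d b)).unop (signOp E.isInternal t) :=
  E.leibniz_signOp t b

theorem diff_d (hx : x ∈ B.gr e) (t : E) : E.d ((D.diff x).unop t)
    = (D.diff x).unop (E.d t) + (D.diff (B.d x)).unop (signOp E.isInternal t) := by
  simp only [diff, MulOpposite.unop_sub, LinearMap.sub_apply, map_sub, rightAct_d, D.L_d hx]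
  abel

/-- The mixed terms cancel by anticommutation; the squares vanish because x² = 0 is required for odd
x, so 2 need not be invertible. -/
theorem diff_mul_diff_of_odd (he : Odd e) (hx : x ∈ B.gr e) : D.diff x * D.diff x = 0 := by
  have h1 := D.L_mul_rightAct hx hx
  rw [Int.negOnePow_odd _ (he.mul he)] at h1
  rw [diff, sub_mul, mul_sub, mul_sub, ← map_mul, ← map_mul, B.mul_self_odd he hx, map_zero,
    map_zero, h1]
  simp

theorem isDiagonalPowers_of_odd (he : Odd e) {X : ℕ → B} (hX : X 1 ∈ B.gr e) (h0 : X 0 = 1)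
    (h2 : ∀ l, 2 ≤ l → X l = 0) :
    IsDiagonalPowers D e X fun l => if l = 0 then 1 else if l = 1 then D.diff (X 1) else 0 where
  mem_gen l := by
    match l with
    | 0 => simpa using D.one_mem_gen
    | 1 => simpa using D.diff_mem_gen hX
    | l + 2 => exact zero_mem _
  zero := rfl
  odd _ l hl := by
    rw [if_neg (by omega), if_neg (by omega)]
  mul l l' := by
    match l, l' with
    | 0, l' => exact ⟨1, by simp⟩
    | l + 1, 0 => exact ⟨1, by simp⟩
    | 1, 1 => exact ⟨1, by simp [D.diff_mul_diff_of_odd he hX]⟩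
    | 1, l' + 2 => exact ⟨0, by simp⟩
    | l + 2, l' + 1 => exact ⟨0, by simp⟩
  sub_rightAct_mem l := by
    match l with
    | 0 => simp [h0]
    | 1 =>
      have : D.diff (X 1) - E.rightAct (X 1) = -(E.rightAct (X 0) * D.L (X 1)) := by
        rw [h0, map_one, one_mul, diff, sub_sub_cancel_left]
      rw [if_neg one_ne_zero, if_pos rfl, this]
      exact neg_mem (Submodule.subset_span ⟨0, X 1, one_pos, rfl⟩)
    | l + 2 => simp [h2]
  sub_mem l hl := by
    match l with
    | 1 => simp [diff]
    | l + 2 => simp [h2]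
  d l := by
    match l with
    | 0 => exact ⟨1, fun t => by simpa [diff] using D.diff_d hX t⟩
    | l + 1 => exact ⟨0, fun t => by simp⟩

theorem rightAct_comm_L_of_even (he : Even e) (hx : x ∈ B.gr e) (b : B) :
    Commute (E.rightAct x) (D.L b) := by
  refine mem_of_gr_le B.isInternal (S := LinearMap.ker
    ((LinearMap.mulLeft R (E.rightAct x) - LinearMap.mulRight R (E.rightAct x)) ∘ₗ
      D.L.toLinearMap)) (fun j b hb => ?_) b |> sub_eq_zero.1
  have := D.rightAct_mul_L hb hx
  rw [Int.negOnePow_even _ (he.mul_right j), Units.val_one, one_smul] at this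
  exact sub_eq_zero.2 this

theorem diff_pow_d (he : Even e) (hx : x ∈ B.gr e) (l : ℕ) (t : E) :
    E.d ((D.diff x ^ (l + 1)).unop t) = (D.diff x ^ (l + 1)).unop (E.d t)
      + (((l + 1 : ℕ) : ℤ) • (D.diff x ^ l * D.diff (B.d x))).unop (signOp E.isInternal t) := by
  induction l with
  | zero => simpa using D.diff_d hx t
  | succ l ih =>
    have hcomm : D.diff (B.d x) * D.diff x = D.diff x * D.diff (B.d x) := by
      have := D.gen_comm (D.diff_mem_gen (B.d_mem hx)) (D.diff_mem_gen hx)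
      rwa [Int.negOnePow_even _ (he.mul_left _), Units.val_one, one_smul] at this
    have hsign := D.gen_signOp (D.diff_pow_mem_gen hx (l + 1)) t
    rw [Int.negOnePow_even _ (he.mul_left _), Units.val_one, one_smul] at hsign
    have h1 : (((l + 1 + 1 : ℕ) : ℤ) • (D.diff x ^ (l + 1) * D.diff (B.d x)))
        = (((l + 1 : ℕ) : ℤ) • (D.diff x ^ l * D.diff (B.d x))) * D.diff x
          + D.diff x ^ (l + 1) * D.diff (B.d x) := by
      rw [smul_mul_assoc, mul_assoc, hcomm, ← mul_assoc, ← pow_succ]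
      push_cast
      rw [add_smul, one_smul]
    rw [h1, pow_succ (D.diff x) (l + 1)]
    change E.d ((D.diff x).unop ((D.diff x ^ (l + 1)).unop t))
      = (D.diff x).unop ((D.diff x ^ (l + 1)).unop (E.d t))
        + ((D.diff x).unop ((((l + 1 : ℕ) : ℤ) • (D.diff x ^ l * D.diff (B.d x))).unop
            (signOp E.isInternal t))
          + (D.diff (B.d x)).unop ((D.diff x ^ (l + 1)).unop (signOp E.isInternal t)))
    rw [D.diff_d hx, ih, hsign, map_add, add_assoc]

/-- The binomial theorem is used twice: for Δ = R - L to find the leading term of Δ^l, and for R = Δ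
+ L to express R^l - L^l through powers of Δ. -/
theorem isDiagonalPowers_pow (he : Even e) (hx : x ∈ B.gr e) :
    IsDiagonalPowers D e (fun l => x ^ l) fun l => D.diff x ^ l where
  mem_gen := D.diff_pow_mem_gen hx
  zero := pow_zero _
  odd ho := absurd he (Int.not_even_iff_odd.2 ho)
  mul l l' := ⟨1, by rw [one_smul, pow_add]⟩
  sub_rightAct_mem l := by
    have hc : Commute (E.rightAct x) (D.L (-x)) := D.rightAct_comm_L_of_even he hx _
    have h1 : D.diff x = E.rightAct x + D.L (-x) := by rw [diff, map_neg, sub_eq_add_neg]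
    rw [h1, hc.add_pow, Finset.sum_range_succ, Nat.sub_self, pow_zero, mul_one, Nat.choose_self,
      Nat.cast_one, mul_one, map_pow, add_sub_cancel_right]
    refine Submodule.sum_mem _ fun k hk => ?_
    refine Submodule.subset_span ⟨k, (-x) ^ (l - k) * (l.choose k : ℕ), Finset.mem_range.1 hk, ?_⟩
    rw [map_mul, map_pow, map_pow, map_natCast, mul_assoc]
  sub_mem l hl := by
    have hc : Commute (D.diff x) (D.L x) :=
      (D.rightAct_comm_L_of_even he hx x).sub_left (Commute.refl _)
    have h1 : E.rightAct (x ^ l) = (D.diff x + D.L x) ^ l := by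
      rw [diff, sub_add_cancel, map_pow]
    obtain ⟨l, rfl⟩ := Nat.exists_eq_add_of_le' hl
    have h2 : E.rightAct (x ^ (l + 1)) - D.L (x ^ (l + 1)) - D.diff x ^ (l + 1)
        = ∑ k ∈ Finset.range l, D.diff x ^ (k + 1) * D.L x ^ (l + 1 - (k + 1))
          * ((l + 1).choose (k + 1) : ℕ) := by
      rw [h1, hc.add_pow, Finset.sum_range_succ, Finset.sum_range_succ', map_pow]
      simp only [pow_zero, one_mul, Nat.choose_zero_right, Nat.choose_self, Nat.cast_one, mul_one,
        Nat.sub_zero, Nat.sub_self]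
      abel
    rw [h2]
    refine Submodule.sum_mem _ fun k hk => ?_
    refine Submodule.subset_span ⟨k + 1, x ^ (l + 1 - (k + 1)) * ((l + 1).choose (k + 1) : ℕ),
      Nat.le_add_left 1 k, Nat.succ_lt_succ (Finset.mem_range.1 hk), ?_⟩
    rw [map_mul, map_pow, map_natCast, mul_assoc]
  d l := by
    refine ⟨(l + 1 : ℕ), fun t => ?_⟩
    rw [pow_one]
    exact D.diff_pow_d he hx l t

/-- The operators are defined by the explicit sum Σ (-1)^q x^(p) y^(q), where x and y are the right
and left actions of the variable. Their properties follow from those of the divided powers of x and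
y. -/
theorem isDiagonalPowers_dividedPower (he : Even e) {X : ℕ → B}
    (hX : ∀ m : ℕ, X m ∈ B.gr (m * e)) (h0 : X 0 = 1)
    (hmul : ∀ m l, X m * X l = (m + l).choose m • X (m + l))
    (hd : ∀ m, B.d (X (m + 1)) = X m * B.d (X 1)) :
    IsDiagonalPowers D e X
      (subDividedPower (fun p => E.rightAct (X p)) fun q => D.L (X q)) := by
  have heven : ∀ m : ℕ, Even ((m : ℤ) * e) := fun m => he.mul_left _
  have ha : ∀ p q, E.rightAct (X p) * E.rightAct (X q)
      = (p + q).choose p • E.rightAct (X (p + q)) := fun p q => by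
    rw [← map_mul, hmul, map_nsmul]
  have hb : ∀ p q, D.L (X p) * D.L (X q) = (p + q).choose p • D.L (X (p + q)) := fun p q => by
    rw [← map_mul, hmul, map_nsmul]
  have hab : ∀ p b, Commute (E.rightAct (X p)) (D.L b) := fun p b =>
    D.rightAct_comm_L_of_even (heven p) (hX p) b
  have hz : subDividedPower (fun p => E.rightAct (X p)) (fun q => D.L (X q)) 0 = 1 :=
    subDividedPower_zero (by simp [h0]) (by simp [h0])
  refine ⟨fun l => ?_, hz, fun ho => absurd he (Int.not_even_iff_odd.2 ho), fun l l' => ?_,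
    fun l => ?_, fun l hl => ?_, fun l => ?_⟩
  · rw [subDividedPower]
    refine Submodule.sum_mem _ fun y hy => zsmul_mem ?_ _
    rw [← mem_antidiagonal.1 hy]
    have := D.mul_mem_gen (D.rightAct_mem_gen (hX y.1)) (D.L_mem_gen (hX y.2))
    rwa [← add_mul, ← Nat.cast_add] at this
  · exact ⟨((l + l').choose l : ℕ), by
      rw [subDividedPower_mul ha hb (fun p q => hab p _), natCast_zsmul]⟩
  · have hmem : ((l, 0) : ℕ × ℕ) ∈ antidiagonal l := by simp
    have h1 := Finset.sum_erase_eq_sub (f := fun y : ℕ × ℕ =>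
      (-1 : ℤ) ^ y.2 • (E.rightAct (X y.1) * D.L (X y.2))) hmem
    simp only [h0, map_one, mul_one, pow_zero, one_smul] at h1
    rw [subDividedPower, ← h1]
    refine Submodule.sum_mem _ fun y hy => ?_
    rw [Finset.mem_erase, mem_antidiagonal] at hy
    have hlt : y.1 < l := by
      by_contra hlt
      exact hy.1 (Prod.ext (by simp only; omega) (by simp only; omega))
    refine zsmul_mem (?_ : E.rightAct (X y.1) * D.L (X y.2) ∈ _) _
    exact Submodule.subset_span ⟨y.1, X y.2, hlt, rfl⟩
  -- The extreme terms of this sum are left multiplication by `X l` and the operator `T l`; those in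
  -- between have exponent strictly between 0 and `l`.
  · have h1 := sum_subDividedPower_mul (a := fun p => E.rightAct (X p)) hb (by simp [h0]) l
    have hmem : ((l, 0) : ℕ × ℕ) ∈ (antidiagonal l).erase (0, l) := by
      rw [Finset.mem_erase, mem_antidiagonal, ne_eq, Prod.mk.injEq]
      simp only
      omega
    have hmem' : ((0, l) : ℕ × ℕ) ∈ antidiagonal l := by simp
    rw [← Finset.add_sum_erase _ _ hmem', ← Finset.add_sum_erase _ _ hmem] at h1
    simp only [hz, h0, map_one, one_mul, mul_one] at h1
    rw [← h1, sub_sub, ← add_assoc, add_sub_cancel_left]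
    refine Submodule.sum_mem _ fun y hy => ?_
    rw [Finset.mem_erase, Finset.mem_erase, mem_antidiagonal, ne_eq, ne_eq, Prod.ext_iff,
      Prod.ext_iff] at hy
    simp only at hy
    exact Submodule.subset_span ⟨y.1, X y.2, by omega, by omega, rfl⟩
  · refine ⟨1, fun t => ?_⟩
    rw [one_smul]
    set f := B.d (X 1) with hf
    have hd0 : B.d (X 0) = 0 := by rw [h0, B.d_one]
    have hterm : ∀ p q t, E.d ((E.rightAct (X p) * D.L (X q)).unop t)
        = (E.rightAct (X p) * D.L (X q)).unop (E.d t)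
          + (E.rightAct (B.d (X p)) * D.L (X q)
            + E.rightAct (X p) * D.L (B.d (X q))).unop (signOp E.isInternal t) := by
      intro p q t
      have hs := D.gen_signOp (D.rightAct_mem_gen (hX p)) t
      rw [Int.negOnePow_even _ (heven p), Units.val_one, one_smul] at hs
      change E.d ((D.L (X q)).unop ((E.rightAct (X p)).unop t))
        = (D.L (X q)).unop ((E.rightAct (X p)).unop (E.d t))
          + ((D.L (X q)).unop ((E.rightAct (B.d (X p))).unop (signOp E.isInternal t))
            + (D.L (B.d (X q))).unop ((E.rightAct (X p)).unop (signOp E.isInternal t)))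
      rw [D.L_d (hX q), rightAct_d, hs, map_add, add_assoc]
    -- Since d(x^(p+1)) = x^(p) dx, lowering either index gives a sum over p + q = l. The shift of q
    -- changes the sign, so the two halves combine to the difference of the actions of dx.
    have hsum : ∑ y ∈ antidiagonal (l + 1), (-1 : ℤ) ^ y.2 •
          (E.rightAct (B.d (X y.1)) * D.L (X y.2) + E.rightAct (X y.1) * D.L (B.d (X y.2)))
        = subDividedPower (fun p => E.rightAct (X p)) (fun q => D.L (X q)) l
          * (E.rightAct f - D.L f) := by
      simp only [smul_add, Finset.sum_add_distrib]
      rw [Finset.Nat.sum_antidiagonal_succ, Finset.Nat.sum_antidiagonal_succ', hd0]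
      simp only [map_zero, zero_mul, mul_zero, smul_zero, zero_add, hd]
      rw [mul_sub, subDividedPower, Finset.sum_mul, Finset.sum_mul, sub_eq_add_neg,
        ← Finset.sum_neg_distrib]
      refine congrArg₂ _ (Finset.sum_congr rfl fun y _ => ?_) (Finset.sum_congr rfl fun y _ => ?_)
      · have hfc : E.rightAct f * D.L (X y.2) = D.L (X y.2) * E.rightAct f := by
          have h1 : f ∈ B.gr (((1 : ℕ) : ℤ) * e - 1) := B.d_mem (hX 1)
          have := D.rightAct_mul_L (hX y.2) h1
          rwa [Int.negOnePow_even _ ((heven y.2).mul_left _), Units.val_one, one_smul] at this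
        rw [map_mul, smul_mul_assoc, mul_assoc, mul_assoc, hfc]
      · rw [map_mul, smul_mul_assoc, pow_succ, mul_neg_one, neg_smul, mul_assoc]
    have hT : ∀ (s : ℕ × ℕ → (Module.End R E)ᵐᵒᵖ) (k : Finset (ℕ × ℕ)) (t : E),
        (∑ y ∈ k, (-1 : ℤ) ^ y.2 • s y).unop t = ∑ y ∈ k, (-1 : ℤ) ^ y.2 • (s y).unop t := by
      intro s k t
      exact map_sum (LinearMap.applyₗ t ∘ₗ (MulOpposite.opLinearEquiv R).symm.toLinearMap :
        (Module.End R E)ᵐᵒᵖ →ₗ[R] E) _ _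
    rw [← hsum, subDividedPower, hT, hT, hT, map_sum, ← Finset.sum_add_distrib]
    refine Finset.sum_congr rfl fun y _ => ?_
    rw [map_zsmul, hterm, smul_add]

end Diagonal

/-! ### Polynomial and free extensions -/

section Extensions

variable {A B : DGAlg.{u} R} {φ : A.Hom B} {n : ℕ} {deg : Fin n → ℤ}

theorem DGAlg.pow_mem {i : ℤ} {b : B} (hb : b ∈ B.gr i) (m : ℕ) : b ^ m ∈ B.gr (m * i) := by
  induction m with
  | zero => simpa using B.one_mem
  | succ m ih =>
    rw [pow_succ, Nat.cast_succ, add_mul, one_mul]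
    exact B.mul_mem ih hb

theorem DGAlg.pow_eq_zero_of_odd {i : ℤ} {b : B} (hi : Odd i) (hb : b ∈ B.gr i) {m : ℕ}
    (hm : 2 ≤ m) : b ^ m = 0 := by
  obtain ⟨k, rfl⟩ := Nat.exists_eq_add_of_le hm
  rw [pow_add, pow_two, B.mul_self_odd hi hb, zero_mul]

theorem IsPolynomialExtensionWith.isVariableExtension {X : Fin n → B}
    (h : IsPolynomialExtensionWith φ deg X) : IsVariableExtension φ deg fun i m => X i ^ m where
  deg_pos := h.deg_pos
  mem i m := B.pow_mem (h.mem i) m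
  zero i := pow_zero _
  odd i hi m hm := B.pow_eq_zero_of_odd hi (h.mem i) hm
  mul i m l := ⟨1, by rw [one_smul, pow_add]⟩
  basis := h.basis
  d_mem i := by
    simp only [pow_one]
    refine Algebra.adjoin_mono (Set.union_subset_union_right _ ?_) (h.d_mem i)
    rintro b ⟨j, hj, rfl⟩
    exact ⟨j, 1, hj, (pow_one _).symm⟩

theorem IsPolynomialExtensionWith.exists_isDiagonalPowers {X : Fin n → B}
    (h : IsPolynomialExtensionWith φ deg X) {N E : DGMod B} (D : Diagonal φ N E) (i : Fin n) :
    ∃ T, IsDiagonalPowers D (deg i) (fun m => X i ^ m) T := by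
  rcases Int.even_or_odd (deg i) with he | ho
  · exact ⟨_, D.isDiagonalPowers_pow he (h.mem i)⟩
  · exact ⟨_, D.isDiagonalPowers_of_odd (X := fun m => X i ^ m) ho
      (by simpa using h.mem i) (pow_zero _) fun l hl => B.pow_eq_zero_of_odd ho (h.mem i) hl⟩

theorem IsFreeExtensionWith.mem_one {X : Fin n → ℕ → B} (h : IsFreeExtensionWith φ deg X)
    (i : Fin n) : X i 1 ∈ B.gr (deg i) := by
  simpa using h.mem i 1

theorem IsFreeExtensionWith.isVariableExtension {X : Fin n → ℕ → B}
    (h : IsFreeExtensionWith φ deg X) : IsVariableExtension φ deg X where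
  deg_pos := h.deg_pos
  mem := h.mem
  zero := h.zero
  odd := h.odd
  mul i m l := by
    rcases Int.even_or_odd (deg i) with he | ho
    · exact ⟨((m + l).choose m : ℕ), by rw [h.even_mul i he, natCast_zsmul]⟩
    · match m, l with
      | 0, l => exact ⟨1, by simp [h.zero]⟩
      | m + 1, 0 => exact ⟨1, by simp [h.zero]⟩
      | 1, 1 => exact ⟨0, by rw [B.mul_self_odd ho (h.mem_one i), zero_smul]⟩
      | 1, l + 2 => exact ⟨0, by rw [h.odd i ho (l + 2) (by omega), mul_zero, zero_smul]⟩
      | m + 2, l + 1 => exact ⟨0, by rw [h.odd i ho (m + 2) (by omega), zero_mul, zero_smul]⟩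
  basis := h.basis
  d_mem := h.d_mem

theorem IsFreeExtensionWith.exists_isDiagonalPowers {X : Fin n → ℕ → B}
    (h : IsFreeExtensionWith φ deg X) {N E : DGMod B} (D : Diagonal φ N E) (i : Fin n) :
    ∃ T, IsDiagonalPowers D (deg i) (X i) T := by
  rcases Int.even_or_odd (deg i) with he | ho
  · exact ⟨_, D.isDiagonalPowers_dividedPower he (h.mem i) (h.zero i) (h.even_mul i he)
      (h.even_d i he)⟩
  · exact ⟨_, D.isDiagonalPowers_of_odd ho (h.mem_one i) (h.zero i) (h.odd i ho)⟩

end Extensions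

/-! ### Naïve liftability -/

section NaiveLifting

variable {A B : DGAlg.{u} R} {φ : A.Hom B} {n : ℕ} {deg : Fin n → ℤ} {X : Fin n → ℕ → B}

/-- A graded DG module with diagonal powers, over which Ext vanishes, splits off `N`. -/
theorem Diagonal.exists_section {N E : DGMod B} (D : Diagonal φ N E)
    (hX : IsVariableExtension φ deg X)
    (hT : ∀ i, ∃ T, IsDiagonalPowers D (deg i) (X i) T)
    (hu : Function.Bijective (Finsupp.lsum R fun m : Exponent deg =>
      (E.rightAct (monomial X m.1)).unop ∘ₗ D.j))
    (hbb : N.IsBoundedBelow) (hsf : N.IsSemifree)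
    (hExt : ∀ i : ℤ, 0 < i → Subsingleton (DGMod.Ext N N i)) : ∃ ρ : N ⟶ E, ρ ≫ D.π = 𝟙 N := by
  choose T hT using hT
  obtain ⟨ι, _, _, e, he, -⟩ := hsf
  choose k hk using he
  -- The B-linear extension of e_i ↦ e_i ⊗ 1 is a graded section of π. It need not commute with
  -- differentials, but π kills its boundary, which therefore lies in positive weight.
  let f : DGMod.HomDeg N E 0 := ⟨e.constr ℕ fun i => D.j (e i),
    DGMod.constr_mem_homDeg e hk 0 _ fun i => by
    rw [add_zero]
    exact D.j_mem (hk i)⟩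
  have hf : ∀ x, D.π.toLinearMap (f.1 x) = x := by
    have : D.π.toLinearMap ∘ₗ f.1 = LinearMap.id := e.ext fun i => by
      rw [LinearMap.comp_apply, e.constr_basis, D.π_j, LinearMap.id_apply]
    exact fun x => LinearMap.congr_fun this x
  obtain ⟨ρ, hρ⟩ := (D.cellStructure hX hT hu).exists_hom hk hbb hExt f fun x => by
    rw [D.mem_filt_one, map_sub, D.π.map_d, hf, hf, sub_self]
  refine ⟨ρ, DGMod.Hom.ext (LinearMap.ext fun x => ?_)⟩
  have := (D.mem_filt_one hX hT hu _).1 (hρ x)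
  rw [map_sub, hf, sub_eq_zero] at this
  exact this

theorem bijective_diagonal (hX : IsVariableExtension φ deg X) (N : DGMod B) :
    Function.Bijective (Finsupp.lsum R fun m : Exponent deg =>
      ((baseChange φ (restrict φ N)).rightAct (monomial X m.1)).unop ∘ₗ (diagonal φ N).j) := by
  have h := hX.basis.bijective_tensor φ hX.mem (restrict φ N)
  have : (fun m : Exponent deg => (tmkBilin φ (restrict φ N)).flip (monomial X m.1))
      = fun m : Exponent deg =>
        tensorAct φ (restrict φ N) (monomial X m.1) ∘ₗ (tmkBilin φ (restrict φ N)).flip 1 := by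
    funext m
    ext x
    simp
  rw [this] at h
  exact h

theorem isNaivelyLiftable (hX : IsVariableExtension φ deg X) {N : DGMod B}
    (hT : ∀ i, ∃ T, IsDiagonalPowers (diagonal φ N) (deg i) (X i) T)
    (hbb : N.IsBoundedBelow) (hsf : N.IsSemifree)
    (hExt : ∀ i : ℤ, 0 < i → Subsingleton (DGMod.Ext N N i)) : IsNaivelyLiftable φ N :=
  (diagonal φ N).exists_section hX hT (bijective_diagonal hX N) hbb hsf hExt

end NaiveLifting

/-! ### Direct summands -/

section Summand

theorem exists_sum_gproj {M : Type u} [AddCommGroup M] [Module R M] {gr : ℤ → Submodule R M}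
    (h : DirectSum.IsInternal gr) (x : M) :
    ∃ s : Finset ℤ, x = ∑ i ∈ s, gproj h i x := by
  classical
  let S : Submodule R M :=
    -- Allowing every larger finite set makes the condition stable under addition, by taking unions.
    { carrier := {x | ∃ s : Finset ℤ, ∀ t, s ⊆ t → x = ∑ i ∈ t, gproj h i x}
      zero_mem' := ⟨∅, fun t _ => by simp⟩
      add_mem' := by
        rintro x y ⟨s, hs⟩ ⟨s', hs'⟩
        refine ⟨s ∪ s', fun t ht => ?_⟩
        simp only [map_add, Finset.sum_add_distrib]
        rw [← hs t (Finset.union_subset_left ht), ← hs' t (Finset.union_subset_right ht)]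
      smul_mem' := by
        rintro r x ⟨s, hs⟩
        refine ⟨s, fun t ht => ?_⟩
        simp only [map_smul, ← Finset.smul_sum]
        rw [← hs t ht] }
  obtain ⟨s, hs⟩ := mem_of_gr_le h (S := S) (fun i y hy => ⟨{i}, fun t ht => by
    simp [gproj_of_mem h hy, Finset.singleton_subset_iff.1 ht]⟩) x
  exact ⟨s, hs s subset_rfl⟩

namespace DGMod

variable {B : DGAlg.{u} R} {N E : DGMod B}

theorem Hom.gproj_comm (f : E ⟶ N) (i : ℤ) (t : E) :
    f.toLinearMap (gproj E.isInternal i t) = gproj N.isInternal i (f.toLinearMap t) := by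
  have : f.toLinearMap.restrictScalars R ∘ₗ gproj E.isInternal i
      = gproj N.isInternal i ∘ₗ f.toLinearMap.restrictScalars R :=
    eq_of_homogeneous E.isInternal fun j x hx => by
      simp only [LinearMap.comp_apply, LinearMap.coe_restrictScalars, gproj_of_mem _ hx,
        gproj_of_mem _ (f.map_mem hx)]
      split_ifs
      · rfl
      · rw [map_zero]
  exact LinearMap.congr_fun this t

/-- The kernel of a homomorphism of DG modules. -/
noncomputable def kernel (f : E ⟶ N) : DGMod B where
  carrier := LinearMap.ker f.toLinearMap
  gr i := (E.gr i).comap ((LinearMap.ker f.toLinearMap).subtype.restrictScalars R)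
  isInternal := by
    let p : ℤ → LinearMap.ker f.toLinearMap →ₗ[R] LinearMap.ker f.toLinearMap := fun i =>
      { toFun := fun t => ⟨gproj E.isInternal i t, by
          rw [LinearMap.mem_ker, Hom.gproj_comm, LinearMap.mem_ker.1 t.2, map_zero]⟩
        map_add' := fun t t' => Subtype.ext (map_add (gproj E.isInternal i) _ _)
        map_smul' := fun r t => Subtype.ext (map_smul (gproj E.isInternal i) r t.1) }
    refine isInternal_of_proj _ p (fun i t ht => Subtype.ext ?_) (fun i k hk t ht =>
      Subtype.ext ?_) ?_
    · exact gproj_self E.isInternal ht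
    · exact (gproj_of_mem E.isInternal ht).trans (if_neg hk)
    · refine eq_top_iff.2 fun t _ => ?_
      obtain ⟨s, hs⟩ := exists_sum_gproj E.isInternal t.1
      have : t = ∑ i ∈ s, p i t := Subtype.ext (by
        rw [AddSubmonoidClass.coe_finsetSum]
        exact hs)
      rw [this]
      exact Submodule.sum_mem _ fun i _ =>
        Submodule.mem_iSup_of_mem i (gproj_mem E.isInternal i t.1)
  smul_mem hx ha := E.smul_mem (Submodule.mem_comap.1 hx) ha
  d :=
    { toFun := fun t => ⟨E.d t, by
        rw [LinearMap.mem_ker, f.map_d, LinearMap.mem_ker.1 t.2, map_zero]⟩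
      map_add' := fun t t' => Subtype.ext (map_add E.d _ _)
      map_smul' := fun r t => Subtype.ext (map_smul E.d r t.1) }
  d_mem hx := E.d_mem (Submodule.mem_comap.1 hx)
  d_d t := Subtype.ext (E.d_d t.1)
  leibniz hx a := Subtype.ext (E.leibniz (Submodule.mem_comap.1 hx) a)

/-- The inclusion of the kernel. -/
noncomputable def kernelι (f : E ⟶ N) : kernel f ⟶ E where
  toLinearMap := (LinearMap.ker f.toLinearMap).subtype
  map_mem hx := hx
  map_d _ := rfl

/-- The complement is the kernel of `f`, with t = ρ f t + (t - ρ f t). -/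
theorem isDirectSummand_of_section {ρ : N ⟶ E} {f : E ⟶ N} (h : ρ ≫ f = 𝟙 N) :
    N.IsDirectSummand E := by
  have h' : ∀ x, f.toLinearMap (ρ.toLinearMap x) = x := fun x =>
    congrArg (fun g : N ⟶ N => g.toLinearMap x) h
  refine ⟨kernel f, ρ, kernelι f, ?_, ?_⟩
  · rintro ⟨x, y⟩ ⟨x', y'⟩ hxy
    change ρ.toLinearMap x + y.1 = ρ.toLinearMap x' + y'.1 at hxy
    have hx : x = x' := by
      have := congrArg f.toLinearMap hxy
      rwa [map_add, map_add, h', h', LinearMap.mem_ker.1 y.2, LinearMap.mem_ker.1 y'.2, add_zero,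
        add_zero] at this
    subst hx
    exact Prod.ext rfl (Subtype.ext (add_left_cancel hxy))
  · intro t
    refine ⟨⟨f.toLinearMap t, ⟨t - ρ.toLinearMap (f.toLinearMap t), ?_⟩⟩, ?_⟩
    · rw [LinearMap.mem_ker, map_sub, h', sub_self]
    · exact add_sub_cancel _ _

end DGMod

end Summand

/-! ### Restriction of semifree DG modules -/

section RestrictSemifree

variable {A B : DGAlg.{u} R} {φ : A.Hom B} {n : ℕ} {deg : Fin n → ℤ} {X : Fin n → ℕ → B}

instance : Countable (Exponent deg) :=
  inferInstanceAs (Countable {m : Fin n → ℕ // ∀ i, Odd (deg i) → m i ≤ 1})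

theorem Exponent.degree_nonneg (hdeg : ∀ i, 0 < deg i) (m : Exponent deg) : 0 ≤ m.degree :=
  Finset.sum_nonneg fun i _ => mul_nonneg (Int.natCast_nonneg _) (hdeg i).le

/-- A homogeneous element is a combination of monomials of at most the same degree. -/
theorem IsVariableExtension.exists_eq_sum (hX : IsVariableExtension φ deg X) {k : ℤ} {b : B}
    (hb : b ∈ B.gr k) : ∃ (s : Finset (Exponent deg)) (a : Exponent deg → A),
      b = ∑ m ∈ s, monomial X m.1 * φ (a m) ∧ ∀ m : Exponent deg, k < m.degree → a m = 0 := by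
  obtain ⟨c, rfl⟩ := hX.basis.2 b
  -- Each coefficient is cut down to the degree it must have; if that degree is negative, the
  -- coefficient is zero.
  refine ⟨c.support, fun m => gproj A.isInternal (k - m.degree) (c m), ?_, fun m hm => ?_⟩
  · have hp : ∀ (m : Exponent deg) (a : A), gproj B.isInternal k (monomial X m.1 * φ a)
        = monomial X m.1 * φ (gproj A.isInternal (k - m.degree) a) := fun m a => by
      have hm : monomial X m.1 ∈ B.gr m.degree := monomial_mem_gr hX.mem m.1
      have : gproj B.isInternal k ∘ₗ LinearMap.mulLeft R (monomial X m.1) ∘ₗ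
            φ.toAlgHom.toLinearMap
          = LinearMap.mulLeft R (monomial X m.1) ∘ₗ φ.toAlgHom.toLinearMap ∘ₗ
            gproj A.isInternal (k - m.degree) :=
        eq_of_homogeneous A.isInternal fun i a ha => by
          simp only [LinearMap.comp_apply, LinearMap.mulLeft_apply, AlgHom.toLinearMap_apply,
            gproj_of_mem _ ha, gproj_of_mem _ (B.mul_mem hm (φ.map_mem ha))]
          by_cases h : m.degree + i = k
          · rw [if_pos h, if_pos (by omega)]
          · rw [if_neg h, if_neg (by omega), map_zero, mul_zero]
      exact LinearMap.congr_fun this a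
    have hc := gproj_self B.isInternal hb
    simp only [Finsupp.sum, map_sum, hp] at hc
    exact hc.symm
  · have := gproj_mem A.isInternal (k - m.degree) (c m)
    rwa [A.gr_neg _ (by omega)] at this

/-- The `A`-module structure on `B`, acting on the right. -/
abbrev DGAlg.Hom.moduleOp (φ : A.Hom B) : Module (A : Type u)ᵐᵒᵖ (B : Type u)ᵐᵒᵖ :=
  Module.compHom _ φ.toAlgHom.toRingHom.op

/-- The monomials, as a basis of the right `A`-module `B`. -/
theorem MonomialBasis.exists_basis (h : MonomialBasis φ deg X) :
    letI := φ.moduleOp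
    ∃ b : Module.Basis (Exponent deg) (A : Type u)ᵐᵒᵖ (B : Type u)ᵐᵒᵖ,
      ∀ m, b m = MulOpposite.op (monomial X m.1) := by
  let _ := φ.moduleOp
  let l := Finsupp.linearCombination (A : Type u)ᵐᵒᵖ
    fun m : Exponent deg => MulOpposite.op (monomial X m.1)
  let o : (Exponent deg →₀ (A : Type u)ᵐᵒᵖ) ≃ (Exponent deg →₀ A) :=
    Finsupp.mapRange.equiv MulOpposite.opEquiv.symm rfl
  have hl : ⇑l = (MulOpposite.op ∘
      (fun c : Exponent deg →₀ A => c.sum fun m a => monomial X m.1 * φ a)) ∘ o := by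
    funext c
    have hsum : (o c).sum (fun m a => monomial X m.1 * φ a)
        = c.sum fun m a => monomial X m.1 * φ a.unop :=
      Finsupp.sum_mapRange_index (f := MulOpposite.unop) (hf := rfl)
        fun m => by rw [map_zero, mul_zero]
    rw [Function.comp_apply, Function.comp_apply, hsum]
    exact (map_sum (MulOpposite.opAddEquiv : B ≃+ (B : Type u)ᵐᵒᵖ) _ _).symm
  have hbij : Function.Bijective l := by
    rw [hl]
    exact (MulOpposite.op_bijective.comp h).comp o.bijective
  refine ⟨Module.Basis.ofRepr (LinearEquiv.ofBijective l hbij).symm, fun m => ?_⟩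
  simp [l, Module.Basis.coe_ofRepr]

/-- The restriction of a semifree DG module along a polynomial or free extension is semifree. -/
theorem isSemifree_restrict (hX : IsVariableExtension φ deg X) {N : DGMod B}
    (hN : N.IsSemifree) : (restrict φ N).IsSemifree := by
  obtain ⟨ι, _, _, e, he, hd⟩ := hN
  let _ := φ.moduleOp
  let _ : Module (B : Type u)ᵐᵒᵖ (restrict φ N) := inferInstanceAs (Module (B : Type u)ᵐᵒᵖ N)
  have : IsScalarTower (A : Type u)ᵐᵒᵖ (B : Type u)ᵐᵒᵖ (restrict φ N) :=
    ⟨fun a b x => mul_smul (MulOpposite.op (φ a.unop)) b (show N from x)⟩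
  obtain ⟨b, hb⟩ := hX.basis.exists_basis
  let e' : Module.Basis ι (B : Type u)ᵐᵒᵖ (restrict φ N) := e
  let E : Module.Basis (Exponent deg × ι) (A : Type u)ᵐᵒᵖ (restrict φ N) := b.smulTower e'
  have hE : ∀ p, E p = restrictAct φ N (monomial X p.1.1) (e' p.2) := fun p => by
    rw [Module.Basis.smulTower_apply, hb]
    rfl
  obtain ⟨enc, henc⟩ := exists_injective_nat (Exponent deg)
  -- Products are ordered first by the basis element of N, then by the degree of the monomial. The
  -- enumeration only breaks ties.
  let r : Exponent deg × ι → ι ×ₗ ℕ ×ₗ ℕ := fun p =>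
    toLex (p.2, toLex (p.1.degree.toNat, enc p.1))
  have hr : Function.Injective r := by
    rintro ⟨m, i⟩ ⟨m', i'⟩ h
    have h1 := congrArg ofLex h
    simp only [r, ofLex_toLex, Prod.mk.injEq, EmbeddingLike.apply_eq_iff_eq] at h1
    exact Prod.ext (henc h1.2.2) h1.1
  let lo : LinearOrder (Exponent deg × ι) := LinearOrder.lift' r hr
  have hlt : ∀ p q : Exponent deg × ι, p < q ↔ r p < r q := fun _ _ => Iff.rfl
  have hwf : WellFoundedLT (Exponent deg × ι) := ⟨InvImage.wf r wellFounded_lt⟩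
  refine ⟨Exponent deg × ι, lo, hwf, E, fun p => ?_, fun p => ?_⟩
  · obtain ⟨k, hk⟩ := he p.2
    rw [hE]
    exact ⟨_, restrictAct_mem φ N hk (monomial_mem_gr hX.mem p.1.1)⟩
  · obtain ⟨m, i⟩ := p
    set S := Submodule.span (A : Type u)ᵐᵒᵖ (E '' {q | q < (m, i)}) with hS
    have hmemS : ∀ (m' : Exponent deg) (i' : ι) (a : A), (m', i') < (m, i) →
        restrictAct φ N (monomial X m'.1 * φ a) (e' i') ∈ S := fun m' i' a h => by
      rw [restrictAct_mul, restrictAct_map, ← hE (m', i')]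
      exact Submodule.smul_mem _ _ (Submodule.subset_span ⟨_, h, rfl⟩)
    have hleS : ∀ (i' : ι), i' < i → ∀ c : B, restrictAct φ N c (e' i') ∈ S := by
      intro i' hi' c
      obtain ⟨c, rfl⟩ := hX.basis.2 c
      simp only [Finsupp.sum, map_sum, LinearMap.sum_apply]
      refine Submodule.sum_mem _ fun m' _ => hmemS m' i' _ ?_
      rw [hlt, Prod.Lex.lt_iff]
      exact Or.inl hi'
    have h1 : ∀ y ∈ Submodule.span (B : Type u)ᵐᵒᵖ (e '' {j | j < i}), ∀ c : B,
        restrictAct φ N c (show restrict φ N from y) ∈ S := by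
      intro y hy
      induction hy using Submodule.span_induction with
      | mem y hy =>
        obtain ⟨i', hi', rfl⟩ := hy
        exact hleS i' hi'
      | zero =>
        intro c
        have : restrictAct φ N c 0 ∈ S := by
          rw [map_zero]
          exact zero_mem _
        exact this
      | add y z _ _ hy hz =>
        intro c
        have := add_mem (hy c) (hz c)
        rw [← map_add] at this
        exact this
      | smul b y _ hy =>
        intro c
        have := hy (b.unop * c)
        rw [restrictAct_mul] at this
        exact this
    obtain ⟨k, hk⟩ := he i
    have hm : monomial X m.1 ∈ B.gr m.degree := monomial_mem_gr hX.mem m.1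
    obtain ⟨s, a, hsum, ha⟩ := hX.exists_eq_sum (B.d_mem hm)
    have hk' : e' i ∈ (restrict φ N).gr k := hk
    rw [hE, restrictAct_d φ N hk']
    -- In d(e X^m), the term d(e) X^m involves smaller basis elements of N, and e d(X^m) expands in
    -- monomials of degree at most |m| - 1.
    refine add_mem (h1 _ (hd i) _) (zsmul_mem ?_ _)
    rw [hsum, map_sum, LinearMap.sum_apply]
    refine Submodule.sum_mem _ fun m' _ => ?_
    by_cases hm' : m.degree - 1 < m'.degree
    · rw [ha m' hm', map_zero, mul_zero, map_zero, LinearMap.zero_apply]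
      exact zero_mem _
    · refine hmemS m' i _ ?_
      rw [hlt, Prod.Lex.lt_iff]
      refine Or.inr ⟨rfl, ?_⟩
      rw [Prod.Lex.lt_iff]
      refine Or.inl ?_
      change m'.degree.toNat < m.degree.toNat
      have := m'.degree_nonneg hX.deg_pos
      omega

end RestrictSemifree

/-- A semifree module is its own semifree resolution, so its derived base change is the ordinary
one. -/
theorem isLiftable_baseChange_of_isSemifree {A B : DGAlg.{u} R} (φ : A.Hom B) {M : DGMod A}
    (hM : M.IsSemifree) : IsLiftable φ (baseChange φ M) := by
  refine ⟨M, M, 𝟙 M, hM, ?_, ⟨Iso.refl _⟩⟩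
  have : ⇑(DGMod.Hom.homologyMap (𝟙 M)) = id := by
    funext x
    obtain ⟨x, rfl⟩ := Submodule.Quotient.mk_surjective _ x
    rfl
  change Function.Bijective (DGMod.Hom.homologyMap (𝟙 M))
  rw [this]
  exact Function.bijective_id

end DGLift

/-! ### The theorem -/

theorem mainTheorem1 {R : Type v} [CommRing R] (A B : DGLift.DGAlg.{u} R)
    (φ : DGLift.DGAlg.Hom A B) (n : ℕ) (hn : 0 < n)
    (hB : DGLift.IsPolynomialExtension φ n ∨
      (Nonempty (DGLift.DividedPowerStructure A) ∧ DGLift.IsFreeExtension φ n))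
    (N : DGLift.DGMod B) (hbb : N.IsBoundedBelow) (hsf : N.IsSemifree)
    (hExt : ∀ i : ℤ, 0 < i → Subsingleton (DGLift.DGMod.Ext N N i)) :
    DGLift.IsNaivelyLiftable φ N ∧
      ∃ N' : DGLift.DGMod B, DGLift.IsLiftable φ N' ∧ N.IsDirectSummand N' := by
  obtain ⟨deg, X, hX, hT⟩ : ∃ (deg : Fin n → ℤ) (X : Fin n → ℕ → B),
      DGLift.IsVariableExtension φ deg X ∧ ∀ i, ∃ T,
        DGLift.IsDiagonalPowers (DGLift.diagonal φ N) (deg i) (X i) T := by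
    rcases hB with ⟨deg, X, h⟩ | ⟨-, deg, X, h⟩
    · exact ⟨deg, _, h.isVariableExtension, h.exists_isDiagonalPowers _⟩
    · exact ⟨deg, X, h.isVariableExtension, h.exists_isDiagonalPowers _⟩
  have hlift := DGLift.isNaivelyLiftable hX hT hbb hsf hExt
  -- The liftable module containing N as a summand is N|_A ⊗_A B itself.
  refine ⟨hlift, _, DGLift.isLiftable_baseChange_of_isSemifree φ
    (DGLift.isSemifree_restrict hX hsf), ?_⟩
  obtain ⟨ρ, hρ⟩ := hlift
  exact DGLift.DGMod.isDirectSummand_of_section hρ
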